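/- Let $K\subset\mathbb{C}$ be a finite abelian extension of $\mathbb{Q}$, let $V$ be a finite-dimensional $K$-vector space and let $W\subset \mathrm{GL}(V)$ be a finite group generated by pseudo-reflections and acting irreducibly on $V$. Let $\mathcal{A}$ be the set of reflecting hyperplanes in $V_{\mathbb{C}}=\mathbb{C}\otimes_K V$, let $V^{\mathrm{reg}}=V_{\mathbb{C}}\setminus\bigcup_{H\in\mathcal{A}}H$, let $x_0\in V^{\mathrm{reg}}$, and let $B=\pi_1(V^{\mathrm{reg}}/W,x_0)$ be the braid group. For an orbit $\mathcal{C}\in\mathcal{A}/W$ let $e_{\mathcal{C}}$ be the order of the pointwise stabilizer in $W$ of any $H\in\mathcal{C}$, and let $\mathbf{S}_{\mathcal{C}}\subset B$ be the set of generators of the monodromy around the images of the hyperplanes in $\mathcal{C}$. Put $\zeta_e=\exp(2\pi i/e)$. The generic Hecke algebra $\mathcal{H}(W)$ is the quotient of the group algebra $\mathbb{Z}[\mathbf{u},\mathbf{u}^{-1}]B$, with indeterminates $\mathbf{u}=(u_{\mathcal{C},j})_{\mathcal{C}\in\mathcal{A}/W,\,0\le j<e_{\mathcal{C}}}$, by the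 relations $\prod_{j}(\mathbf{s}-u_{\mathcal{C},j})=0$ for $\mathbf{s}\in\mathbf{S}_{\mathcal{C}}$. Assume that $\mathcal{H}(W)$ is a free $\mathbb{Z}[\mathbf{u},\mathbf{u}^{-1}]$-module of rank $|W|$ and that there is a unique symmetrizing form $t$ on $\mathcal{H}(W)$ such that (i) the specialization $u_{\mathcal{C},j}\mapsto\zeta_{e_{\mathcal{C}}}^j$ maps $t$ to the canonical form $w\mapsto\delta_{w,1}$ on the group algebra of $W$, and (ii) $t(b^{-1})^*=t(b\boldsymbol{\pi})/t(\boldsymbol{\pi})$ for all $b\in B$, where $^*$ inverts all the indeterminates and $\boldsymbol{\pi}\in B$ is the class of the loop $\tau\mapsto e^{2\pi i\tau}x_0$. Let $y$ be an indeterminate and $q=y^{|\mu(K)|}$, where $\mu(K)$ is the group of roots of unity of $K$. For a family of integers $\mathbf{m}=(m_{\mathcal{C},j})\in\mathcal{M}=\prod_{\mathcal{C}}\mathbb{Z}^{e_{\mathcal{C}}}$ let $\varphi_{\mathbf{m}}$ be the specialization $u_{\mathcal{C},j}\mapsto\zeta_{e_{\mathcal{C}}}^jq^{m_{\mathcal{C},j}}$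 and let $\mathcal{H}_{\mathbf{m}}$ be the corresponding specialization of $\mathcal{H}(W)$, over $\mathbb{Z}_K[y,y^{-1}]$. Let $\Lambda$ be an indexing set for the irreducible representations of $W$ over $K$; by Tits' deformation theorem ($y\mapsto1$), $\mathrm{Irr}(K(y)\mathcal{H}_{\mathbf{m}})=\{V^{\lambda}_{\varphi_{\mathbf{m}}}\mid\lambda\in\Lambda\}$. Let $s^{\varphi_{\mathbf{m}}}_\lambda\in K(y)$ be the Schur elements, defined by $\varphi_{\mathbf{m}}(t)=\sum_{\lambda}\chi_{V^\lambda_{\varphi_{\mathbf{m}}}}/s^{\varphi_{\mathbf{m}}}_\lambda$, and let $a^{\varphi_{\mathbf{m}}}_\lambda=-\mathrm{val}_y(s^{\varphi_{\mathbf{m}}}_\lambda)/|\mu(K)|$, where $\mathrm{val}_y$ is the order at $y=0$. The group $G=\prod_{\mathcal{C}}\mathbb{Z}/e_{\mathcal{C}}\mathbb{Z}$ acts on $\mathcal{M}$ by $(\mathbf{g}.\mathbf{m})_{\mathcal{C},j}=m_{\mathcal{C},j+g_{\mathcal{C}}}$ (indices modulo $e_{\mathcal{C}}$). There are isomorphisms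 $\Gamma^{\mathbf{g}}:\mathcal{H}_{\mathbf{m}}\to\mathcal{H}_{\mathbf{g}.\mathbf{m}}$ with $\Gamma^{\mathbf{g}}(\mathbf{s})=\zeta_{e_{\mathcal{C}}}^{g_{\mathcal{C}}}\mathbf{s}$ for $\mathbf{s}\in\mathbf{S}_{\mathcal{C}}$, and they induce an action $(\mathbf{g},\lambda)\mapsto\lambda^{\mathbf{g}}$ of $G$ on $\Lambda$, independent of $\mathbf{m}$: the representation of $\mathcal{H}_{\mathbf{g}.\mathbf{m}}$ on $V^{\lambda}_{\varphi_{\mathbf{g}.\mathbf{m}}}$ composed with $\Gamma^{\mathbf{g}}$ is afforded by $V^{\lambda^{\mathbf{g}}}_{\varphi_{\mathbf{m}}}$. Let $\theta:\mathbb{Z}_K[y,y^{-1}]\to k$ be a ring homomorphism to a field $k$ that is the field of fractions of the image of $\theta$, and write $k\mathcal{H}_{\mathbf{m}}$ for the specialization of $\mathcal{H}_{\mathbf{m}}$ via $\theta$. Let $[V^\lambda_{\varphi_{\mathbf{m}}}:M]$, for $\lambda\in\Lambda$ and $M\in\mathrm{Irr}(k\mathcal{H}_{\mathbf{m}})$,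 be the decomposition numbers associated with $\theta$. A subset $\mathcal{B}\subset\Lambda$ is a basic set of $k\mathcal{H}_{\mathbf{m}}$ with respect to $\theta$ if there is a map $M\mapsto\lambda_M$ from $\mathrm{Irr}(k\mathcal{H}_{\mathbf{m}})$ to $\Lambda$ which is a bijection onto $\mathcal{B}$ and is such that, for all $M$, $[V^{\lambda_M}_{\varphi_{\mathbf{m}}}:M]=1$, and $a^{\varphi_{\mathbf{m}}}_\mu>a^{\varphi_{\mathbf{m}}}_{\lambda_M}$ for all $\mu\ne\lambda_M$ with $[V^{\mu}_{\varphi_{\mathbf{m}}}:M]\neq0$. Let $\mathbf{m}\in\mathcal{M}$ be such that $k\mathcal{H}_{\mathbf{m}}$ is split and admits a basic set $\mathcal{B}(\varphi_{\mathbf{m}})\subset\Lambda$ with respect to $\theta$. Then, for all $\mathbf{g}\in G$, the algebra $k\mathcal{H}_{\mathbf{g}.\mathbf{m}}$ admits a basic set $\mathcal{B}(\varphi_{\mathbf{g}.\mathbf{m}})\subset\Lambda$ with respect to $\theta$. Moreover, this basic set is unique and $$\mathcal{B}(\varphi_{\mathbf{g}.\mathbf{m}})=\{\lambda^{\mathbf{g}^{-1}}\mid\lambda\in\mathcal{B}(\varphi_{\mathbf{m}})\}.$$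 -/

import Mathlib

open scoped NumberField LaurentPolynomial

noncomputable section

namespace CycHecke

/-! ### Complex reflection groups

`V = K^n` for a number field `K` with a fixed embedding into `ℂ`, and `W` is a subgroup of
`GL_n(K)`.  The hyperplanes and the regular points live in `ℂ ⊗ V = ℂ^n`. -/

section Reflection

variable {K : Type*} [Field K] [Algebra K ℂ] {n : ℕ}

/-- The action of `w ∈ GL_n(K)` on `ℂ^n`. -/
def act (w : GL (Fin n) K) : (Fin n → ℂ) →ₗ[ℂ] (Fin n → ℂ) :=
  Matrix.toLin' ((w : Matrix (Fin n) (Fin n) K).map (algebraMap K ℂ))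

theorem act_one : act (1 : GL (Fin n) K) = LinearMap.id := by
  simp [act, Matrix.map_one]

theorem act_mul (v w : GL (Fin n) K) : act (v * w) = act v ∘ₗ act w := by
  simp [act, Matrix.map_mul, Matrix.toLin'_mul]

theorem act_inv_act (w : GL (Fin n) K) (x : Fin n → ℂ) : act w⁻¹ (act w x) = x := by
  rw [← LinearMap.comp_apply, ← act_mul, inv_mul_cancel, act_one, LinearMap.id_apply]

/-- The subspace of points of `ℂ^n` fixed by `w`. -/
def fixedSpace (w : GL (Fin n) K) : Submodule ℂ (Fin n → ℂ) :=
  LinearMap.eqLocus (act w) LinearMap.id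

/-- A pseudo-reflection: its fixed space is a hyperplane. -/
def IsPseudoReflection (w : GL (Fin n) K) : Prop :=
  Module.finrank ℂ (fixedSpace w) + 1 = n

variable (W : Subgroup (GL (Fin n) K))

/-- `W` acts irreducibly on `K^n`. -/
def ActsIrreducibly : Prop :=
  0 < n ∧ ∀ U : Submodule K (Fin n → K),
    (∀ w ∈ W, ∀ v ∈ U, (w : Matrix (Fin n) (Fin n) K).mulVec v ∈ U) → U = ⊥ ∨ U = ⊤

/-- The set `𝒜` of reflecting hyperplanes of `W`. -/
def hyperplanes : Set (Submodule ℂ (Fin n → ℂ)) :=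
  {H | ∃ w ∈ W, IsPseudoReflection w ∧ H = fixedSpace w}

/-- Two reflecting hyperplanes are equivalent if they are conjugate under `W`. -/
def hyperplaneSetoid : Setoid (hyperplanes W) where
  r H H' := ∃ w ∈ W, H.1.map (act w) = H'.1
  iseqv :=
    { refl := fun H => ⟨1, W.one_mem, by simp [act_one]⟩
      symm := by
        rintro H H' ⟨w, hw, h⟩
        refine ⟨w⁻¹, W.inv_mem hw, ?_⟩
        rw [← h, ← Submodule.map_comp, ← act_mul, inv_mul_cancel, act_one, Submodule.map_id]
      trans := by
        rintro H H' H'' ⟨w, hw, h⟩ ⟨v, hv, h'⟩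
        refine ⟨v * w, W.mul_mem hv hw, ?_⟩
        rw [act_mul, Submodule.map_comp, h, h'] }

/-- The set `𝒜 / W` of orbits of reflecting hyperplanes. -/
def HypOrbit : Type := Quotient (hyperplaneSetoid W)

variable {W} in
/-- `e_𝒞`: the order of the pointwise stabilizer `W_H`, for any `H ∈ 𝒞`. -/
def ramif (C : HypOrbit W) : ℕ :=
  Nat.card {w : GL (Fin n) K // w ∈ W ∧ ∀ x ∈ (Quotient.out C).1, act w x = x}

/-- `V^reg`: the complement in `ℂ^n` of the reflecting hyperplanes. -/
def Vreg : Type := {x : Fin n → ℂ // ∀ H ∈ hyperplanes W, x ∉ H}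

instance : TopologicalSpace (Vreg W) := instTopologicalSpaceSubtype

/-- The orbit relation of `W` on `V^reg`. -/
def regSetoid : Setoid (Vreg W) where
  r x y := ∃ w ∈ W, act w x.1 = y.1
  iseqv :=
    { refl := fun x => ⟨1, W.one_mem, by simp [act_one]⟩
      symm := by
        rintro x y ⟨w, hw, h⟩
        exact ⟨w⁻¹, W.inv_mem hw, by rw [← h, act_inv_act]⟩
      trans := by
        rintro x y z ⟨w, hw, h⟩ ⟨v, hv, h'⟩
        exact ⟨v * w, W.mul_mem hv hw, by rw [act_mul, LinearMap.comp_apply, h, h']⟩ }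

/-- The orbit space `V^reg / W`, with the quotient topology. -/
def RegQuot : Type := Quotient (regSetoid W)

instance : TopologicalSpace (RegQuot W) := instTopologicalSpaceQuotient

variable {W}

/-- The projection `V^reg → V^reg / W`. -/
def regProj (x : Vreg W) : RegQuot W := Quotient.mk (regSetoid W) x

theorem continuous_regProj : Continuous (regProj (W := W)) := continuous_quotient_mk'

/-! ### The braid group -/

/-- The braid group `B = π₁(V^reg / W, x₀)`.  The product of two classes of loops is
"first the left one, then the right one"; Mathlib's `FundamentalGroup` composes in the other
order, hence the opposite group.  With this convention, sending the class of the image of a path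
from `x₀` to `w x₀` to `w` is a homomorphism `B → W`. -/
abbrev Braid (x₀ : Vreg W) : Type := (FundamentalGroup (RegQuot W) (regProj x₀))ᵐᵒᵖ

/-- The element of `B` given by a loop. -/
def ofLoop {x₀ : Vreg W} (γ : Path (regProj x₀) (regProj x₀)) : Braid x₀ :=
  MulOpposite.op (FundamentalGroup.fromPath (Path.Homotopic.Quotient.mk γ))

/-- The image in `V^reg / W` of a path in `V^reg` from `x` to `y = w x`, as a loop. -/
def projLoop {x y : Vreg W} (w : W) (h : act w.1 x.1 = y.1) (γ : Path x y) :
    Path (regProj x) (regProj x) :=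
  (γ.map continuous_regProj).cast rfl
    (Quotient.sound (s := regSetoid W) ⟨w.1, w.2, h⟩)

/-- The loop `t ↦ exp(2πit) x₀` in `V^reg`. -/
def fullTwistPath (x₀ : Vreg W) : Path x₀ x₀ where
  toFun t := ⟨Complex.exp (2 * Real.pi * Complex.I * (t : ℝ)) • x₀.1, fun H hH h =>
    x₀.2 H hH ((Submodule.smul_mem_iff H (Complex.exp_ne_zero _)).1 h)⟩
  continuous_toFun := by
    refine Continuous.subtype_mk ?_ _
    fun_prop
  source' := by
    apply Subtype.ext
    simp
  target' := by
    apply Subtype.ext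
    simp [Complex.exp_two_pi_mul_I]

/-- The central element `π` of the braid group. -/
def fullTwist (x₀ : Vreg W) : Braid x₀ :=
  ofLoop ((fullTwistPath x₀).map continuous_regProj)

/-- The data defining a generator of the monodromy around the image of a hyperplane `H` of the
orbit `C`.  Here `s ∈ W` is the reflection with hyperplane `H` and non-trivial eigenvalue
`exp(2πi/e_C)`, and `γ` is a path in `V^reg` from `x₀` to a point `x = a + p` close to `H`, with
`a ∈ H` and `p` in the non-trivial eigenline of `s`: the disc `a + z p`, `|z| ≤ 1`, meets no
reflecting hyperplane other than `H`.  The arc `t ↦ a + exp(2πit/e_C) p` goes from `x` to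
`y = s x`. -/
structure Meridian (x₀ : Vreg W) (C : HypOrbit W) where
  H : hyperplanes W
  mem_orbit : Quotient.mk (hyperplaneSetoid W) H = C
  s : W
  fixed : fixedSpace s.1 = H.1
  a : Fin n → ℂ
  p : Fin n → ℂ
  a_mem : a ∈ H.1
  p_not_mem : p ∉ H.1
  eigen : act s.1 p = Complex.exp (2 * Real.pi * Complex.I / ramif C) • p
  near : ∀ H' ∈ hyperplanes W, H' ≠ H.1 → ∀ z : ℂ, ‖z‖ ≤ 1 → a + z • p ∉ H'
  x : Vreg W
  y : Vreg W
  γ : Path x₀ x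
  arc : Path x y
  arc_eq : ∀ t, (arc t).1 = a + Complex.exp (2 * Real.pi * Complex.I * (t : ℝ) / ramif C) • p
  s_x : act s.1 x.1 = y.1

/-- The generator of the monodromy defined by `γ`: follow `γ`, then the arc, then `γ` backwards
(all in `V^reg / W`). -/
def Meridian.toBraid {x₀ : Vreg W} {C : HypOrbit W} (M : Meridian x₀ C) : Braid x₀ :=
  ofLoop (((M.γ.map continuous_regProj).trans (projLoop M.s M.s_x M.arc)).trans
    (M.γ.map continuous_regProj).symm)

/-- `b` belongs to `𝐒_𝒞`, the set of generators of the monodromy around the images of the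
elements of `C`. -/
def IsBraidReflection {x₀ : Vreg W} (C : HypOrbit W) (b : Braid x₀) : Prop :=
  ∃ M : Meridian x₀ C, M.toBraid = b

end Reflection

/-! ### Hecke algebras -/

section Hecke

variable {K : Type*} [Field K] [Algebra K ℂ] {n : ℕ} {W : Subgroup (GL (Fin n) K)}

/-- A family of invertible parameters `(u_{𝒞,j})` in `S`, with `j` taken modulo `e_𝒞`. -/
abbrev Param (W : Subgroup (GL (Fin n) K)) (S : Type*) [CommRing S] :=
  (C : HypOrbit W) → ZMod (ramif C) → Sˣ

/-- The polynomial `∏_j (X - u_{𝒞,j})`. -/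
def paramPoly {S : Type*} [CommRing S] (u : Param W S) (C : HypOrbit W) : Polynomial S :=
  ∏ j ∈ Finset.range (ramif C), (Polynomial.X - Polynomial.C (u C (j : ZMod (ramif C)) : S))

/-- The relations `∏_j (𝐬 - u_{𝒞,j}) = 0` in `S B`, for `𝐬 ∈ 𝐒_𝒞`. -/
inductive HeckeRel (x₀ : Vreg W) {S : Type*} [CommRing S] (u : Param W S) :
    MonoidAlgebra S (Braid x₀) → MonoidAlgebra S (Braid x₀) → Prop
  | rel (C : HypOrbit W) (s : Braid x₀) (hs : IsBraidReflection C s) :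
      HeckeRel x₀ u
        (Polynomial.aeval (MonoidAlgebra.of S (Braid x₀) s) (paramPoly u C)) 0

/-- The Hecke algebra of `W` over `S` with parameters `u`: the quotient of the group algebra `S B`
by the relations above.  For a homomorphism `S → S'` the algebra with the image parameters over
`S'` is the specialization `S' ⊗_S -` of the one over `S`. -/
abbrev Hecke (x₀ : Vreg W) {S : Type*} [CommRing S] (u : Param W S) : Type _ :=
  RingQuot (HeckeRel x₀ u)

/-- The image in the Hecke algebra of an element of the braid group. -/
def T (x₀ : Vreg W) {S : Type*} [CommRing S] (u : Param W S) (b : Braid x₀) : Hecke x₀ u :=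
  RingQuot.mkAlgHom S (HeckeRel x₀ u) (MonoidAlgebra.of S (Braid x₀) b)

/-- The image of a family of parameters under a ring homomorphism. -/
def Param.map {S S' : Type*} [CommRing S] [CommRing S'] (f : S →+* S') (u : Param W S) :
    Param W S' :=
  fun C j => Units.map f (u C j)

/-- The canonical homomorphism from a Hecke algebra to its specialization. -/
def Hecke.spec (x₀ : Vreg W) {S S' : Type*} [CommRing S] [CommRing S'] (f : S →+* S')
    (u : Param W S) : Hecke x₀ u →+* Hecke x₀ (u.map f) :=
  RingQuot.lift ⟨(RingQuot.mkRingHom (HeckeRel x₀ (u.map f))).comp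
      (MonoidAlgebra.mapRingHom (Braid x₀) f), by
    rintro _ _ ⟨C, s, hs⟩
    have h := RingQuot.mkRingHom_rel (HeckeRel.rel (u := u.map f) C s hs)
    rw [map_zero] at h
    rw [map_zero, RingHom.comp_apply, ← h]
    congr 1
    have hp : paramPoly (u.map f) C = (paramPoly u C).map f := by
      simp [paramPoly, Param.map, Polynomial.map_prod]
    rw [hp, Polynomial.aeval_def, Polynomial.aeval_def, Polynomial.hom_eval₂,
      Polynomial.eval₂_map]
    congr 1
    · ext c : 1
      simp [MonoidAlgebra.coe_algebraMap]
    · simp⟩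

/-! ### The generic Hecke algebra and its canonical symmetrizing form -/

/-- The Laurent polynomial ring `ℤ[𝐮, 𝐮⁻¹]` in the indeterminates `u_{𝒞,j}`. -/
abbrev GenRing (W : Subgroup (GL (Fin n) K)) : Type :=
  AddMonoidAlgebra ℤ ((Σ C : HypOrbit W, ZMod (ramif C)) →₀ ℤ)

/-- The indeterminates `u_{𝒞,j}`. -/
def genParam (W : Subgroup (GL (Fin n) K)) : Param W (GenRing W) := fun C j =>
  { val := AddMonoidAlgebra.single (Finsupp.single ⟨C, j⟩ 1) 1
    inv := AddMonoidAlgebra.single (Finsupp.single ⟨C, j⟩ (-1)) 1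
    val_inv := by
      rw [AddMonoidAlgebra.single_mul_single, ← Finsupp.single_add]
      simp [AddMonoidAlgebra.one_def]
    inv_val := by
      rw [AddMonoidAlgebra.single_mul_single, ← Finsupp.single_add]
      simp [AddMonoidAlgebra.one_def] }

/-- The ring homomorphism `ℤ[𝐮, 𝐮⁻¹] → S` that sends the indeterminates to given units of `S`. -/
def genEval {S : Type*} [CommRing S] (u : Param W S) : GenRing W →+* S :=
  (AddMonoidAlgebra.lift ℤ S ((Σ C : HypOrbit W, ZMod (ramif C)) →₀ ℤ)
    { toFun := fun f =>
        ((Multiplicative.toAdd f).prod fun i (k : ℤ) => u i.1 i.2 ^ k : Sˣ)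
      map_one' := by simp
      map_mul' := fun f g => by
        rw [toAdd_mul, Finsupp.prod_add_index' (fun _ => zpow_zero _)
          (fun _ _ _ => zpow_add _ _ _), Units.val_mul] }).toRingHom

/-- The involution of `ℤ[𝐮, 𝐮⁻¹]` that inverts all the indeterminates. -/
def genInv (W : Subgroup (GL (Fin n) K)) : GenRing W →+* GenRing W :=
  AddMonoidAlgebra.mapDomainRingHom ℤ
    (-AddMonoidHom.id ((Σ C : HypOrbit W, ZMod (ramif C)) →₀ ℤ))

/-- The root of unity `ζ_e = exp(2πi/e)`, as a unit of `ℤ_K` (`1` if `K` does not contain it;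
`K` contains `ζ_e` for all `e = e_𝒞`). -/
def zeta (K : Type*) [Field K] [Algebra K ℂ] (e : ℕ) : (𝓞 K)ˣ :=
  open Classical in
  if h : ∃ z : (𝓞 K)ˣ, algebraMap K ℂ ((z : 𝓞 K) : K) = Complex.exp (2 * Real.pi * Complex.I / e)
  then h.choose else 1

/-- The parameters `ζ_{e_𝒞}^j`, for which the Hecke algebra is the group algebra of `W`. -/
def groupParam (W : Subgroup (GL (Fin n) K)) : Param W (𝓞 K) :=
  fun C j => zeta K (ramif C) ^ j.val

/-- `t` is a symmetrizing form on the `R`-algebra `A`: a trace form whose bilinear form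
`(a, a') ↦ t (a a')` is non-degenerate (that is, identifies `A` with its dual). -/
def IsSymmetrizing {R A : Type*} [CommRing R] [Ring A] [Algebra R A] (t : A →ₗ[R] R) : Prop :=
  (∀ a b, t (a * b) = t (b * a)) ∧
    Function.Bijective fun a : A => t ∘ₗ LinearMap.mulLeft R a

/-- The characteristic properties of the canonical form of the generic Hecke algebra:
* it is symmetrizing;
* it specializes, for `u_{𝒞,j} ↦ ζ_{e_𝒞}^j`, to the canonical form `w ↦ δ_{w,1}` on the group
  algebra of `W`;
* `t(b⁻¹)^* = t(b π) / t(π)` for all `b ∈ B`, where `^*` inverts the indeterminates. -/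
structure IsCanonicalForm (x₀ : Vreg W)
    (t : Hecke x₀ (genParam W) →ₗ[GenRing W] GenRing W) : Prop where
  symm : IsSymmetrizing t
  spec_eq_one : ∀ (γ : Path x₀ x₀),
    genEval (groupParam W) (t (T x₀ (genParam W)
      (ofLoop (γ.map continuous_regProj)))) = 1
  spec_eq_zero : ∀ (w : W) (y : Vreg W) (h : act w.1 x₀.1 = y.1) (γ : Path x₀ y), w ≠ 1 →
    genEval (groupParam W) (t (T x₀ (genParam W) (ofLoop (projLoop w h γ)))) = 0
  inv : ∀ b : Braid x₀,
    genInv W (t (T x₀ (genParam W) b⁻¹)) * t (T x₀ (genParam W) (fullTwist x₀)) =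
      t (T x₀ (genParam W) (b * fullTwist x₀))

end Hecke

/-! ### Simple modules -/

section Irr

/-- Maximal left ideals `I`, `J` are equivalent if the simple modules `A / I`, `A / J` are
isomorphic. -/
def simpleSetoid (A : Type*) [Ring A] : Setoid {I : Ideal A // I.IsMaximal} where
  r I J := Nonempty ((A ⧸ I.1) ≃ₗ[A] (A ⧸ J.1))
  iseqv :=
    { refl := fun _ => ⟨LinearEquiv.refl _ _⟩
      symm := fun ⟨e⟩ => ⟨e.symm⟩
      trans := fun ⟨e⟩ ⟨f⟩ => ⟨e.trans f⟩ }

/-- The set of isomorphism classes of simple left `A`-modules. -/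
def Irr (A : Type*) [Ring A] : Type _ := Quotient (simpleSetoid A)

/-- A simple module in the given isomorphism class. -/
abbrev Irr.Mod {A : Type*} [Ring A] (M : Irr A) : Type _ := A ⧸ (Quotient.out M).1

variable (F : Type*) [Field F] {A : Type*} [Ring A] [Algebra F A]

/-- The character of a simple module. -/
def Irr.char (M : Irr A) (a : A) : F :=
  LinearMap.trace F M.Mod (Algebra.lsmul F F M.Mod a)

open Classical in
/-- The characteristic polynomial of the action of `a` on a simple module (of finite dimension). -/
def Irr.charpoly (M : Irr A) (a : A) : Polynomial F :=
  if h : Module.Finite F M.Mod then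
    haveI := h
    LinearMap.charpoly (Algebra.lsmul F F M.Mod a)
  else 1

/-- The `F`-algebra `A` is split: all endomorphisms of simple modules are scalars. -/
def IsSplit (F A : Type*) [Field F] [Ring A] [Algebra F A] : Prop :=
  ∀ (M : Irr A) (f : M.Mod →ₗ[A] M.Mod), ∃ c : F, ∀ x, f x = c • x

end Irr

/-! ### Cyclotomic Hecke algebras -/

section Cyclotomic

variable {K : Type*} [Field K] [NumberField K] [Algebra K ℂ] {n : ℕ}
  {W : Subgroup (GL (Fin n) K)}

/-- The set `ℳ = ∏_𝒞 ℤ^{e_𝒞}`. -/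
abbrev Weights (W : Subgroup (GL (Fin n) K)) := (C : HypOrbit W) → ZMod (ramif C) → ℤ

/-- The group `G = ∏_𝒞 ℤ/e_𝒞ℤ`, written additively. -/
abbrev ShiftGroup (W : Subgroup (GL (Fin n) K)) := (C : HypOrbit W) → ZMod (ramif C)

/-- The action of `G` on `ℳ` by cyclic permutations: `(g.m)_{𝒞,j} = m_{𝒞,j+g_𝒞}`. -/
def shift (g : ShiftGroup W) (m : Weights W) : Weights W := fun C j => m C (j + g C)

/-- `y^k`, as a unit of `ℤ_K[y, y⁻¹]`. -/
def yPow (K : Type*) [Field K] (k : ℤ) : ((𝓞 K)[T;T⁻¹])ˣ where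
  val := LaurentPolynomial.T k
  inv := LaurentPolynomial.T (-k)
  val_inv := by rw [← LaurentPolynomial.T_add]; simp
  inv_val := by rw [← LaurentPolynomial.T_add]; simp

/-- The values `ζ_{e_𝒞}^j q^{m_{𝒞,j}}` of the `u_{𝒞,j}` under the cyclotomic specialization
`φ_𝐦`, where `q = y^{|μ(K)|}`. -/
def cycParam (m : Weights W) : Param W ((𝓞 K)[T;T⁻¹]) := fun C j =>
  Units.map (LaurentPolynomial.C : 𝓞 K →+* (𝓞 K)[T;T⁻¹]) (zeta K (ramif C) ^ j.val) *
    yPow K (NumberField.Units.torsionOrder K * m C j)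

/-- The cyclotomic Hecke algebra `ℋ_𝐦`, with scalars extended to `ℤ_K[y, y⁻¹]`. -/
abbrev HeckeCyc (x₀ : Vreg W) (m : Weights W) := Hecke x₀ (cycParam m)

/-- The inclusion `ℤ_K[y, y⁻¹] → K(y)`. -/
def toKy (K : Type*) [Field K] : (𝓞 K)[T;T⁻¹] →+* RatFunc K :=
  LaurentPolynomial.eval₂ (algebraMap (𝓞 K) (RatFunc K)) (Units.mk0 RatFunc.X RatFunc.X_ne_zero)

/-- The specialization `y ↦ 1`. -/
def atOne (K : Type*) [Field K] : (𝓞 K)[T;T⁻¹] →+* K :=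
  LaurentPolynomial.eval₂ (algebraMap (𝓞 K) K) 1

/-- `K(y) ℋ_𝐦`. -/
abbrev HeckeK (x₀ : Vreg W) (m : Weights W) := Hecke x₀ ((cycParam m).map (toKy K))

/-- `k ℋ_𝐦`, for a specialization `θ : ℤ_K[y, y⁻¹] → k`. -/
abbrev Heckek (x₀ : Vreg W) {k : Type*} [Field k] (θ : (𝓞 K)[T;T⁻¹] →+* k) (m : Weights W) :=
  Hecke x₀ ((cycParam m).map θ)

/-- The simple `K(y) ℋ_𝐦`-module `U` corresponds to the simple `K W`-module `L` under Tits'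
deformation theorem: the specialization `y ↦ 1` sends the character of `U` to that of `L`. -/
def TitsCorresponds (x₀ : Vreg W) (m : Weights W) (U : Irr (HeckeK x₀ m))
    (L : Irr (MonoidAlgebra K W)) : Prop :=
  ∀ (w : W) (y : Vreg W) (h : act w.1 x₀.1 = y.1) (γ : Path x₀ y),
    ∃ P : (𝓞 K)[T;T⁻¹],
      toKy K P = U.char (RatFunc K) (T x₀ _ (ofLoop (projLoop w h γ))) ∧
      atOne K P = L.char K (MonoidAlgebra.of K W w)

/-- `s` is the family of Schur elements of the simple `K(y) ℋ_𝐦`-modules with respect to the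
specialization `t_φ` of `t`, that is, `t_φ = ∑_χ (1 / s_χ) χ`. -/
def IsSchurFamily (x₀ : Vreg W) (t : Hecke x₀ (genParam W) →ₗ[GenRing W] GenRing W)
    (m : Weights W) (s : Irr (HeckeK x₀ m) → RatFunc K) : Prop :=
  (∀ U, s U ≠ 0) ∧ ∀ b : Braid x₀,
    toKy K (genEval (cycParam m) (t (T x₀ (genParam W) b))) =
      ∑ᶠ U : Irr (HeckeK x₀ m), (s U)⁻¹ * U.char (RatFunc K) (T x₀ _ b)

/-- The order at `y = 0` of a non-zero element of `K(y)`. -/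
def valY {K : Type*} [Field K] (f : RatFunc K) : ℤ :=
  (f.num.rootMultiplicity 0 : ℤ) - (f.denom.rootMultiplicity 0 : ℤ)

/-- The value `a = -val_q(s)` of the `a`-function, for a Schur element `s`. -/
def aValue (s : RatFunc K) : ℚ := -((valY s : ℚ) / NumberField.Units.torsionOrder K)

/-- `d` is the decomposition matrix associated with `θ`.  The decomposition map is the unique
additive map between Grothendieck groups that is compatible with characteristic polynomials: for
`h ∈ ℋ_𝐦`, the characteristic polynomial of `h` on a simple `K(y) ℋ_𝐦`-module `U` has coefficients
in `ℤ_K[y, y⁻¹]`, and `θ` maps it to the characteristic polynomial of `h` on the reduction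
`∑_M d_{U,M} [M]` of `U`. -/
def IsDecompositionMatrix (x₀ : Vreg W) {k : Type*} [Field k] (θ : (𝓞 K)[T;T⁻¹] →+* k)
    (m : Weights W) (d : Irr (HeckeK x₀ m) → Irr (Heckek x₀ θ m) → ℕ) : Prop :=
  ∀ (U : Irr (HeckeK x₀ m)) (h : HeckeCyc x₀ m), ∃ P : Polynomial ((𝓞 K)[T;T⁻¹]),
    P.map (toKy K) = U.charpoly (RatFunc K) (Hecke.spec x₀ (toKy K) (cycParam m) h) ∧
    P.map θ = ∏ᶠ M : Irr (Heckek x₀ θ m),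
      M.charpoly k (Hecke.spec x₀ θ (cycParam m) h) ^ d U M

/-- `𝓑 ⊆ Λ` is a basic set of `ℋ_𝐦` with respect to `θ`.  The set `Λ` indexes `Irr(W)` through
`ι`; `V : Λ → Irr(K(y) ℋ_𝐦)` is Tits' bijection, `s` are the Schur elements, `d` is the
decomposition matrix (each of them is unique), and `l` is the map `M ↦ λ_M`. -/
def IsBasicSet (x₀ : Vreg W) (t : Hecke x₀ (genParam W) →ₗ[GenRing W] GenRing W)
    {Λ : Type*} (ι : Λ ≃ Irr (MonoidAlgebra K W))
    {k : Type*} [Field k] (θ : (𝓞 K)[T;T⁻¹] →+* k) (m : Weights W) (𝓑 : Set Λ) : Prop :=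
  ∃ (V : Λ → Irr (HeckeK x₀ m)) (s : Irr (HeckeK x₀ m) → RatFunc K)
    (d : Irr (HeckeK x₀ m) → Irr (Heckek x₀ θ m) → ℕ),
    Function.Bijective V ∧ (∀ l, TitsCorresponds x₀ m (V l) (ι l)) ∧
    IsSchurFamily x₀ t m s ∧ IsDecompositionMatrix x₀ θ m d ∧
    ∃ l : Irr (Heckek x₀ θ m) → Λ,
      (∀ M, d (V (l M)) M = 1 ∧
        ∀ μ, μ ≠ l M → d (V μ) M ≠ 0 → aValue (s (V (l M))) < aValue (s (V μ))) ∧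
      Set.BijOn l Set.univ 𝓑

/-! ### Change of parameters -/

/-- `Γ` is the isomorphism `Γ^𝐠 : ℋ_𝐦 → ℋ_{𝐠.𝐦}`, determined by `𝐬 ↦ ζ_{e_𝒞}^{g_𝒞} 𝐬` on the
generators `𝐬 ∈ 𝐒_𝒞`. -/
def IsGamma (x₀ : Vreg W) (g : ShiftGroup W) (m : Weights W)
    (Γ : HeckeCyc x₀ m ≃ₐ[(𝓞 K)[T;T⁻¹]] HeckeCyc x₀ (shift g m)) : Prop :=
  ∀ (C : HypOrbit W) (s : Braid x₀), IsBraidReflection C s →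
    Γ (T x₀ (cycParam m) s) =
      LaurentPolynomial.C ((zeta K (ramif C) ^ (g C).val : (𝓞 K)ˣ) : 𝓞 K) •
        T x₀ (cycParam (shift g m)) s

/-- The simple `K(y) ℋ_𝐦`-module `U'` affords the representation `ρ ∘ Γ` of `ℋ_𝐦`, where `ρ` is
the representation of `ℋ_{𝐠.𝐦}` on `U`. -/
def Affords (x₀ : Vreg W) (g : ShiftGroup W) (m : Weights W)
    (Γ : HeckeCyc x₀ m ≃ₐ[(𝓞 K)[T;T⁻¹]] HeckeCyc x₀ (shift g m))
    (U' : Irr (HeckeK x₀ m)) (U : Irr (HeckeK x₀ (shift g m))) : Prop :=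
  ∃ f : U'.Mod ≃ₗ[RatFunc K] U.Mod, ∀ (h : HeckeCyc x₀ m) (v : U'.Mod),
    f (Hecke.spec x₀ (toKy K) (cycParam m) h • v) =
      Hecke.spec x₀ (toKy K) (cycParam (shift g m)) (Γ h) • f v

/-- `σ` is the action `(𝐠, λ) ↦ λ^𝐠` of `G` on `Λ` induced by the isomorphisms `Γ^𝐠`: for all
`𝐦`, if `ρ` is the irreducible representation of `ℋ_{𝐠.𝐦}` labelled by `λ`, then the simple
module affording `ρ ∘ Γ^𝐠` is labelled by `λ^𝐠`. -/
def IsInducedAction (x₀ : Vreg W) {Λ : Type*} (ι : Λ ≃ Irr (MonoidAlgebra K W))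
    (Γ : ∀ (g : ShiftGroup W) (m : Weights W),
      HeckeCyc x₀ m ≃ₐ[(𝓞 K)[T;T⁻¹]] HeckeCyc x₀ (shift g m))
    (σ : ShiftGroup W → Λ → Λ) : Prop :=
  (∀ l, σ 0 l = l) ∧ (∀ g g' l, σ (g + g') l = σ g (σ g' l)) ∧
  ∀ (g : ShiftGroup W) (m : Weights W) (l : Λ) (U : Irr (HeckeK x₀ (shift g m)))
    (U' : Irr (HeckeK x₀ m)), TitsCorresponds x₀ (shift g m) U (ι l) →
    Affords x₀ g m (Γ g m) U' U → TitsCorresponds x₀ m U' (ι (σ g l))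

end Cyclotomic

end CycHecke

end

noncomputable section

namespace CycHecke

/-! ### Reflecting hyperplanes and semi-invariants -/

section Geometry

variable {K : Type*} [Field K] [Algebra K ℂ] {n : ℕ} {W : Subgroup (GL (Fin n) K)}

/-! Let `χ` be the linear character of the braid group `B` with value `ζ_{e_𝒞}^{g_𝒞}` on `𝐒_𝒞`. The
map `T_b ↦ χ(b) T_b` is an isomorphism `Γ : ℋ_𝐦 → ℋ_{𝐠.𝐦}`, because up to a common scalar it only
rotates the factors of each relation. It commutes with every extension of scalars, so it transports
simple modules and decomposition numbers. What remains is to follow the labels in `Λ` and the Schur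
elements.

Labels. The character `χ` is built from length functions `ℓ_𝒞 : B → ℤ`, the winding numbers of the
`W`-invariant functions `∏_{H ∈ 𝒞} α_H ^ e_𝒞` on `V^reg / W` (`exists_braidLength`). On the image of
a loop of `V^reg` the value of `ℓ_𝒞` is divisible by `e_𝒞`, so `χ` factors through a linear
character `ε` of `W`, and `λ ↦ λ^𝐠` is the tensor product with `ε` (`exists_labelAction`).

Schur elements. They are preserved as soon as `t_{𝐠.𝐦} ∘ Γ = t_𝐦`. The parameters of `ℋ_𝐦`, with
indices translated by `𝐠`, are those of `ℋ_{𝐠.𝐦}` multiplied by `ζ^𝐠`. Two properties of `t`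
therefore suffice: `t(T_b)` is homogeneous of degree `ℓ_𝒞(b)` in the `u_{𝒞,j}`
(`IsCanonicalForm.homogeneous`), and `t` is invariant under translation of the indices
(`IsCanonicalForm.genEval_translate`). The second follows from the uniqueness of `t`: the translate
of `t` is again canonical, where homogeneity is used to check its specialization to the group
algebra.

Homogeneity. Multiply the `u_{𝒞,j}` of one orbit by `x`, and undo this on the `T_b` by powers of
`x`. The result is a trace form `G` with values in `R[x, x⁻¹]`, where `R` is the generic ring. It is
`t(z ·)` for a unit `z` of `Z[x, x⁻¹]`, `Z` being the centre of the generic algebra. At the group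
algebra the trace of the regular representation is `|W|` times `t`, so this trace is non-degenerate,
`Z` is reduced, and an idempotent killed by `t` has rank `0`. Over a reduced ring the coefficients
of a unit are pairwise orthogonal; since `z` is `1` at `x = 1`, they are idempotents. From `t(1) =
1` those of non-zero degree are killed by `t`, hence `z = 1`.

Uniqueness. Tits' bijection, the Schur elements and the decomposition matrix are each determined by
their definitions, and `λ_M` is the only label of minimal `a`-value among those with non-zero
decomposition number at `M`. -/

theorem mem_fixedSpace {w : GL (Fin n) K} {x : Fin n → ℂ} :
    x ∈ fixedSpace w ↔ act w x = x := Iff.rfl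

theorem act_act_inv (w : GL (Fin n) K) (x : Fin n → ℂ) : act w (act w⁻¹ x) = x := by
  simpa using act_inv_act w⁻¹ x

theorem act_mul_apply (v w : GL (Fin n) K) (x : Fin n → ℂ) :
    act (v * w) x = act v (act w x) := by
  rw [act_mul, LinearMap.comp_apply]

/-- The action of `w` on `ℂ^n` as a linear automorphism. -/
def actEquiv (w : GL (Fin n) K) : (Fin n → ℂ) ≃ₗ[ℂ] (Fin n → ℂ) :=
  LinearEquiv.ofLinearMap (act w) (act w⁻¹)
    (LinearMap.ext fun x => act_act_inv w x) (LinearMap.ext fun x => act_inv_act w x)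

theorem mem_map_act {w : GL (Fin n) K} {H : Submodule ℂ (Fin n → ℂ)} {x : Fin n → ℂ} :
    x ∈ H.map (act w) ↔ act w⁻¹ x ∈ H := by
  constructor
  · rintro ⟨y, hy, rfl⟩
    rwa [act_inv_act]
  · intro h
    exact ⟨_, h, act_act_inv w x⟩

theorem fixedSpace_conj (w s : GL (Fin n) K) :
    fixedSpace (w * s * w⁻¹) = (fixedSpace s).map (act w) := by
  ext x
  rw [mem_map_act, mem_fixedSpace, mem_fixedSpace, act_mul_apply, act_mul_apply]
  constructor
  · intro h
    conv_rhs => rw [← h]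
    rw [act_inv_act]
  · intro h
    rw [h, act_act_inv]

theorem map_act_mem_hyperplanes {w : GL (Fin n) K} (hw : w ∈ W)
    {H : Submodule ℂ (Fin n → ℂ)} (hH : H ∈ hyperplanes W) :
    H.map (act w) ∈ hyperplanes W := by
  obtain ⟨s, hs, hps, rfl⟩ := hH
  refine ⟨w * s * w⁻¹, W.mul_mem (W.mul_mem hw hs) (W.inv_mem hw), ?_, (fixedSpace_conj w s).symm⟩
  rw [IsPseudoReflection, fixedSpace_conj]
  have := LinearEquiv.finrank_map_eq (actEquiv w) (fixedSpace s)
  rw [IsPseudoReflection] at hps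
  exact (congrArg (· + 1) this).trans hps

theorem act_notMem_hyperplanes {w : GL (Fin n) K} (hw : w ∈ W) {x : Fin n → ℂ}
    (hx : ∀ H ∈ hyperplanes W, x ∉ H) : ∀ H ∈ hyperplanes W, act w x ∉ H := by
  intro H hH h
  refine hx _ (map_act_mem_hyperplanes (W.inv_mem hw) hH) ?_
  rw [mem_map_act]
  simpa using h

/-- The permutation of the reflecting hyperplanes given by `w ∈ W`. -/
def hypPerm (w : W) : hyperplanes W ≃ hyperplanes W where
  toFun H := ⟨H.1.map (act w.1), map_act_mem_hyperplanes w.2 H.2⟩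
  invFun H := ⟨H.1.map (act w.1⁻¹), map_act_mem_hyperplanes (W.inv_mem w.2) H.2⟩
  left_inv H := Subtype.ext (by
    ext x
    simp only [mem_map_act, inv_inv, act_inv_act])
  right_inv H := Subtype.ext (by
    ext x
    simp only [mem_map_act, inv_inv, act_act_inv])

theorem mk_hypPerm (w : W) (H : hyperplanes W) :
    Quotient.mk (hyperplaneSetoid W) (hypPerm w H) = Quotient.mk (hyperplaneSetoid W) H :=
  (Quotient.sound (s := hyperplaneSetoid W) ⟨w.1, w.2, rfl⟩).symm

instance [Finite W] : Finite (hyperplanes W) := by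
  refine Finite.of_surjective
    (fun w : {w : W // IsPseudoReflection w.1} =>
      (⟨fixedSpace w.1.1, w.1.1, w.1.2, w.2, rfl⟩ : hyperplanes W)) ?_
  rintro ⟨H, w, hw, hps, rfl⟩
  exact ⟨⟨⟨w, hw⟩, hps⟩, rfl⟩

instance [Finite W] : Finite (HypOrbit W) :=
  inferInstanceAs (Finite (Quotient (hyperplaneSetoid W)))

/-- Conjugate hyperplanes have conjugate pointwise stabilizers, so the representative chosen by
`Quotient.out` does not matter. -/
theorem ramif_eq_card (H : hyperplanes W) :
    ramif (Quotient.mk (hyperplaneSetoid W) H) =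
      Nat.card {w : GL (Fin n) K // w ∈ W ∧ ∀ x ∈ H.1, act w x = x} := by
  obtain ⟨v, hv, h⟩ := Quotient.exact (Quotient.out_eq (Quotient.mk (hyperplaneSetoid W) H))
  refine Nat.card_congr
    { toFun := fun w => ⟨v * w.1 * v⁻¹, W.mul_mem (W.mul_mem hv w.2.1) (W.inv_mem hv), ?_⟩
      invFun := fun w => ⟨v⁻¹ * w.1 * v, W.mul_mem (W.mul_mem (W.inv_mem hv) w.2.1) hv, ?_⟩
      left_inv := fun w => Subtype.ext (by group)
      right_inv := fun w => Subtype.ext (by group) }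
  · intro x hx
    rw [← h, mem_map_act] at hx
    rw [act_mul_apply, act_mul_apply, w.2.2 _ hx, act_act_inv]
  · intro x hx
    have hx' : act v x ∈ H.1 := by
      rw [← h, mem_map_act, act_inv_act]
      exact hx
    rw [act_mul_apply, act_mul_apply, w.2.2 _ hx', act_inv_act]

theorem ramif_ne_zero [Finite W] (C : HypOrbit W) : ramif C ≠ 0 := by
  have : Finite {w : GL (Fin n) K // w ∈ W ∧ ∀ x ∈ (Quotient.out C).1, act w x = x} :=
    Finite.of_injective (fun w => (⟨w.1, w.2.1⟩ : W))
      fun a b h => Subtype.ext (congrArg (fun u : W => u.1) h)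
  have : Nonempty {w : GL (Fin n) K // w ∈ W ∧ ∀ x ∈ (Quotient.out C).1, act w x = x} :=
    ⟨⟨1, W.one_mem, fun x _ => by rw [act_one, LinearMap.id_apply]⟩⟩
  exact Nat.card_pos.ne'

/-- An element that fixes a hyperplane of the orbit `C` pointwise has order dividing `e_C`. -/
theorem pow_ramif_eq_one [Finite W] {H : hyperplanes W} {w : GL (Fin n) K} (hw : w ∈ W)
    (h : ∀ x ∈ H.1, act w x = x) : w ^ ramif (Quotient.mk (hyperplaneSetoid W) H) = 1 := by
  let S : Subgroup (GL (Fin n) K) :=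
    { carrier := {w | w ∈ W ∧ ∀ x ∈ H.1, act w x = x}
      one_mem' := ⟨W.one_mem, fun x _ => by rw [act_one, LinearMap.id_apply]⟩
      mul_mem' := fun {a b} ha hb => ⟨W.mul_mem ha.1 hb.1, fun x hx => by
        rw [act_mul_apply, hb.2 x hx, ha.2 x hx]⟩
      inv_mem' := fun {a} ha => ⟨W.inv_mem ha.1, fun x hx => by
        conv_lhs => rw [← ha.2 x hx]
        rw [act_inv_act]⟩ }
  rw [ramif_eq_card]
  exact congrArg Subtype.val (pow_card_eq_one' (x := (⟨w, hw, h⟩ : S)))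

theorem exists_hypForm {H : Submodule ℂ (Fin n → ℂ)} (hH : H ∈ hyperplanes W) :
    ∃ f : (Fin n → ℂ) →ₗ[ℂ] ℂ, LinearMap.ker f = H := by
  obtain ⟨w, -, hw, rfl⟩ := hH
  have hlt : fixedSpace w < ⊤ := by
    refine lt_top_iff_ne_top.2 fun h => ?_
    rw [IsPseudoReflection, h, finrank_top, Module.finrank_fin_fun] at hw
    omega
  obtain ⟨f, hf0, hf⟩ := Submodule.exists_le_ker_of_lt_top _ hlt
  refine ⟨f, (Submodule.eq_of_le_of_finrank_le hf ?_).symm⟩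
  have h1 := Module.Dual.finrank_ker_add_one_of_ne_zero hf0
  rw [Module.finrank_fin_fun] at h1
  rw [IsPseudoReflection] at hw
  omega

/-- A linear form with kernel `H`. -/
def hypForm (H : hyperplanes W) : (Fin n → ℂ) →ₗ[ℂ] ℂ := (exists_hypForm H.2).choose

theorem hypForm_eq_zero {H : hyperplanes W} {x : Fin n → ℂ} : hypForm H x = 0 ↔ x ∈ H.1 := by
  rw [← LinearMap.mem_ker, hypForm, (exists_hypForm H.2).choose_spec]

theorem exists_eq_smul_of_ker_eq {E : Type*} [AddCommGroup E] [Module ℂ E] {f g : E →ₗ[ℂ] ℂ}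
    (h : ∀ x, f x = 0 ↔ g x = 0) : ∃ c : ℂ, ∀ x, g x = c * f x := by
  by_cases hf : ∀ x, f x = 0
  · exact ⟨0, fun x => by rw [(h x).1 (hf x), zero_mul]⟩
  · push Not at hf
    obtain ⟨v, hv⟩ := hf
    refine ⟨g v / f v, fun x => ?_⟩
    have h1 : g (x - (f x / f v) • v) = 0 := (h _).1 (by simp [hv])
    rw [map_sub, map_smul, smul_eq_mul, sub_eq_zero] at h1
    rw [h1]
    ring

/-- The product of the linear forms of the hyperplanes of the orbit `C`. -/
def orbitForm (C : HypOrbit W) (x : Fin n → ℂ) : ℂ :=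
  ∏ᶠ H : {H : hyperplanes W // Quotient.mk (hyperplaneSetoid W) H = C}, hypForm H.1 x

theorem continuous_hypForm (H : hyperplanes W) : Continuous (hypForm H) :=
  LinearMap.continuous_of_finiteDimensional _

theorem continuous_orbitForm [Finite W] (C : HypOrbit W) : Continuous (orbitForm C) := by
  have := Fintype.ofFinite {H : hyperplanes W // Quotient.mk (hyperplaneSetoid W) H = C}
  have : orbitForm C = fun x => ∏ H : {H : hyperplanes W //
      Quotient.mk (hyperplaneSetoid W) H = C}, hypForm H.1 x :=
    funext fun x => finprod_eq_prod_of_fintype _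
  rw [this]
  exact continuous_finsetProd _ fun H _ => continuous_hypForm H.1

theorem orbitForm_eq_zero [Finite W] {C : HypOrbit W} {x : Fin n → ℂ} :
    orbitForm C x = 0 ↔ ∃ H : hyperplanes W, Quotient.mk (hyperplaneSetoid W) H = C ∧ x ∈ H.1 := by
  have := Fintype.ofFinite {H : hyperplanes W // Quotient.mk (hyperplaneSetoid W) H = C}
  rw [orbitForm, finprod_eq_prod_of_fintype, Finset.prod_eq_zero_iff]
  constructor
  · rintro ⟨H, -, h⟩
    exact ⟨H.1, H.2, hypForm_eq_zero.1 h⟩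
  · rintro ⟨H, hC, h⟩
    exact ⟨⟨H, hC⟩, Finset.mem_univ _, hypForm_eq_zero.2 h⟩

theorem orbitForm_ne_zero [Finite W] (C : HypOrbit W) (x : Vreg W) : orbitForm C x.1 ≠ 0 :=
  fun h => by
    obtain ⟨H, -, hx⟩ := orbitForm_eq_zero.1 h
    exact x.2 H.1 H.2 hx

/-- `w` permutes the hyperplanes of `C`, and a linear form is determined by its kernel up to a
scalar. The scalars multiply to a constant. -/
theorem exists_orbitForm_act [Finite W] (C : HypOrbit W) (w : W) :
    ∃ c : ℂ, ∀ x, orbitForm C (act w.1 x) = c * orbitForm C x := by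
  have h : ∀ H : hyperplanes W, ∃ c : ℂ, ∀ x,
      hypForm (hypPerm w H) (act w.1 x) = c * hypForm H x := by
    intro H
    refine exists_eq_smul_of_ker_eq (f := hypForm H)
      (g := (hypForm (hypPerm w H)).comp (act w.1)) fun x => ?_
    rw [LinearMap.comp_apply, hypForm_eq_zero, hypForm_eq_zero]
    change x ∈ H.1 ↔ act w.1 x ∈ H.1.map (act w.1)
    rw [mem_map_act, act_inv_act]
  choose c hc using h
  refine ⟨∏ᶠ H : {H : hyperplanes W // Quotient.mk (hyperplaneSetoid W) H = C}, c H.1, fun x => ?_⟩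
  rw [orbitForm, orbitForm, ← finprod_mul_distrib (Set.toFinite _) (Set.toFinite _)]
  let e : {H : hyperplanes W // Quotient.mk (hyperplaneSetoid W) H = C} ≃
      {H : hyperplanes W // Quotient.mk (hyperplaneSetoid W) H = C} :=
    (hypPerm w).subtypeEquiv fun H => by rw [mk_hypPerm]
  rw [← finprod_comp_equiv e]
  exact finprod_congr fun H => hc H.1 x

/-- A vector space over an infinite field is not a finite union of proper subspaces. If `H` were
covered by the hyperplanes of `C`, it would lie in one of them and equal it by dimension. -/
theorem exists_mem_orbitForm_ne_zero [Finite W] (H : hyperplanes W) {C : HypOrbit W}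
    (hC : Quotient.mk (hyperplaneSetoid W) H ≠ C) : ∃ a ∈ H.1, orbitForm C a ≠ 0 := by
  by_contra! hcon
  let p : {H' : hyperplanes W // Quotient.mk (hyperplaneSetoid W) H' = C} → Submodule ℂ H.1 :=
    fun H' => H'.1.1.comap H.1.subtype
  have hU : (⋃ i, (p i : Set H.1)) = Set.univ := by
    refine Set.eq_univ_of_forall fun a => ?_
    obtain ⟨H', hH', h⟩ := orbitForm_eq_zero.1 (hcon a.1 a.2)
    exact Set.mem_iUnion.2 ⟨⟨H', hH'⟩, h⟩
  obtain ⟨H', hH'⟩ := Subspace.exists_eq_top_of_iUnion_eq_univ hU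
  have hle : H.1 ≤ H'.1.1 := fun x hx => by
    have : (⟨x, hx⟩ : H.1) ∈ p H' := by rw [hH']; trivial
    exact this
  have heq : H.1 = H'.1.1 := by
    refine Submodule.eq_of_le_of_finrank_le hle ?_
    obtain ⟨w, -, hw, h⟩ := H.2
    obtain ⟨w', -, hw', h'⟩ := H'.1.2
    rw [IsPseudoReflection, ← h] at hw
    rw [IsPseudoReflection, ← h'] at hw'
    omega
  exact hC (by rw [Subtype.ext heq, H'.2])

/-- The function `∏_{H ∈ C} α_H ^ e_C` is invariant under `W`. -/
theorem orbitForm_act_pow [Finite W]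
    (hgen : Subgroup.closure {w | w ∈ W ∧ IsPseudoReflection w} = W)
    (C : HypOrbit W) {w : GL (Fin n) K} (hw : w ∈ W) (x : Fin n → ℂ) :
    orbitForm C (act w x) ^ ramif C = orbitForm C x ^ ramif C := by
  rw [← hgen] at hw
  induction hw using Subgroup.closure_induction generalizing x with
  | one => rw [act_one, LinearMap.id_apply]
  | mul a b _ _ ha hb => rw [act_mul_apply, ha, hb]
  | inv a _ ha => rw [← ha, act_act_inv]
  | mem w hw =>
    obtain ⟨hw, hps⟩ := hw
    obtain ⟨c, hc⟩ := exists_orbitForm_act C ⟨w, hw⟩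
    let H : hyperplanes W := ⟨fixedSpace w, w, hw, hps, rfl⟩
    -- The multiplier `c` of a reflection is an `e_C`-th root of unity if its hyperplane lies in
    -- `C`, since the reflection then has order dividing `e_C`. Otherwise `c = 1`, as is seen at a
    -- point fixed by the reflection and off the hyperplanes of `C`.
    by_cases hC : Quotient.mk (hyperplaneSetoid W) H = C
    · by_cases h0 : orbitForm C x = 0
      · rw [hc, h0, mul_zero]
      have hpow : ∀ k : ℕ, orbitForm C (act (w ^ k) x) = c ^ k * orbitForm C x := by
        intro k
        induction k with
        | zero => simp [act_one]
        | succ k ih => rw [pow_succ', act_mul_apply, hc, ih]; ring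
      have h1 := hpow (ramif C)
      have h2 : w ^ ramif C = 1 := by
        rw [← hC]
        exact pow_ramif_eq_one hw fun x hx => hx
      rw [h2, act_one, LinearMap.id_apply] at h1
      have h3 : c ^ ramif C = 1 := by
        have : (c ^ ramif C - 1) * orbitForm C x = 0 := by
          rw [sub_mul, ← h1, one_mul, sub_self]
        rcases mul_eq_zero.1 this with h | h
        · exact sub_eq_zero.1 h
        · exact absurd h h0
      rw [hc, mul_pow, h3, one_mul]
    · obtain ⟨a, ha, ha0⟩ := exists_mem_orbitForm_ne_zero H hC
      have h1 := hc a
      rw [show act w a = a from ha] at h1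
      have h2 : c = 1 := by
        have : (c - 1) * orbitForm C a = 0 := by
          rw [sub_mul, ← h1, one_mul, sub_self]
        rcases mul_eq_zero.1 this with h | h
        · exact sub_eq_zero.1 h
        · exact absurd h ha0
      rw [hc, h2, one_mul]

/-- The complex line through `x` and `y` meets each hyperplane at most once, because `x` lies on
none. The complement of a countable set in `ℂ` is path connected. -/
theorem vreg_joined [Finite W] (x y : Vreg W) : Joined x y := by
  let bad : Set ℂ := {z | ∃ H : hyperplanes W, x.1 + z • (y.1 - x.1) ∈ H.1}
  have hbad : bad.Countable := by
    have : bad = ⋃ H : hyperplanes W, {z | x.1 + z • (y.1 - x.1) ∈ H.1} := by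
      ext z
      simp [bad]
    rw [this]
    refine Set.countable_iUnion fun H => Set.Subsingleton.countable ?_
    intro z hz z' hz'
    simp only [Set.mem_ofPred_eq, ← hypForm_eq_zero, map_add, map_smul, smul_eq_mul] at hz hz'
    have hx : hypForm H x.1 ≠ 0 := fun h => x.2 H.1 H.2 (hypForm_eq_zero.1 h)
    have hm : (z - z') * hypForm H (y.1 - x.1) = 0 := by linear_combination hz - hz'
    rcases mul_eq_zero.1 hm with h | h
    · exact sub_eq_zero.1 h
    · rw [h, mul_zero, add_zero] at hz
      exact absurd hz hx
  have hpc : IsPathConnected badᶜ :=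
    hbad.isPathConnected_compl_of_one_lt_rank (by
      rw [Complex.rank_real_complex]; exact_mod_cast one_lt_two)
  have h0 : (0 : ℂ) ∈ badᶜ := by
    rintro ⟨H, h⟩
    exact x.2 H.1 H.2 (by simpa using h)
  have h1 : (1 : ℂ) ∈ badᶜ := by
    rintro ⟨H, h⟩
    exact y.2 H.1 H.2 (by simpa using h)
  obtain ⟨γ, hγ⟩ := hpc.joinedIn 0 h0 1 h1
  refine ⟨⟨⟨fun t => ⟨x.1 + γ t • (y.1 - x.1), fun H hH h => hγ t ⟨⟨H, hH⟩, h⟩⟩, ?_⟩, ?_, ?_⟩⟩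
  · refine Continuous.subtype_mk ?_ _
    fun_prop
  · apply Subtype.ext
    simp
  · apply Subtype.ext
    simp

end Geometry

end CycHecke
end

noncomputable section

namespace CycHecke

/-! ### Winding numbers -/

section Winding

open Complex

variable {X : Type*} [TopologicalSpace X]

/-- The continuous variation of `log δ` along `γ` is `c`. -/
def HasLogVariation (δ : X → ℂ) {x y : X} (γ : Path x y) (c : ℂ) : Prop :=
  ∃ L : C(unitInterval, ℂ), (∀ t, exp (L t) = δ (γ t)) ∧ L 1 - L 0 = c

variable {δ : X → ℂ}

theorem exists_hasLogVariation (hδ : Continuous δ) (h0 : ∀ x, δ x ≠ 0) {x y : X} (γ : Path x y) :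
    ∃ c, HasLogVariation δ γ c := by
  let g : C(unitInterval, {z : ℂ // z ≠ 0}) :=
    ⟨fun t => ⟨δ (γ t), h0 _⟩, by fun_prop⟩
  obtain ⟨L, hL, -⟩ := isCoveringMap_exp.exists_path_lifts g (log (δ (γ 0)))
    (Subtype.ext (exp_log (h0 _)).symm)
  exact ⟨_, L, fun t => congrArg Subtype.val (congrFun hL t), rfl⟩

theorem HasLogVariation.unique (hδ : Continuous δ) (h0 : ∀ x, δ x ≠ 0) {x y : X} {γ γ' : Path x y}
    (h : γ.Homotopic γ') {c c' : ℂ} (hc : HasLogVariation δ γ c) (hc' : HasLogVariation δ γ' c') :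
    c = c' := by
  obtain ⟨L, hL, rfl⟩ := hc
  obtain ⟨L', hL', rfl⟩ := hc'
  let D : C(X, {z : ℂ // z ≠ 0}) := ⟨fun x => ⟨δ x, h0 x⟩, by fun_prop⟩
  -- The two lifts may start at different logarithms of the same number; shifting by a period of
  -- `exp` makes them start together, as the homotopy lifting property requires.
  let Lshift : C(unitInterval, ℂ) := ⟨fun t => L' t + (L 0 - L' 0), by fun_prop⟩
  have hexp : exp (L 0 - L' 0) = 1 := by
    rw [exp_sub, hL, hL', γ.source, γ'.source, div_self (h0 _)]
  have e1 : D (γ 0) = (⟨_, (L 0).exp_ne_zero⟩ : {z : ℂ // z ≠ 0}) := Subtype.ext (hL 0).symm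
  have e2 : D (γ' 0) = (⟨_, (L 0).exp_ne_zero⟩ : {z : ℂ // z ≠ 0}) := by
    rw [γ'.source, ← γ.source, e1]
  have h1 := (isCoveringMap_exp.eq_liftPath_iff' (γ := D.comp γ.toContinuousMap) (e := L 0)
    (γ_0 := e1) (Γ := L)).2 ⟨funext fun t => Subtype.ext (hL t), rfl⟩
  have h2 := (isCoveringMap_exp.eq_liftPath_iff' (γ := D.comp γ'.toContinuousMap) (e := L 0)
    (γ_0 := e2) (Γ := Lshift)).2 ⟨funext fun t => Subtype.ext (by
      change exp (L' t + (L 0 - L' 0)) = δ (γ' t)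
      rw [exp_add, hexp, mul_one, hL']), by simp [Lshift]⟩
  have h3 := isCoveringMap_exp.liftPath_apply_one_eq_of_homotopicRel
    (γ₀ := D.comp γ.toContinuousMap) (γ₁ := D.comp γ'.toContinuousMap)
    (ContinuousMap.HomotopicRel.comp_continuousMap h D) (L 0) e1 e2
  rw [← h1, ← h2] at h3
  have h4 : L 1 = L' 1 + (L 0 - L' 0) := h3
  rw [h4]
  ring

theorem HasLogVariation.trans {x y z : X} {γ : Path x y} {γ' : Path y z} {c c' : ℂ}
    (hc : HasLogVariation δ γ c) (hc' : HasLogVariation δ γ' c') (h0 : ∀ x, δ x ≠ 0) :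
    HasLogVariation δ (γ.trans γ') (c + c') := by
  obtain ⟨L, hL, rfl⟩ := hc
  obtain ⟨L', hL', rfl⟩ := hc'
  have hexp : exp (L 1 - L' 0) = 1 := by
    rw [exp_sub, hL, hL', γ.target, γ'.source, div_self (h0 _)]
  let p : Path (L 0) (L 1) := ⟨L, rfl, rfl⟩
  let p' : Path (L 1) (L' 1 + (L 1 - L' 0)) :=
    ⟨⟨fun t => L' t + (L 1 - L' 0), by fun_prop⟩, by simp, rfl⟩
  refine ⟨(p.trans p').toContinuousMap, fun t => ?_, ?_⟩
  · change exp ((p.trans p') t) = _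
    rw [Path.trans_apply, Path.trans_apply]
    split_ifs with h
    · exact hL _
    · change exp (L' _ + (L 1 - L' 0)) = _
      rw [exp_add, hexp, mul_one, hL']
  · change (p.trans p') 1 - (p.trans p') 0 = _
    rw [Path.target, Path.source]
    ring

theorem HasLogVariation.symm {x y : X} {γ : Path x y} {c : ℂ} (hc : HasLogVariation δ γ c) :
    HasLogVariation δ γ.symm (-c) := by
  obtain ⟨L, hL, rfl⟩ := hc
  refine ⟨⟨fun t => L (unitInterval.symm t), by fun_prop⟩, fun t => hL _, ?_⟩
  simp

theorem hasLogVariation_refl (x : X) (h0 : ∀ x, δ x ≠ 0) :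
    HasLogVariation δ (Path.refl x) 0 :=
  ⟨ContinuousMap.const unitInterval (log (δ x)), fun _ => exp_log (h0 x), sub_self _⟩

theorem HasLogVariation.exists_int {x : X} {γ : Path x x} {c : ℂ} (hc : HasLogVariation δ γ c)
    (h0 : ∀ x, δ x ≠ 0) : ∃ k : ℤ, c = k * (2 * Real.pi * I) := by
  obtain ⟨L, hL, rfl⟩ := hc
  rw [← exp_eq_one_iff, exp_sub, hL, hL, γ.source, γ.target, div_self (h0 _)]

/-- The winding number around `0` of the image under `δ` of the loops based at `x`. -/
theorem exists_windingHom (hδ : Continuous δ) (h0 : ∀ x, δ x ≠ 0) (x : X) :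
    ∃ ℓ : (FundamentalGroup X x)ᵐᵒᵖ →* Multiplicative ℤ, ∀ (γ : Path x x) (k : ℤ),
      HasLogVariation δ γ (k * (2 * Real.pi * I)) →
        ℓ (MulOpposite.op (FundamentalGroup.fromPath (Path.Homotopic.Quotient.mk γ))) =
          Multiplicative.ofAdd k := by
  have hex : ∀ γ : Path x x, ∃ k : ℤ, HasLogVariation δ γ (k * (2 * Real.pi * I)) := by
    intro γ
    obtain ⟨c, hc⟩ := exists_hasLogVariation hδ h0 γ
    obtain ⟨k, rfl⟩ := hc.exists_int h0
    exact ⟨k, hc⟩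
  choose wind hwind using hex
  have huniq : ∀ {γ γ' : Path x x} {k k' : ℤ}, γ.Homotopic γ' →
      HasLogVariation δ γ (k * (2 * Real.pi * I)) →
      HasLogVariation δ γ' (k' * (2 * Real.pi * I)) → k = k' := by
    intro γ γ' k k' h hk hk'
    have := hk.unique hδ h0 h hk'
    exact_mod_cast mul_right_cancel₀ two_pi_I_ne_zero this
  let f : Path.Homotopic.Quotient x x → ℤ :=
    fun p => p.lift wind fun γ γ' h => huniq h (hwind γ) (hwind γ')
  have hf : ∀ (γ : Path x x) (k : ℤ), HasLogVariation δ γ (k * (2 * Real.pi * I)) →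
      f (Path.Homotopic.Quotient.mk γ) = k := fun γ k hk =>
    huniq (Path.Homotopic.refl γ) (hwind γ) hk
  refine ⟨{ toFun := fun p => Multiplicative.ofAdd (f (FundamentalGroup.toPath p.unop))
            map_one' := ?_
            map_mul' := ?_ }, fun γ k hk => congrArg Multiplicative.ofAdd (hf γ k hk)⟩
  · have := hf (Path.refl x) 0 (by simpa using hasLogVariation_refl x h0)
    exact congrArg Multiplicative.ofAdd this
  · intro p q
    induction p with | _ p
    induction q with | _ q
    obtain ⟨γ, rfl⟩ := Path.Homotopic.Quotient.mk_surjective p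
    obtain ⟨γ', rfl⟩ := Path.Homotopic.Quotient.mk_surjective q
    have := hf (γ.trans γ') (wind γ + wind γ') (by
      have := (hwind γ).trans (hwind γ') h0
      rwa [← add_mul, ← Int.cast_add] at this)
    exact congrArg Multiplicative.ofAdd this

/-- The disc is simply connected, so the arc from `1` to `ζ` may be replaced by the two radii
through `0`. Since `g (r ζ) = g r`, the variations along the radii cancel. This handles the factors
of the discriminant that do not vanish near the hyperplane of a meridian. -/
theorem exists_log_of_disc {g : ℂ → ℂ} (hg : Continuous g) (h0 : ∀ z, ‖z‖ ≤ 1 → g z ≠ 0) {ζ : ℂ}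
    (hζ : ‖ζ‖ ≤ 1) (hinv : ∀ r : ℝ, 0 ≤ r → r ≤ 1 → g (r * ζ) = g r) {arc : C(unitInterval, ℂ)}
    (harc : ∀ t, ‖arc t‖ ≤ 1) (ha0 : arc 0 = 1) (ha1 : arc 1 = ζ) :
    ∃ L : C(unitInterval, ℂ), (∀ t, exp (L t) = g (arc t)) ∧ L 1 - L 0 = 0 := by
  let one : Metric.closedBall (0 : ℂ) 1 := ⟨1, by simp⟩
  let zero : Metric.closedBall (0 : ℂ) 1 := ⟨0, by simp⟩
  let ζ' : Metric.closedBall (0 : ℂ) 1 := ⟨ζ, by simpa using hζ⟩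
  let δ : Metric.closedBall (0 : ℂ) 1 → ℂ := fun z => g z
  have hδ : Continuous δ := hg.comp continuous_subtype_val
  have hδ0 : ∀ z, δ z ≠ 0 := fun z => h0 z (mem_closedBall_zero_iff.1 z.2)
  have : ContractibleSpace (Metric.closedBall (0 : ℂ) 1) :=
    (convex_closedBall (0 : ℂ) 1).contractibleSpace ⟨0, by simp⟩
  let p : Path one ζ' :=
    ⟨⟨fun t => ⟨arc t, by simpa using harc t⟩, by fun_prop⟩, Subtype.ext ha0, Subtype.ext ha1⟩
  have hr : ∀ t : unitInterval, ‖((t : ℝ) : ℂ)‖ ≤ 1 := fun t => by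
    rw [Complex.norm_real, Real.norm_of_nonneg t.2.1]
    exact t.2.2
  let r₁ : Path zero one :=
    ⟨⟨fun t => ⟨(t : ℝ), by simpa using hr t⟩, by fun_prop⟩, Subtype.ext (by simp [zero]),
      Subtype.ext (by simp [one])⟩
  let r₂ : Path zero ζ' :=
    ⟨⟨fun t => ⟨(t : ℝ) * ζ, by
        rw [mem_closedBall_zero_iff, norm_mul]
        exact mul_le_one₀ (hr t) (norm_nonneg _) hζ⟩, by fun_prop⟩, Subtype.ext (by simp [zero]),
      Subtype.ext (by simp [ζ'])⟩
  obtain ⟨c, hc⟩ := exists_hasLogVariation hδ hδ0 r₁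
  have hc₂ : HasLogVariation δ r₂ c := by
    obtain ⟨L, hL, h⟩ := hc
    refine ⟨L, fun t => ?_, h⟩
    rw [hL]
    exact (hinv t t.2.1 t.2.2).symm
  have hpath : (r₁.symm.trans r₂).Homotopic p := SimplyConnectedSpace.paths_homotopic _ _
  obtain ⟨d, hd⟩ := exists_hasLogVariation hδ hδ0 p
  have h := (hc.symm.trans hc₂ hδ0).unique hδ hδ0 hpath hd
  rw [neg_add_cancel] at h
  rw [← h] at hd
  exact hd

end Winding

/-! ### The braid group -/

section Braid

variable {K : Type*} [Field K] [Algebra K ℂ] {n : ℕ} {W : Subgroup (GL (Fin n) K)}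

/-- The element `b` of the braid group is the class of the image of a path from `x₀` to `w x₀`. -/
def LiftsTo {x₀ : Vreg W} (b : Braid x₀) (w : W) : Prop :=
  ∃ (y : Vreg W) (h : act w.1 x₀.1 = y.1) (γ : Path x₀ y), b = ofLoop (projLoop w h γ)

theorem ofLoop_trans {x₀ : Vreg W} (γ γ' : Path (regProj x₀) (regProj x₀)) :
    ofLoop (γ.trans γ') = ofLoop γ * ofLoop γ' := rfl

theorem ofLoop_symm {x₀ : Vreg W} (γ : Path (regProj x₀) (regProj x₀)) :
    ofLoop γ.symm = (ofLoop γ)⁻¹ := rfl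

theorem ofLoop_refl {x₀ : Vreg W} : ofLoop (Path.refl (regProj x₀)) = 1 := rfl

theorem ofLoop_surjective {x₀ : Vreg W} (b : Braid x₀) : ∃ γ, ofLoop γ = b := by
  induction b with | _ p
  obtain ⟨γ, rfl⟩ := Path.Homotopic.Quotient.mk_surjective p
  exact ⟨γ, rfl⟩

/-- The action of `W` on `V^reg`. -/
def vregAct (w : W) (x : Vreg W) : Vreg W := ⟨act w.1 x.1, act_notMem_hyperplanes w.2 x.2⟩

theorem continuous_vregAct (w : W) : Continuous (vregAct w) :=
  Continuous.subtype_mk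
    ((LinearMap.continuous_of_finiteDimensional (act w.1)).comp continuous_subtype_val) _

theorem regProj_vregAct (w : W) (x : Vreg W) : regProj (vregAct w x) = regProj x :=
  (Quotient.sound (s := regSetoid W) ⟨w.1, w.2, rfl⟩).symm

theorem LiftsTo.exists_path {x₀ : Vreg W} {b : Braid x₀} {w : W} (h : LiftsTo b w) :
    ∃ γ : Path x₀ (vregAct w x₀), b = ofLoop (projLoop w rfl γ) := by
  obtain ⟨y, hy, γ, rfl⟩ := h
  obtain rfl : vregAct w x₀ = y := Subtype.ext hy
  exact ⟨γ, rfl⟩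

/-- The second path must start where the first ends, at `w x₀`. Translating it by `w` does not
change its image in `V^reg / W`. -/
theorem LiftsTo.mul {x₀ : Vreg W} {b b' : Braid x₀} {w w' : W} (h : LiftsTo b w)
    (h' : LiftsTo b' w') : LiftsTo (b * b') (w * w') := by
  obtain ⟨γ, rfl⟩ := h.exists_path
  obtain ⟨γ', rfl⟩ := h'.exists_path
  refine ⟨vregAct w (vregAct w' x₀), act_mul_apply _ _ _,
    γ.trans (γ'.map (continuous_vregAct w)), ?_⟩
  rw [← ofLoop_trans]
  congr 1
  ext t
  change ((projLoop w rfl γ).trans (projLoop w' rfl γ')) t =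
    regProj ((γ.trans (γ'.map (continuous_vregAct w))) t)
  rw [Path.trans_apply, Path.trans_apply]
  split_ifs
  · rfl
  · exact (regProj_vregAct w _).symm

theorem LiftsTo.inv {x₀ : Vreg W} {b : Braid x₀} {w : W} (h : LiftsTo b w) :
    LiftsTo b⁻¹ w⁻¹ := by
  obtain ⟨γ, rfl⟩ := h.exists_path
  have e : vregAct w⁻¹ (vregAct w x₀) = x₀ := Subtype.ext (act_inv_act w.1 x₀.1)
  refine ⟨vregAct w⁻¹ x₀, rfl, ((γ.map (continuous_vregAct w⁻¹)).cast rfl e.symm).symm, ?_⟩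
  rw [← ofLoop_symm]
  congr 1
  ext t
  exact (regProj_vregAct w⁻¹ _).symm

theorem exists_liftsTo [Finite W] (x₀ : Vreg W) (w : W) : ∃ b : Braid x₀, LiftsTo b w := by
  obtain ⟨γ⟩ := vreg_joined x₀ (vregAct w x₀)
  exact ⟨_, _, rfl, γ, rfl⟩

/-- The function on `V^reg / W` induced by `∏_{H ∈ C} α_H ^ e_C`. -/
def discr [Finite W] (hgen : Subgroup.closure {w | w ∈ W ∧ IsPseudoReflection w} = W)
    (C : HypOrbit W) : RegQuot W → ℂ :=
  Quotient.lift (fun x : Vreg W => orbitForm C x.1 ^ ramif C) (by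
    rintro x y ⟨w, hw, h⟩
    rw [← h, orbitForm_act_pow hgen C hw])

theorem continuous_discr [Finite W]
    (hgen : Subgroup.closure {w | w ∈ W ∧ IsPseudoReflection w} = W) (C : HypOrbit W) :
    Continuous (discr hgen C) :=
  Continuous.quotient_lift (((continuous_orbitForm C).comp continuous_subtype_val).pow _) _

theorem discr_ne_zero [Finite W]
    (hgen : Subgroup.closure {w | w ∈ W ∧ IsPseudoReflection w} = W) (C : HypOrbit W)
    (x : RegQuot W) : discr hgen C x ≠ 0 := by
  obtain ⟨x, rfl⟩ := Quotient.exists_rep x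
  exact pow_ne_zero _ (orbitForm_ne_zero C x)

theorem norm_exp_two_pi_I_mul_div (t : ℝ) (e : ℕ) :
    ‖Complex.exp (2 * Real.pi * Complex.I * t / e)‖ = 1 := by
  have : (2 * Real.pi * Complex.I * t / e : ℂ) = ((2 * Real.pi * t / e : ℝ) : ℂ) * Complex.I := by
    push_cast
    ring
  rw [this, Complex.norm_exp_ofReal_mul_I]

theorem Meridian.act_eq {x₀ : Vreg W} {C : HypOrbit W} (M : Meridian x₀ C) (z : ℂ) :
    act M.s.1 (M.a + z • M.p) =
      M.a + (z * Complex.exp (2 * Real.pi * Complex.I / ramif C)) • M.p := by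
  have ha : act M.s.1 M.a = M.a := by
    have := M.a_mem
    rwa [← M.fixed] at this
  rw [map_add, map_smul, ha, M.eigen, smul_smul]

/-- The arc `t ↦ exp(2πit/e)` of the unit circle. -/
def circleArc (e : ℕ) : C(unitInterval, ℂ) :=
  ⟨fun t => Complex.exp (2 * Real.pi * Complex.I * (t : ℝ) / e), by fun_prop⟩

/-- The disc of the meridian meets no hyperplane of `C`, and the reflection acts on it by `z ↦ ζ z`.
Invariance of the discriminant is thus the symmetry asked for by `exists_log_of_disc`. -/
theorem Meridian.hasLogVariation_ne [Finite W]
    (hgen : Subgroup.closure {w | w ∈ W ∧ IsPseudoReflection w} = W) {x₀ : Vreg W}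
    {C C' : HypOrbit W} (M : Meridian x₀ C') (hC : C' ≠ C) :
    HasLogVariation (discr hgen C) (projLoop M.s M.s_x M.arc) 0 := by
  obtain ⟨L, hL, h⟩ := exists_log_of_disc
    (g := fun z => orbitForm C (M.a + z • M.p) ^ ramif C)
    (ζ := Complex.exp (2 * Real.pi * Complex.I / ramif C')) (arc := circleArc (ramif C'))
    (((continuous_orbitForm C).comp (by fun_prop)).pow _) (fun z hz => pow_ne_zero _ fun h0 => by
      obtain ⟨H, hH, hx⟩ := orbitForm_eq_zero.1 h0
      refine M.near H.1 H.2 (fun h1 => hC ?_) z hz hx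
      rw [← M.mem_orbit, ← hH, Subtype.ext h1])
    (by simpa using (norm_exp_two_pi_I_mul_div 1 (ramif C')).le)
    (fun r _ _ => by
      rw [← M.act_eq, orbitForm_act_pow hgen C M.s.2])
    (fun t => (norm_exp_two_pi_I_mul_div _ _).le) (by simp [circleArc]) (by simp [circleArc])
  refine ⟨L, fun t => (hL t).trans ?_, h⟩
  change orbitForm C (M.a + Complex.exp _ • M.p) ^ ramif C = orbitForm C (M.arc t).1 ^ ramif C
  rw [M.arc_eq]

open Classical in
-- On the disc the product of the linear forms is `z α_H(p) f(z)`, with `f` free of zeros. Along the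
-- arc `z ^ e_C` turns exactly once, and `f ^ e_C` contributes nothing.
theorem Meridian.hasLogVariation_self [Finite W]
    (hgen : Subgroup.closure {w | w ∈ W ∧ IsPseudoReflection w} = W) {x₀ : Vreg W}
    {C : HypOrbit W} (M : Meridian x₀ C) :
    HasLogVariation (discr hgen C) (projLoop M.s M.s_x M.arc) (2 * Real.pi * Complex.I) := by
  have := Fintype.ofFinite {H : hyperplanes W // Quotient.mk (hyperplaneSetoid W) H = C}
  have he : (ramif C : ℂ) ≠ 0 := Nat.cast_ne_zero.2 (ramif_ne_zero C)
  let H₀ : {H : hyperplanes W // Quotient.mk (hyperplaneSetoid W) H = C} := ⟨M.H, M.mem_orbit⟩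
  let f : ℂ → ℂ := fun z => ∏ H ∈ Finset.univ.erase H₀, hypForm H.1 (M.a + z • M.p)
  have hα : hypForm M.H M.p ≠ 0 := fun h => M.p_not_mem (hypForm_eq_zero.1 h)
  have hsplit : ∀ z : ℂ, orbitForm C (M.a + z • M.p) = z * hypForm M.H M.p * f z := by
    intro z
    rw [orbitForm, finprod_eq_prod_of_fintype,
      ← Finset.mul_prod_erase Finset.univ _ (Finset.mem_univ H₀)]
    congr 1
    rw [map_add, map_smul, hypForm_eq_zero.2 M.a_mem, zero_add, smul_eq_mul]
  have hζ : Complex.exp (2 * Real.pi * Complex.I / ramif C) ^ ramif C = 1 := by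
    rw [← Complex.exp_nat_mul, mul_div_cancel₀ _ he, Complex.exp_two_pi_mul_I]
  obtain ⟨L, hL, h⟩ := exists_log_of_disc
    (g := fun z => f z ^ ramif C)
    (ζ := Complex.exp (2 * Real.pi * Complex.I / ramif C)) (arc := circleArc (ramif C))
    ((continuous_finsetProd _ fun H _ => (continuous_hypForm H.1).comp (by fun_prop)).pow _)
    (fun z hz => pow_ne_zero _ (Finset.prod_ne_zero_iff.2 fun H hH h0 => by
      refine M.near H.1.1 H.1.2 (fun h1 => ?_) z hz (hypForm_eq_zero.1 h0)
      exact (Finset.mem_erase.1 hH).1 (Subtype.ext (Subtype.ext h1))))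
    (by simpa using (norm_exp_two_pi_I_mul_div 1 (ramif C)).le)
    (fun r _ _ => by
      -- The symmetry of `f ^ e_C` comes from that of the whole product by cancelling `r ^ e_C`,
      -- which needs `r ≠ 0`; at `r = 0` both sides are the same value.
      by_cases hr : (r : ℂ) = 0
      · rw [hr, zero_mul]
      have h1 := orbitForm_act_pow hgen C M.s.2 (M.a + (r : ℂ) • M.p)
      rw [M.act_eq, hsplit, hsplit] at h1
      simp only [mul_pow, hζ, mul_one] at h1
      exact mul_left_cancel₀ (mul_ne_zero (pow_ne_zero _ hr) (pow_ne_zero _ hα)) h1)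
    (fun t => (norm_exp_two_pi_I_mul_div _ _).le) (by simp [circleArc]) (by simp [circleArc])
  refine ⟨⟨fun t => 2 * Real.pi * Complex.I * (t : ℝ) + (Complex.log (hypForm M.H M.p ^ ramif C)
    + L t), by fun_prop⟩, fun t => ?_, ?_⟩
  · change Complex.exp (_ + (_ + L t)) = orbitForm C (M.arc t).1 ^ ramif C
    rw [M.arc_eq, hsplit, Complex.exp_add, Complex.exp_add, hL, mul_pow, mul_pow,
      Complex.exp_log (pow_ne_zero _ hα), ← Complex.exp_nat_mul, mul_div_cancel₀ _ he]
    exact (mul_assoc _ _ _).symm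
  · change (_ * (((1 : unitInterval) : ℝ) : ℂ) + (_ + L 1)) - (_ * (((0 : unitInterval) : ℝ) : ℂ)
      + (_ + L 0)) = _
    rw [Set.Icc.coe_one, Set.Icc.coe_zero, Complex.ofReal_one, Complex.ofReal_zero]
    linear_combination h

/-- The length functions on the braid group: `ℓ_C` counts the generators of the monodromy around
the elements of `C`. -/
theorem exists_braidLength [Finite W]
    (hgen : Subgroup.closure {w | w ∈ W ∧ IsPseudoReflection w} = W) (x₀ : Vreg W) :
    ∃ ℓ : HypOrbit W → Braid x₀ →* Multiplicative ℤ,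
      (∀ C b, IsBraidReflection C b → ℓ C b = Multiplicative.ofAdd 1) ∧
      (∀ C C' b, C' ≠ C → IsBraidReflection C' b → ℓ C b = 1) ∧
      (∀ C b, LiftsTo b 1 → ∃ k : ℤ, ℓ C b = Multiplicative.ofAdd (ramif C * k)) := by
  choose ℓ hℓ using fun C => exists_windingHom (continuous_discr hgen C) (discr_ne_zero hgen C)
    (regProj x₀)
  have key : ∀ C C' (M : Meridian x₀ C') (k : ℤ), HasLogVariation (discr hgen C)
      (projLoop M.s M.s_x M.arc) (k * (2 * Real.pi * Complex.I)) →
      ℓ C M.toBraid = Multiplicative.ofAdd k := by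
    intro C C' M k hk
    obtain ⟨c, hc⟩ := exists_hasLogVariation (continuous_discr hgen C) (discr_ne_zero hgen C)
      (M.γ.map continuous_regProj)
    -- The path to the neighbourhood of the hyperplane is run in both directions, so its
    -- contribution `c` cancels.
    have := (hc.trans hk (discr_ne_zero hgen C)).trans hc.symm (discr_ne_zero hgen C)
    rw [show c + k * (2 * Real.pi * Complex.I) + -c = k * (2 * Real.pi * Complex.I) by ring] at this
    exact hℓ C _ k this
  refine ⟨ℓ, ?_, ?_, ?_⟩
  · rintro C b ⟨M, rfl⟩
    exact key C C M 1 (by simpa using M.hasLogVariation_self hgen)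
  · rintro C C' b hC ⟨M, rfl⟩
    exact key C C' M 0 (by simpa using M.hasLogVariation_ne hgen hC)
  · rintro C b h
    obtain ⟨γ, rfl⟩ := h.exists_path
    -- On `V^reg` the product of the linear forms exists without the exponent `e_C` and has an
    -- integral winding number along the lifted loop. The discriminant is its `e_C`-th power.
    obtain ⟨c, L, hL, hc⟩ := exists_hasLogVariation
      (δ := fun x : Vreg W => orbitForm C x.1)
      ((continuous_orbitForm C).comp continuous_subtype_val) (orbitForm_ne_zero C) γ
    have h1 : ∃ k : ℤ, c = k * (2 * Real.pi * Complex.I) := by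
      rw [← Complex.exp_eq_one_iff, ← hc, Complex.exp_sub, hL, hL, γ.source, γ.target]
      have : (vregAct (1 : W) x₀).1 = x₀.1 := by
        change act (1 : GL (Fin n) K) x₀.1 = x₀.1
        rw [act_one, LinearMap.id_apply]
      change orbitForm C (vregAct (1 : W) x₀).1 / orbitForm C x₀.1 = 1
      rw [this, div_self (orbitForm_ne_zero C x₀)]
    obtain ⟨k, rfl⟩ := h1
    refine ⟨k, hℓ C _ _ ⟨⟨fun t => ramif C * L t, by fun_prop⟩, fun t => ?_, ?_⟩⟩
    · change Complex.exp (ramif C * L t) = orbitForm C (γ t).1 ^ ramif C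
      rw [Complex.exp_nat_mul, hL]
    · change ramif C * L 1 - ramif C * L 0 = _
      rw [← mul_sub, hc]
      push_cast
      ring

end Braid

end CycHecke
end

noncomputable section

namespace CycHecke

/-! ### Hecke algebras: generators, twists and specializations -/

section HeckeBasic

variable {K : Type*} [Field K] [Algebra K ℂ] {n : ℕ} {W : Subgroup (GL (Fin n) K)}
variable {x₀ : Vreg W} {S : Type*} [CommRing S] {u : Param W S}

theorem T_mul (b b' : Braid x₀) : T x₀ u (b * b') = T x₀ u b * T x₀ u b' := by
  rw [T, map_mul, map_mul]; rfl

theorem T_one : T x₀ u 1 = 1 := by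
  rw [T, map_one, map_one]

theorem T_mul_inv (b : Braid x₀) : T x₀ u b * T x₀ u b⁻¹ = 1 := by
  rw [← T_mul, mul_inv_cancel, T_one]

/-- `b ↦ T_b` as a homomorphism of monoids. -/
def THom (x₀ : Vreg W) (u : Param W S) : Braid x₀ →* Hecke x₀ u where
  toFun := T x₀ u
  map_one' := T_one
  map_mul' := T_mul

theorem span_range_T : Submodule.span S (Set.range (T x₀ u)) = ⊤ := by
  rw [eq_top_iff]
  rintro h -
  obtain ⟨a, rfl⟩ := RingQuot.mkAlgHom_surjective S (HeckeRel x₀ u) h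
  induction a using MonoidAlgebra.induction_on with
  | of b => exact Submodule.subset_span ⟨b, rfl⟩
  | add a b ha hb => rw [map_add]; exact Submodule.add_mem _ ha hb
  | smul r a ha => rw [map_smul]; exact Submodule.smul_mem _ _ ha

theorem Hecke.induction {p : Hecke x₀ u → Prop} (h : Hecke x₀ u) (hT : ∀ b, p (T x₀ u b))
    (hadd : ∀ a b, p a → p b → p (a + b)) (hsmul : ∀ (r : S) a, p a → p (r • a)) : p h := by
  obtain ⟨a, rfl⟩ := RingQuot.mkAlgHom_surjective S (HeckeRel x₀ u) h
  induction a using MonoidAlgebra.induction_on with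
  | of b => exact hT b
  | add a b ha hb => rw [map_add]; exact hadd _ _ ha hb
  | smul r a ha => rw [map_smul]; exact hsmul _ _ ha

theorem Hecke.algHom_ext {A : Type*} [Semiring A] [Algebra S A] {f g : Hecke x₀ u →ₐ[S] A}
    (h : ∀ b, f (T x₀ u b) = g (T x₀ u b)) : f = g := by
  ext x
  exact h x

/-- The algebra homomorphism defined by the images of the elements of the braid group. -/
def Hecke.lift {A : Type*} [Ring A] [Algebra S A] (g : Braid x₀ →* A)
    (hg : ∀ C s, IsBraidReflection C s → Polynomial.aeval (g s) (paramPoly u C) = 0) :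
    Hecke x₀ u →ₐ[S] A :=
  RingQuot.liftAlgHom S ⟨MonoidAlgebra.lift S A _ g, by
    rintro _ _ ⟨C, s, hs⟩
    rw [map_zero, ← Polynomial.aeval_algHom_apply, MonoidAlgebra.lift_of]
    exact hg C s hs⟩

theorem Hecke.lift_T {A : Type*} [Ring A] [Algebra S A] (g : Braid x₀ →* A)
    (hg : ∀ C s, IsBraidReflection C s → Polynomial.aeval (g s) (paramPoly u C) = 0)
    (b : Braid x₀) : Hecke.lift g hg (T x₀ u b) = g b := by
  rw [Hecke.lift, T, RingQuot.liftAlgHom_mkAlgHom_apply, MonoidAlgebra.lift_of]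

theorem aeval_T_paramPoly {C : HypOrbit W} {s : Braid x₀} (hs : IsBraidReflection C s) :
    Polynomial.aeval (T x₀ u s) (paramPoly u C) = 0 := by
  rw [T, Polynomial.aeval_algHom_apply, RingQuot.mkAlgHom_rel S (HeckeRel.rel C s hs), map_zero]

theorem Hecke.spec_T {S' : Type*} [CommRing S'] (f : S →+* S') (b : Braid x₀) :
    Hecke.spec x₀ f u (T x₀ u b) = T x₀ (u.map f) b := by
  have h1 : T x₀ u b = RingQuot.mkRingHom (HeckeRel x₀ u) (MonoidAlgebra.of S (Braid x₀) b) := by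
    rw [T, ← RingQuot.mkAlgHom_coe S]; rfl
  have h2 : T x₀ (u.map f) b =
      RingQuot.mkRingHom (HeckeRel x₀ (u.map f)) (MonoidAlgebra.of S' (Braid x₀) b) := by
    rw [T, ← RingQuot.mkAlgHom_coe S']; rfl
  rw [h1, h2, Hecke.spec, RingQuot.lift_mkRingHom_apply, RingHom.comp_apply]
  simp

theorem Hecke.spec_algebraMap {S' : Type*} [CommRing S'] (f : S →+* S') (r : S) :
    Hecke.spec x₀ f u (algebraMap S _ r) = algebraMap S' _ (f r) := by
  have h1 : algebraMap S (Hecke x₀ u) r =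
      RingQuot.mkRingHom (HeckeRel x₀ u) (algebraMap S (MonoidAlgebra S (Braid x₀)) r) := by
    rw [← RingQuot.mkAlgHom_coe S]
    exact ((RingQuot.mkAlgHom S (HeckeRel x₀ u)).commutes r).symm
  have h2 : algebraMap S' (Hecke x₀ (u.map f)) (f r) = RingQuot.mkRingHom (HeckeRel x₀ (u.map f))
      (algebraMap S' (MonoidAlgebra S' (Braid x₀)) (f r)) := by
    rw [← RingQuot.mkAlgHom_coe S']
    exact ((RingQuot.mkAlgHom S' (HeckeRel x₀ (u.map f))).commutes (f r)).symm
  rw [h1, h2, Hecke.spec, RingQuot.lift_mkRingHom_apply, RingHom.comp_apply]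
  simp [MonoidAlgebra.coe_algebraMap]

theorem Hecke.spec_smul {S' : Type*} [CommRing S'] (f : S →+* S') (r : S) (h : Hecke x₀ u) :
    Hecke.spec x₀ f u (r • h) = f r • Hecke.spec x₀ f u h := by
  rw [Algebra.smul_def, map_mul, Hecke.spec_algebraMap, ← Algebra.smul_def]

/-- Twisting `T_b` by the linear character `χ` sends the relations for `u` to those for `u'`. -/
def Compat (χ : Braid x₀ →* Sˣ) (u u' : Param W S) : Prop :=
  ∀ C s, IsBraidReflection C s → ∃ g : ZMod (ramif C), ∀ j, u C j = χ s * u' C (j + g)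

theorem Compat.symm {χ : Braid x₀ →* Sˣ} {u u' : Param W S} (h : Compat χ u u') :
    Compat χ⁻¹ u' u := by
  intro C s hs
  obtain ⟨g, hg⟩ := h C s hs
  refine ⟨-g, fun j => ?_⟩
  rw [hg, neg_add_cancel_right, MonoidHom.inv_apply, inv_mul_cancel_left]

theorem Compat.map {S' : Type*} [CommRing S'] (f : S →+* S') {χ : Braid x₀ →* Sˣ}
    {u u' : Param W S} (h : Compat χ u u') :
    Compat ((Units.map (f : S →* S')).comp χ) (u.map f) (u'.map f) := by
  intro C s hs
  obtain ⟨g, hg⟩ := h C s hs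
  refine ⟨g, fun j => ?_⟩
  rw [Param.map, hg, map_mul]
  rfl

theorem prod_range_eq_prod_zmod {M : Type*} [CommMonoid M] {e : ℕ} [NeZero e] (f : ZMod e → M) :
    ∏ j ∈ Finset.range e, f j = ∏ j : ZMod e, f j := by
  refine Finset.prod_bij' (fun j _ => (j : ZMod e)) (fun j _ => j.val) ?_ ?_ ?_ ?_ ?_
  · intros; exact Finset.mem_univ _
  · intro j _; exact Finset.mem_range.2 (ZMod.val_lt j)
  · intro j hj; exact ZMod.val_cast_of_lt (Finset.mem_range.1 hj)
  · intro j _; exact ZMod.natCast_zmod_val j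
  · intros; rfl

/-- If `P` and `P'` are the polynomials of `u` and `u'`, then `P(χ(s) X) = χ(s) ^ e_C P'(X)`:
translating `j` only reorders the factors. -/
theorem Compat.aeval_eq_zero [Finite W] {χ : Braid x₀ →* Sˣ} {u u' : Param W S}
    (h : Compat χ u u') {A : Type*} [Ring A] [Algebra S A] {C : HypOrbit W} {s : Braid x₀}
    (hs : IsBraidReflection C s) {a : A} (ha : Polynomial.aeval a (paramPoly u' C) = 0) :
    Polynomial.aeval ((χ s : S) • a) (paramPoly u C) = 0 := by
  have : NeZero (ramif C) := ⟨ramif_ne_zero C⟩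
  obtain ⟨g, hg⟩ := h C s hs
  have key : (paramPoly u C).comp (Polynomial.C (χ s : S) * Polynomial.X) =
      Polynomial.C ((χ s : S) ^ ramif C) * paramPoly u' C := by
    rw [paramPoly, paramPoly,
      prod_range_eq_prod_zmod fun j => Polynomial.X - Polynomial.C (u C j : S),
      prod_range_eq_prod_zmod fun j => Polynomial.X - Polynomial.C (u' C j : S),
      Polynomial.prod_comp]
    rw [← Equiv.prod_comp (Equiv.addRight g) (fun j => Polynomial.X - Polynomial.C (u' C j : S))]
    have : Polynomial.C ((χ s : S) ^ ramif C) =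
        ∏ _j : ZMod (ramif C), Polynomial.C (χ s : S) := by
      rw [Finset.prod_const, Finset.card_univ, ZMod.card, map_pow]
    rw [this, ← Finset.prod_mul_distrib]
    refine Finset.prod_congr rfl fun j _ => ?_
    rw [hg j]
    simp [mul_sub]
  have h2 : Polynomial.aeval ((χ s : S) • a) (paramPoly u C) =
      Polynomial.aeval a ((paramPoly u C).comp (Polynomial.C (χ s : S) * Polynomial.X)) := by
    rw [Polynomial.aeval_comp]
    congr 2
    simp [Algebra.smul_def]
  rw [h2, key, map_mul, ha, mul_zero]

/-- The homomorphism `T_b ↦ χ(b) T_b` between Hecke algebras. -/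
def twistHom [Finite W] {χ : Braid x₀ →* Sˣ} {u u' : Param W S} (h : Compat χ u u') :
    Hecke x₀ u →ₐ[S] Hecke x₀ u' :=
  Hecke.lift
    { toFun := fun b => (χ b : S) • T x₀ u' b
      map_one' := by rw [map_one, T_one, Units.val_one, one_smul]
      map_mul' := fun b b' => by
        rw [map_mul, T_mul, Units.val_mul, smul_mul_smul_comm] }
    fun _ _ hs => h.aeval_eq_zero hs (aeval_T_paramPoly hs)

theorem twistHom_T [Finite W] {χ : Braid x₀ →* Sˣ} {u u' : Param W S} (h : Compat χ u u')
    (b : Braid x₀) : twistHom h (T x₀ u b) = (χ b : S) • T x₀ u' b :=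
  Hecke.lift_T _ _ b

/-- The isomorphism `T_b ↦ χ(b) T_b` between Hecke algebras. -/
def twistEquiv [Finite W] {χ : Braid x₀ →* Sˣ} {u u' : Param W S} (h : Compat χ u u') :
    Hecke x₀ u ≃ₐ[S] Hecke x₀ u' :=
  AlgEquiv.ofAlgHom (twistHom h) (twistHom h.symm)
    (Hecke.algHom_ext fun b => by
      simp [twistHom_T, smul_smul])
    (Hecke.algHom_ext fun b => by
      simp [twistHom_T, smul_smul])

theorem twistEquiv_T [Finite W] {χ : Braid x₀ →* Sˣ} {u u' : Param W S} (h : Compat χ u u')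
    (b : Braid x₀) : twistEquiv h (T x₀ u b) = (χ b : S) • T x₀ u' b :=
  twistHom_T h b

theorem twistEquiv_spec [Finite W] {S' : Type*} [CommRing S'] (f : S →+* S')
    {χ : Braid x₀ →* Sˣ} {u u' : Param W S} (h : Compat χ u u') (a : Hecke x₀ u) :
    twistEquiv (h.map f) (Hecke.spec x₀ f u a) = Hecke.spec x₀ f u' (twistEquiv h a) := by
  induction a using Hecke.induction with
  | hT b =>
    rw [Hecke.spec_T, twistEquiv_T, twistEquiv_T, Hecke.spec_smul, Hecke.spec_T]
    rfl
  | hadd a b ha hb => simp only [map_add, ha, hb]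
  | hsmul r a ha => rw [Hecke.spec_smul, map_smul, map_smul, Hecke.spec_smul, ha]

/-! ### The generic ring -/

theorem genEval_single (u : Param W S) (f : (Σ C : HypOrbit W, ZMod (ramif C)) →₀ ℤ) (c : ℤ) :
    genEval u (AddMonoidAlgebra.single f c) =
      c * ((f.prod fun i (k : ℤ) => u i.1 i.2 ^ k : Sˣ) : S) := by
  change AddMonoidAlgebra.lift ℤ S _ _ (AddMonoidAlgebra.single f c) = _
  rw [AddMonoidAlgebra.lift_single, zsmul_eq_mul]
  rfl

theorem genEval_genParam (u : Param W S) (C : HypOrbit W) (j : ZMod (ramif C)) :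
    genEval u (genParam W C j : GenRing W) = u C j := by
  change genEval u (AddMonoidAlgebra.single _ 1) = _
  rw [genEval_single]
  simp

theorem genParam_map_genEval (u : Param W S) : (genParam W).map (genEval u) = u := by
  funext C j
  exact Units.ext (genEval_genParam u C j)

theorem genRing_hom_ext {A : Type*} [CommRing A] {f g : GenRing W →+* A}
    (h : ∀ C j, f (genParam W C j) = g (genParam W C j)) : f = g := by
  refine AddMonoidAlgebra.ringHom_ext (fun c => ?_) fun m => ?_
  · have h1 : (AddMonoidAlgebra.single 0 c : GenRing W) = (c : GenRing W) := by
      rw [AddMonoidAlgebra.intCast_def]; rfl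
    rw [h1, map_intCast, map_intCast]
  · let F : Multiplicative ((Σ C : HypOrbit W, ZMod (ramif C)) →₀ ℤ) →* A :=
      (f : GenRing W →* A).comp (AddMonoidAlgebra.of ℤ _)
    let G : Multiplicative ((Σ C : HypOrbit W, ZMod (ramif C)) →₀ ℤ) →* A :=
      (g : GenRing W →* A).comp (AddMonoidAlgebra.of ℤ _)
    suffices hFG : F = G from DFunLike.congr_fun hFG (Multiplicative.ofAdd m)
    refine Finsupp.mulHom_ext' fun i => ?_
    refine MonoidHom.ext_mint ?_
    exact h i.1 i.2

theorem genEval_genParam_eq_id : genEval (genParam W) = RingHom.id (GenRing W) :=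
  genRing_hom_ext fun C j => by rw [genEval_genParam]; rfl

instance : CharZero (GenRing W) := (genEval (1 : Param W ℤ)).charZero

/-- Every family of parameters is a specialization of the generic one, and the images of a generic
basis span the specialized algebra. -/
theorem Hecke.finite [Finite W]
    (hfree : Nonempty (Module.Basis W (GenRing W) (Hecke x₀ (genParam W)))) (u : Param W S) :
    Module.Finite S (Hecke x₀ u) := by
  obtain ⟨b⟩ := hfree
  have := Fintype.ofFinite W
  obtain ⟨u', rfl⟩ : ∃ f : GenRing W →+* S, u = (genParam W).map f :=
    ⟨genEval u, (genParam_map_genEval u).symm⟩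
  let N := Submodule.span S (Set.range fun w => Hecke.spec x₀ u' (genParam W) (b w))
  have hN : ∀ h, Hecke.spec x₀ u' (genParam W) h ∈ N := by
    intro h
    rw [← b.sum_repr h, map_sum]
    refine Submodule.sum_mem _ fun w _ => ?_
    rw [Hecke.spec_smul]
    exact Submodule.smul_mem _ _ (Submodule.subset_span ⟨w, rfl⟩)
  have htop : N = ⊤ := by
    rw [eq_top_iff, ← span_range_T, Submodule.span_le]
    rintro _ ⟨c, rfl⟩
    rw [← Hecke.spec_T]
    exact hN _
  refine ⟨?_⟩
  rw [← htop]
  exact Submodule.fg_span (Set.finite_range _)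

end HeckeBasic

end CycHecke
end

noncomputable section

namespace CycHecke

/-! ### Symmetric algebras -/

theorem trace_eq_finrank_range {F M : Type*} [Field F] [AddCommGroup M] [Module F M]
    [Module.Finite F M] {f : M →ₗ[F] M} (hf : IsIdempotentElem f) :
    LinearMap.trace F M f = (Module.finrank F (LinearMap.range f) : F) :=
  (LinearMap.IsIdempotentElem.isProj_range f hf).trace

section Symmetric

variable {R : Type*} [CommRing R] {H : Type*} [Ring H] [Algebra R H] {t : H →ₗ[R] R}

theorem IsSymmetrizing.eq_zero (ht : IsSymmetrizing t) {a : H} (h : ∀ x, t (a * x) = 0) :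
    a = 0 := by
  apply ht.2.1
  ext x
  simp [h x]

theorem IsSymmetrizing.exists_dual (ht : IsSymmetrizing t) (f : H →ₗ[R] R) :
    ∃ a, ∀ x, t (a * x) = f x := by
  obtain ⟨a, ha⟩ := ht.2.2 f
  exact ⟨a, fun x => LinearMap.congr_fun ha x⟩

variable {ι : Type*} (b : Module.Basis ι R H)

theorem IsSymmetrizing.exists_dualBasis (ht : IsSymmetrizing t) :
    ∃ b' : ι → H, ∀ i x, t (b' i * x) = b.repr x i := by
  choose b' hb' using fun i => ht.exists_dual (b.coord i)
  exact ⟨b', hb'⟩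

variable [Fintype ι]

theorem trace_mulLeft_eq {b' : ι → H} (hb' : ∀ i x, t (b' i * x) = b.repr x i) (h : H) :
    LinearMap.trace R H (LinearMap.mulLeft R h) = ∑ i, t (b' i * (h * b i)) := by
  classical
  rw [LinearMap.trace_eq_matrix_trace R b, Matrix.trace]
  refine Finset.sum_congr rfl fun i _ => ?_
  rw [Matrix.diag_apply, LinearMap.toMatrix_apply, hb', LinearMap.mulLeft_apply]

variable {S : Type*} [CommRing S] [CharZero S] {ev : R →+* S} {N : ℕ}

/-- If the trace form specializes to a non-zero multiple of a symmetrizing form, then it is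
non-degenerate. -/
theorem IsSymmetrizing.eq_zero_of_trace (b : Module.Basis ι R H) [IsDomain R]
    [IsDomain S] (ht : IsSymmetrizing t) (hN : N ≠ 0)
    (hev : ∀ h, ev (LinearMap.trace R H (LinearMap.mulLeft R h)) = N * ev (t h)) {a : H}
    (ha : ∀ x, LinearMap.trace R H (LinearMap.mulLeft R (a * x)) = 0) : a = 0 := by
  classical
  obtain ⟨b', hb'⟩ := ht.exists_dualBasis b
  let tr : H → R := fun h => LinearMap.trace R H (LinearMap.mulLeft R h)
  let M : Matrix ι ι R := fun i j => tr (b i * b j)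
  let Q : Matrix ι ι R := fun i j => t (b i * b j)
  let D : Matrix ι ι R := fun i j => b.repr (b' i) j
  -- The coordinates of the dual basis give an inverse of the Gram matrix of `t`, so its determinant
  -- is a unit and survives every specialization.
  have hDQ : D * Q = 1 := by
    ext i j
    rw [Matrix.mul_apply, Matrix.one_apply]
    have : ∑ k, D i k * Q k j = t (b' i * b j) := by
      conv_rhs => rw [← b.sum_repr (b' i), Finset.sum_mul, map_sum]
      refine Finset.sum_congr rfl fun k _ => ?_
      rw [smul_mul_assoc, map_smul, smul_eq_mul]
    rw [this, hb', b.repr_self, Finsupp.single_apply]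
    simp only [eq_comm]
  have hQ : IsUnit Q.det := by
    have := congrArg Matrix.det hDQ
    rw [Matrix.det_mul, Matrix.det_one] at this
    exact IsUnit.of_mul_eq_one_right _ this
  -- It is enough to see this after applying `ev`, where the Gram matrix of the trace form is `N`
  -- times that of `t`.
  have hMdet : M.det ≠ 0 := by
    intro h0
    have h1 : ev.mapMatrix M = (N : S) • ev.mapMatrix Q := by
      ext i j
      exact hev (b i * b j)
    have h2 := ev.map_det M
    rw [h0, map_zero, h1, Matrix.det_smul, ← RingHom.map_det] at h2
    have h3 := mul_ne_zero (pow_ne_zero (Fintype.card ι) (Nat.cast_ne_zero (R := S).2 hN))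
      (hQ.map ev).ne_zero
    exact h3 h2.symm
  have hv : Matrix.vecMul (b.repr a) M = 0 := by
    ext j
    have h1 : Matrix.vecMul (b.repr a) M j = tr (a * b j) := by
      simp only [Matrix.vecMul, dotProduct, tr]
      conv_rhs => rw [← b.sum_repr a, Finset.sum_mul]
      have : LinearMap.mulLeft R (∑ i, b.repr a i • b i * b j) =
          ∑ i, b.repr a i • LinearMap.mulLeft R (b i * b j) := by
        ext x
        simp [Finset.sum_mul, mul_assoc]
      rw [this, map_sum]
      refine Finset.sum_congr rfl fun k _ => ?_
      rw [map_smul, smul_eq_mul]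
    rw [h1]
    exact ha (b j)
  have := Matrix.eq_zero_of_vecMul_eq_zero hMdet hv
  rw [← b.sum_repr a]
  exact Finset.sum_eq_zero fun i _ => by rw [congrFun this i, Pi.zero_apply, zero_smul]

/-- If `a` is central and nilpotent, so is every operator `x ↦ a y x` nilpotent, hence of trace `0`:
`a` lies in the radical of the trace form. This is the reducedness of the centre. -/
theorem IsSymmetrizing.eq_zero_of_isNilpotent (b : Module.Basis ι R H) [IsDomain R]
    [IsDomain S] (ht : IsSymmetrizing t) (hN : N ≠ 0)
    (hev : ∀ h, ev (LinearMap.trace R H (LinearMap.mulLeft R h)) = N * ev (t h)) {a : H}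
    (hc : ∀ x, a * x = x * a) (ha : IsNilpotent a) : a = 0 := by
  refine ht.eq_zero_of_trace b hN hev fun x => ?_
  have := Module.Free.of_basis b
  have := Module.Finite.of_basis b
  have h1 : IsNilpotent (a * x) := (show Commute a x from hc x).isNilpotent_mul_right ha
  have h2 : IsNilpotent (LinearMap.mulLeft R (a * x)) := by
    obtain ⟨k, hk⟩ := h1
    exact ⟨k, by rw [LinearMap.pow_mulLeft, hk, LinearMap.mulLeft_zero_eq_zero]⟩
  exact (LinearMap.isNilpotent_trace_of_isNilpotent h2).eq_zero

/-- The trace of multiplication by `e` is a rank, computed over the fraction field. It is a natural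
number, so it is unchanged by `ev`, and there it is `N ev(t e) = 0`. -/
theorem eq_zero_of_isIdempotentElem (b : Module.Basis ι R H) [IsDomain R] [CharZero R]
    (hev : ∀ h, ev (LinearMap.trace R H (LinearMap.mulLeft R h)) = N * ev (t h)) {e : H}
    (he : IsIdempotentElem e) (hte : t e = 0) : e = 0 := by
  have := Module.Free.of_basis b
  have := Module.Finite.of_basis b
  let f := (LinearMap.mulLeft R e).baseChange (FractionRing R)
  have hf : IsIdempotentElem f := by
    rw [IsIdempotentElem, Module.End.mul_eq_comp, ← LinearMap.baseChange_comp]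
    congr 1
    ext x
    simp [← mul_assoc, he.eq]
  have h1 : algebraMap R (FractionRing R) (LinearMap.trace R H (LinearMap.mulLeft R e)) =
      (Module.finrank (FractionRing R) (LinearMap.range f) : FractionRing R) := by
    rw [← LinearMap.trace_baseChange]
    exact trace_eq_finrank_range hf
  have h2 : LinearMap.trace R H (LinearMap.mulLeft R e) =
      (Module.finrank (FractionRing R) (LinearMap.range f) : R) := by
    apply IsFractionRing.injective R (FractionRing R)
    rw [h1, map_natCast]
  have h3 := hev e
  rw [hte, map_zero, mul_zero, h2, map_natCast, Nat.cast_eq_zero] at h3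
  have h4 : f = 0 := by
    rw [← LinearMap.range_eq_bot]
    exact Submodule.finrank_eq_zero.1 h3
  have h5 : (1 : FractionRing R) ⊗ₜ[R] e = 0 := by
    have := LinearMap.congr_fun h4 ((1 : FractionRing R) ⊗ₜ[R] (1 : H))
    simpa [f] using this
  have h6 := Algebra.TensorProduct.includeRight_injective (R := R) (A := FractionRing R) (B := H)
    (IsFractionRing.injective R (FractionRing R))
  apply h6
  rw [map_zero]
  exact h5

end Symmetric

/-! ### Units of Laurent polynomial rings -/

section LaurentUnits

/-- Over a domain the units are monomials: after clearing denominators `f` becomes a divisor of a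
power of the prime `X`. -/
theorem eq_zero_or_of_mul_eq_one_laurent {D : Type*} [CommRing D] [IsDomain D] {f g : D[T;T⁻¹]}
    (h : f * g = 1) {k l : ℤ} (hkl : k ≠ l) : f.coeff k * f.coeff l = 0 := by
  obtain ⟨a, p, hp⟩ := LaurentPolynomial.exists_T_pow f
  obtain ⟨c, q, hq⟩ := LaurentPolynomial.exists_T_pow g
  have hpq : p * q = Polynomial.X ^ (a + c) := by
    apply Polynomial.toLaurent_injective
    rw [map_mul, hp, hq, Polynomial.toLaurent_X_pow, Nat.cast_add, LaurentPolynomial.T_add,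
      mul_mul_mul_comm, h, one_mul]
  obtain ⟨i, -, hi⟩ := (dvd_prime_pow Polynomial.prime_X _).1 (Dvd.intro q hpq)
  obtain ⟨v, hv⟩ := hi.symm
  obtain ⟨r, -, hr⟩ := Polynomial.isUnit_iff.1 v.isUnit
  have hf : f = LaurentPolynomial.C r * LaurentPolynomial.T (i - a) := by
    have h1 : f * LaurentPolynomial.T a = LaurentPolynomial.C r * LaurentPolynomial.T i := by
      rw [← hp, ← hv, ← hr, map_mul, Polynomial.toLaurent_X_pow, Polynomial.toLaurent_C, mul_comm]
    rw [LaurentPolynomial.T_sub, ← mul_assoc, ← h1, LaurentPolynomial.mul_T_assoc, add_neg_cancel,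
      LaurentPolynomial.T_zero, mul_one]
  rw [hf, ← LaurentPolynomial.single_eq_C_mul_T, AddMonoidAlgebra.coeff_single,
    Finsupp.single_apply, Finsupp.single_apply]
  split_ifs with h1 h2
  · exact absurd (h1.symm.trans h2) hkl
  all_goals simp

/-- By the case of a domain the product vanishes modulo every prime ideal, so it is nilpotent. -/
theorem coeff_mul_coeff_eq_zero_of_mul_eq_one {Z : Type*} [CommRing Z] [IsReduced Z]
    {f g : Z[T;T⁻¹]} (h : f * g = 1) {k l : ℤ} (hkl : k ≠ l) : f.coeff k * f.coeff l = 0 := by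
  have hmem : f.coeff k * f.coeff l ∈ nilradical Z := by
    rw [nilradical_eq_sInf, Ideal.mem_sInf]
    intro P hP
    have : P.IsPrime := hP
    rw [← Ideal.Quotient.eq_zero_iff_mem, map_mul]
    have h1 := congrArg (AddMonoidAlgebra.mapRingHom ℤ (Ideal.Quotient.mk P)) h
    rw [map_mul, map_one] at h1
    have h2 := eq_zero_or_of_mul_eq_one_laurent h1 hkl
    rwa [AddMonoidAlgebra.coeff_mapRingHom, AddMonoidAlgebra.coeff_mapRingHom] at h2
  exact (mem_nilradical.1 hmem).eq_zero

end LaurentUnits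

end CycHecke
end

noncomputable section

namespace CycHecke

/-! ### Homogeneity of symmetrizing forms -/

section Homogeneity

variable {R : Type*} [CommRing R] {H : Type*} [Ring H] [Algebra R H]

/-- The extension of a linear form to Laurent polynomials. -/
def laurentForm (t : H →ₗ[R] R) : H[T;T⁻¹] →+ R[T;T⁻¹] where
  toFun := AddMonoidAlgebra.map t.toAddMonoidHom
  map_zero' := AddMonoidAlgebra.map_zero _
  map_add' := AddMonoidAlgebra.map_add _

theorem laurentForm_coeff (t : H →ₗ[R] R) (f : H[T;T⁻¹]) (k : ℤ) :
    (laurentForm t f).coeff k = t (f.coeff k) := by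
  simp [laurentForm]

/-- The inclusion of `R[x, x⁻¹]` into `H[x, x⁻¹]`. -/
def laurentScalar (R H : Type*) [CommRing R] [Ring H] [Algebra R H] : R[T;T⁻¹] →+* H[T;T⁻¹] :=
  AddMonoidAlgebra.mapRingHom ℤ (algebraMap R H)

theorem laurentScalar_single (k : ℤ) (r : R) :
    laurentScalar R H (AddMonoidAlgebra.single k r) =
      AddMonoidAlgebra.single k (algebraMap R H r) :=
  AddMonoidAlgebra.mapRingHom_single _ _ _

theorem laurentScalar_mul_comm (r : R[T;T⁻¹]) (f : H[T;T⁻¹]) :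
    laurentScalar R H r * f = f * laurentScalar R H r := by
  induction r using AddMonoidAlgebra.induction_linear with
  | zero => rw [map_zero, zero_mul, mul_zero]
  | add r s hr hs => rw [map_add, add_mul, mul_add, hr, hs]
  | single k a =>
    induction f using AddMonoidAlgebra.induction_linear with
    | zero => rw [zero_mul, mul_zero]
    | add f g hf hg => rw [add_mul, mul_add, hf, hg]
    | single l h =>
      rw [laurentScalar_single, AddMonoidAlgebra.single_mul_single,
        AddMonoidAlgebra.single_mul_single, add_comm, Algebra.commutes]

theorem laurentForm_scalar_mul (t : H →ₗ[R] R) (r : R[T;T⁻¹]) (f : H[T;T⁻¹]) :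
    laurentForm t (laurentScalar R H r * f) = r * laurentForm t f := by
  induction r using AddMonoidAlgebra.induction_linear with
  | zero => rw [map_zero, zero_mul, zero_mul, map_zero]
  | add r s hr hs => rw [map_add, add_mul, add_mul, map_add, hr, hs]
  | single k a =>
    induction f using AddMonoidAlgebra.induction_linear with
    | zero => rw [mul_zero, map_zero, mul_zero]
    | add f g hf hg => rw [mul_add, map_add, map_add, mul_add, hf, hg]
    | single l h =>
      rw [laurentScalar_single, AddMonoidAlgebra.single_mul_single]
      change AddMonoidAlgebra.map _ _ = _ * AddMonoidAlgebra.map _ _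
      rw [AddMonoidAlgebra.map_single, AddMonoidAlgebra.map_single,
        AddMonoidAlgebra.single_mul_single, ← Algebra.smul_def]
      exact congrArg _ (t.map_smul a h)

theorem coeff_mul_C (f : H[T;T⁻¹]) (h : H) (k : ℤ) :
    (f * LaurentPolynomial.C h).coeff k = f.coeff k * h :=
  AddMonoidAlgebra.coeff_mul_single_zero _ _ _

theorem coeff_C_mul (f : H[T;T⁻¹]) (h : H) (k : ℤ) :
    (LaurentPolynomial.C h * f).coeff k = h * f.coeff k :=
  AddMonoidAlgebra.coeff_single_zero_mul _ _ _

theorem commute_laurent {z : H[T;T⁻¹]} (hz : ∀ k x, z.coeff k * x = x * z.coeff k)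
    (f : H[T;T⁻¹]) : z * f = f * z := by
  have hC : ∀ x : H, z * LaurentPolynomial.C x = LaurentPolynomial.C x * z := fun x => by
    ext k
    rw [coeff_mul_C, coeff_C_mul, hz]
  induction f using AddMonoidAlgebra.induction_linear with
  | zero => rw [zero_mul, mul_zero]
  | add f g hf hg => rw [add_mul, mul_add, hf, hg]
  | single l h =>
    rw [LaurentPolynomial.single_eq_C_mul_T, ← mul_assoc, hC, mul_assoc, mul_assoc,
      LaurentPolynomial.T_mul]

/-- A unit of `Z[x, x⁻¹]`, where `Z` is the centre of `H`: its coefficients are orthogonal if `Z`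
is reduced. -/
theorem coeff_mul_coeff_eq_zero_of_central
    (hred : ∀ a : H, (∀ x, a * x = x * a) → IsNilpotent a → a = 0) {z y : H[T;T⁻¹]}
    (hz : ∀ k x, z.coeff k * x = x * z.coeff k) (hzy : z * y = 1) {k l : ℤ} (hkl : k ≠ l) :
    z.coeff k * z.coeff l = 0 := by
  have hyz : y * z = 1 := by rw [← commute_laurent hz, hzy]
  have hy : ∀ k x, y.coeff k * x = x * y.coeff k := by
    intro k x
    have h1 : y * LaurentPolynomial.C x = LaurentPolynomial.C x * y := by
      calc y * LaurentPolynomial.C x = y * LaurentPolynomial.C x * (z * y) := by rw [hzy, mul_one]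
        _ = y * (LaurentPolynomial.C x * z) * y := by noncomm_ring
        _ = y * z * LaurentPolynomial.C x * y := by
          rw [← commute_laurent hz (LaurentPolynomial.C x)]; noncomm_ring
        _ = LaurentPolynomial.C x * y := by rw [hyz, one_mul]
    rw [← coeff_mul_C, h1, coeff_C_mul]
  -- Both `z` and its inverse come from Laurent polynomials over the centre, a commutative ring that
  -- is reduced by `hred`.
  have hlift : ∀ f : H[T;T⁻¹], (∀ k x, f.coeff k * x = x * f.coeff k) →
      ∃ g : (Subring.center H)[T;T⁻¹],
        AddMonoidAlgebra.mapRingHom ℤ (Subring.center H).subtype g = f := by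
    intro f hf
    have := (AddMonoidAlgebra.range_map (M := ℤ)
      ((Subring.center H).subtype : Subring.center H →+ H)).ge
      (show f ∈ {x | ∀ i, x.coeff i ∈ Set.range _} from fun k =>
        ⟨⟨f.coeff k, Subring.mem_center_iff.2 fun x => (hf k x).symm⟩, rfl⟩)
    exact this
  obtain ⟨z', hz'⟩ := hlift z hz
  obtain ⟨y', hy'⟩ := hlift y hy
  have hinj : Function.Injective
      (AddMonoidAlgebra.mapRingHom ℤ (Subring.center H).subtype) := by
    intro f g hfg
    ext k
    have := congrArg (fun q : H[T;T⁻¹] => q.coeff k) hfg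
    simpa using this
  have hzy' : z' * y' = 1 := by
    apply hinj
    rw [map_mul, hz', hy', hzy, map_one]
  have : IsReduced (Subring.center H) := ⟨fun a ha => Subtype.ext
    (hred a.1 (fun x => ((Subring.mem_center_iff.1 a.2) x).symm)
      (ha.map (Subring.center H).subtype))⟩
  have h1 := coeff_mul_coeff_eq_zero_of_mul_eq_one hzy' hkl
  rw [← hz', AddMonoidAlgebra.coeff_mapRingHom, AddMonoidAlgebra.coeff_mapRingHom, ← map_mul, h1,
    map_zero]

/-- The value at `x = 1` of a Laurent polynomial. -/
def laurentEvalOne (M : Type*) [Semiring M] : M[T;T⁻¹] →+ M where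
  toFun f := f.coeff.sum fun _ a => a
  map_zero' := Finsupp.sum_zero_index
  map_add' _ _ := Finsupp.sum_add_index' (fun _ => rfl) fun _ _ _ => rfl

theorem laurentEvalOne_single {M : Type*} [Semiring M] (k : ℤ) (a : M) :
    laurentEvalOne M (AddMonoidAlgebra.single k a) = a := by
  change (Finsupp.single k a).sum (fun _ a => a) = a
  exact Finsupp.sum_single_index rfl

theorem laurentEvalOne_T_mul {M : Type*} [Semiring M] (k : ℤ) (f : M[T;T⁻¹]) :
    laurentEvalOne M (LaurentPolynomial.T k * f) = laurentEvalOne M f := by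
  induction f using AddMonoidAlgebra.induction_linear with
  | zero => rw [mul_zero]
  | add f g hf hg => rw [mul_add, map_add, map_add, hf, hg]
  | single l h =>
    rw [LaurentPolynomial.T, AddMonoidAlgebra.single_mul_single, one_mul, laurentEvalOne_single,
      laurentEvalOne_single]

theorem laurentEvalOne_laurentForm (t : H →ₗ[R] R) (f : H[T;T⁻¹]) :
    laurentEvalOne R (laurentForm t f) = t (laurentEvalOne H f) := by
  induction f using AddMonoidAlgebra.induction_linear with
  | zero => simp
  | add f g hf hg => rw [map_add, map_add, map_add, map_add, hf, hg]
  | single l h =>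
    change laurentEvalOne R (AddMonoidAlgebra.map _ _) = _
    rw [AddMonoidAlgebra.map_single, laurentEvalOne_single, laurentEvalOne_single]
    rfl

theorem laurentEvalOne_mul_C (f : H[T;T⁻¹]) (h : H) :
    laurentEvalOne H (f * LaurentPolynomial.C h) = laurentEvalOne H f * h := by
  induction f using AddMonoidAlgebra.induction_linear with
  | zero => simp
  | add f g hf hg => rw [add_mul, map_add, map_add, add_mul, hf, hg]
  | single l a =>
    rw [← LaurentPolynomial.single_eq_C, AddMonoidAlgebra.single_mul_single,
      laurentEvalOne_single, laurentEvalOne_single]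

variable {t : H →ₗ[R] R} {ι : Type*} [Fintype ι]

/-- A symmetrizing form that is compatible at `x = 1` with a coaction `c` of the multiplicative
group is homogeneous, provided that the centre is reduced and that central idempotents are detected
by the form. -/
theorem IsSymmetrizing.homogeneous (b : Module.Basis ι R H) (ht : IsSymmetrizing t)
    (ht1 : t 1 = 1)
    (hred : ∀ a : H, (∀ x, a * x = x * a) → IsNilpotent a → a = 0)
    (hidem : ∀ e : H, IsIdempotentElem e → t e = 0 → e = 0)
    {B : Type*} [Monoid B] (T : B →* H) (hspan : Submodule.span R (Set.range T) = ⊤)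
    (ℓ : B →* Multiplicative ℤ) (σ : R →+* R[T;T⁻¹]) (c : H →+* H[T;T⁻¹])
    (hcT : ∀ g, c (T g) = AddMonoidAlgebra.single (ℓ g).toAdd (T g))
    (hcσ : ∀ r, c (algebraMap R H r) = laurentScalar R H (σ r))
    (hσ : ∀ r, laurentEvalOne R (σ r) = r)
    (G : H →ₗ[R] R[T;T⁻¹])
    (hG : ∀ g, G (T g) = LaurentPolynomial.T (-(ℓ g).toAdd) * σ (t (T g))) (g : B) :
    σ (t (T g)) = AddMonoidAlgebra.single (ℓ g).toAdd (t (T g)) := by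
  obtain ⟨b', hb'⟩ := ht.exists_dualBasis b
  have hind : ∀ {p : H → Prop} (x : H) (_of : ∀ g, p (T g))
      (_add : ∀ x y, p x → p y → p (x + y)) (_smul : ∀ (r : R) x, p x → p (r • x)), p x := by
    intro p x h1 h2 h3
    have hx : x ∈ Submodule.span R (Set.range T) := by rw [hspan]; trivial
    induction hx using Submodule.span_induction with
    | mem x hx => obtain ⟨g, rfl⟩ := hx; exact h1 g
    | zero => simpa using h3 0 _ (h1 1)
    | add x y _ _ hx hy => exact h2 x y hx hy
    | smul r x _ hx => exact h3 r x hx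
  -- `ℓ` takes values in a commutative group, so the twist does not destroy the trace property.
  have hGtr : ∀ x y, G (x * y) = G (y * x) := by
    intro x y
    induction x using hind with
    | _of g =>
      induction y using hind with
      | _of g' =>
        rw [← map_mul T, ← map_mul T, hG, hG, map_mul ℓ, map_mul ℓ, mul_comm (ℓ g), map_mul T,
          map_mul T, ht.1]
      | _add x y hx hy => rw [mul_add, add_mul, map_add, map_add, hx, hy]
      | _smul r x hx => rw [mul_smul_comm, smul_mul_assoc, map_smul, map_smul, hx]
    | _add x' y' hx hy => rw [mul_add, add_mul, map_add, map_add, hx, hy]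
    | _smul r x hx => rw [mul_smul_comm, smul_mul_assoc, map_smul, map_smul, hx]
  -- The element representing `G` with respect to `t`, written in the dual basis. It is central
  -- because `G` is a trace form.
  let z : H[T;T⁻¹] := ∑ i, laurentScalar R H (G (b i)) * LaurentPolynomial.C (b' i)
  have hzG : ∀ x, laurentForm t (z * LaurentPolynomial.C x) = G x := by
    intro x
    conv_rhs => rw [← b.sum_repr x, map_sum]
    rw [Finset.sum_mul, map_sum]
    refine Finset.sum_congr rfl fun i _ => ?_
    rw [mul_assoc, laurentForm_scalar_mul, ← map_mul]
    have : laurentForm t (LaurentPolynomial.C (b' i * x)) = LaurentPolynomial.C (b.repr x i) := by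
      change AddMonoidAlgebra.map _ (AddMonoidAlgebra.single 0 _) = _
      rw [AddMonoidAlgebra.map_single]
      exact congrArg _ (hb' i x)
    rw [this, map_smul, LaurentPolynomial.smul_eq_C_mul, mul_comm]
  have hzk : ∀ k x, t (z.coeff k * x) = (G x).coeff k := fun k x => by
    rw [← hzG, laurentForm_coeff, coeff_mul_C]
  have hzc : ∀ k x, z.coeff k * x = x * z.coeff k := by
    intro k x
    rw [← sub_eq_zero]
    refine ht.eq_zero fun y => ?_
    rw [sub_mul, map_sub, mul_assoc, hzk, ht.1 (x * _) y, ← mul_assoc, ht.1 (y * x), hzk, hGtr,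
      sub_self]
  -- On `T g` the factor `x ^ ℓ(g)` from the coaction cancels the factor `x ^ (-ℓ(g))` in `G`; both
  -- sides are `σ`-semilinear.
  have hA : ∀ x, laurentForm t (z * c x) = σ (t x) := by
    intro x
    induction x using hind with
    | _of g =>
      have : c (T g) = laurentScalar R H (LaurentPolynomial.T (ℓ g).toAdd) *
          LaurentPolynomial.C (T g) := by
        rw [hcT, LaurentPolynomial.T, laurentScalar_single, map_one,
          LaurentPolynomial.single_eq_C_mul_T]
        exact (LaurentPolynomial.T_mul _ _).symm
      rw [this, ← mul_assoc, ← laurentScalar_mul_comm, mul_assoc, laurentForm_scalar_mul, hzG, hG,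
        ← mul_assoc, ← LaurentPolynomial.T_add, add_neg_cancel, LaurentPolynomial.T_zero, one_mul]
    | _add x y hx hy => rw [map_add, map_add, map_add, mul_add, map_add, hx, hy]
    | _smul r x hx =>
      rw [Algebra.smul_def, map_mul c, hcσ, ← mul_assoc, ← laurentScalar_mul_comm, mul_assoc,
        laurentForm_scalar_mul, hx, ← Algebra.smul_def, map_smul, smul_eq_mul, map_mul]
  -- The families `c (b i)` and `c (b' i)` are dual for the form `t(z ·)`. On the image of `c` this
  -- is the coaction applied to the expansion in `b`; scalar multiples of the image exhaust `H[x,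
  -- x⁻¹]`, because `x ^ k T g` is a scalar times `c (T g)`.
  have hB : ∀ f : H[T;T⁻¹],
      ∑ i, laurentScalar R H (laurentForm t (z * (c (b' i) * f))) * c (b i) = f := by
    have hBc : ∀ x, ∑ i, laurentScalar R H (laurentForm t (z * (c (b' i) * c x))) * c (b i) =
        c x := by
      intro x
      conv_rhs => rw [← b.sum_repr x, map_sum]
      refine Finset.sum_congr rfl fun i _ => ?_
      rw [← map_mul, hA, hb', Algebra.smul_def, map_mul, hcσ]
    have hBs : ∀ (r : R[T;T⁻¹]) f,
        ∑ i, laurentScalar R H (laurentForm t (z * (c (b' i) * f))) * c (b i) = f →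
        ∑ i, laurentScalar R H (laurentForm t (z * (c (b' i) * (laurentScalar R H r * f)))) *
          c (b i) = laurentScalar R H r * f := by
      intro r f hf
      conv_rhs => rw [← hf, Finset.mul_sum]
      refine Finset.sum_congr rfl fun i _ => ?_
      rw [← mul_assoc (c (b' i)), ← laurentScalar_mul_comm, mul_assoc, ← mul_assoc z,
        ← laurentScalar_mul_comm, mul_assoc, laurentForm_scalar_mul, map_mul, mul_assoc]
    intro f
    induction f using AddMonoidAlgebra.induction_linear with
    | zero => simp
    | add f g hf hg =>
      simp only [mul_add, map_add, add_mul, Finset.sum_add_distrib]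
      rw [hf, hg]
    | single k x =>
      induction x using hind with
      | _of g =>
        have : (AddMonoidAlgebra.single k (T g) : H[T;T⁻¹]) =
            laurentScalar R H (LaurentPolynomial.T (k - (ℓ g).toAdd)) * c (T g) := by
          rw [hcT, LaurentPolynomial.T, laurentScalar_single, AddMonoidAlgebra.single_mul_single,
            map_one, one_mul, sub_add_cancel]
        rw [this]
        exact hBs _ _ (hBc _)
      | _add x y hx hy =>
        rw [AddMonoidAlgebra.single_add]
        simp only [mul_add, map_add, add_mul, Finset.sum_add_distrib]
        rw [hx, hy]
      | _smul r x hx =>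
        have : (AddMonoidAlgebra.single k (r • x) : H[T;T⁻¹]) =
            laurentScalar R H (LaurentPolynomial.C r) * AddMonoidAlgebra.single k x := by
          rw [← LaurentPolynomial.single_eq_C, laurentScalar_single,
            AddMonoidAlgebra.single_mul_single, zero_add, Algebra.smul_def]
        rw [this]
        exact hBs _ _ hx
  -- The inverse of `z` represents `t` with respect to `t(z ·)`, hence is written in the dual family
  -- of the previous step.
  let y : H[T;T⁻¹] := ∑ i, laurentScalar R H (laurentForm t (c (b i))) * c (b' i)
  have hzy : z * y = 1 := by
    have h1 : ∀ f, laurentForm t (z * y * f) = laurentForm t f := by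
      intro f
      conv_rhs => rw [← hB f, map_sum]
      rw [Finset.mul_sum, Finset.sum_mul, map_sum]
      refine Finset.sum_congr rfl fun i _ => ?_
      rw [← mul_assoc, ← laurentScalar_mul_comm, mul_assoc, mul_assoc, laurentForm_scalar_mul,
        laurentForm_scalar_mul, mul_comm]
    rw [← sub_eq_zero]
    ext k
    rw [AddMonoidAlgebra.coeff_zero, Finsupp.zero_apply]
    refine ht.eq_zero fun x => ?_
    rw [← coeff_mul_C, ← laurentForm_coeff, sub_mul, map_sub, h1, one_mul, sub_self]
    rfl
  have horth : ∀ {k l : ℤ}, k ≠ l → z.coeff k * z.coeff l = 0 := fun hkl =>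
    coeff_mul_coeff_eq_zero_of_central hred hzc hzy hkl
  have hsum : laurentEvalOne H z = 1 := by
    rw [← sub_eq_zero]
    refine ht.eq_zero fun x => ?_
    have h1 : laurentEvalOne R (G x) = t x := by
      induction x using hind with
      | _of g => rw [hG, laurentEvalOne_T_mul, hσ]
      | _add x y hx hy => rw [map_add, map_add, map_add, hx, hy]
      | _smul r x hx =>
        rw [G.map_smul, t.map_smul, ← hx, LaurentPolynomial.smul_eq_C_mul, mul_comm,
          laurentEvalOne_mul_C, mul_comm, smul_eq_mul]
    rw [sub_mul, map_sub, one_mul, ← laurentEvalOne_mul_C, ← laurentEvalOne_laurentForm, hzG, h1,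
      sub_self]
  -- Multiply the relation that the coefficients of `z` add up to `1` by one of them; the others are
  -- orthogonal to it.
  have hz2 : ∀ k, IsIdempotentElem (z.coeff k) := by
    intro k
    have h1 : z.coeff k = z.coeff k * laurentEvalOne H z := by rw [hsum, mul_one]
    rw [IsIdempotentElem]
    conv_rhs => rw [h1]
    change _ = z.coeff k * z.coeff.sum fun _ a => a
    rw [Finsupp.mul_sum, Finsupp.sum_eq_single k]
    · intro l _ hl
      exact horth hl.symm
    · intro _
      exact mul_zero _
  -- The value of `t` on the `k`-th coefficient is the coefficient of `x ^ k` in `G 1`, and `G 1 =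
  -- 1`.
  have hz0 : ∀ k, k ≠ 0 → z.coeff k = 0 := by
    intro k hk
    refine hidem _ (hz2 k) ?_
    have h1 := hzk k 1
    rw [mul_one] at h1
    rw [h1, ← map_one T, hG, map_one ℓ, map_one T, ht1, map_one σ, toAdd_one, neg_zero,
      LaurentPolynomial.T_zero, one_mul, ← LaurentPolynomial.T_zero, LaurentPolynomial.T_apply,
      if_neg hk.symm]
  have hz1 : z.coeff 0 = 1 := by
    rw [← hsum]
    change _ = z.coeff.sum fun _ a => a
    rw [Finsupp.sum_eq_single 0]
    · intro l _ hl
      exact hz0 l hl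
    · intro _
      rfl
  have hGt : G (T g) = LaurentPolynomial.C (t (T g)) := by
    ext k
    rw [← hzk, LaurentPolynomial.C_apply]
    split_ifs with h
    · rw [h, hz1, one_mul]
    · rw [hz0 k h, zero_mul, map_zero]
  rw [hG] at hGt
  have h2 := congrArg (LaurentPolynomial.T (ℓ g).toAdd * ·) hGt
  beta_reduce at h2
  rw [← mul_assoc, ← LaurentPolynomial.T_add, add_neg_cancel, LaurentPolynomial.T_zero, one_mul,
    LaurentPolynomial.T_mul, ← LaurentPolynomial.single_eq_C_mul_T] at h2
  exact h2

end Homogeneity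

end CycHecke
end

/-! ### Lifting of braids, and the trace of the regular representation -/

noncomputable section

namespace CycHecke

section Lifting

variable {K : Type*} [Field K] [Algebra K ℂ] {n : ℕ} {W : Subgroup (GL (Fin n) K)}
variable {x₀ : Vreg W} {t : Hecke x₀ (genParam W) →ₗ[GenRing W] GenRing W}

instance vregMulAction : MulAction W (Vreg W) where
  smul := vregAct
  one_smul x := Subtype.ext (by change act 1 x.1 = _; rw [act_one]; rfl)
  mul_smul v w x := Subtype.ext (act_mul_apply v.1 w.1 x.1)

/-- `V^reg` is open in `ℂ^n`, hence locally compact and Hausdorff, and a finite group acting freely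
on such a space acts properly discontinuously. -/
theorem isQuotientCoveringMap_regProj [Finite W]
    (hfix : ∀ (w : W) (x : Vreg W), vregAct w x = x → w = 1) :
    IsQuotientCoveringMap (regProj (W := W)) W := by
  have : ContinuousConstSMul W (Vreg W) := ⟨continuous_vregAct⟩
  have : ProperlyDiscontinuousSMul W (Vreg W) := ⟨fun _ _ => Set.toFinite _⟩
  have : T2Space (Vreg W) := inferInstanceAs (T2Space {x : Fin n → ℂ // _})
  have hopen : IsOpen {x : Fin n → ℂ | ∀ H ∈ hyperplanes W, x ∉ H} := by
    have : {x : Fin n → ℂ | ∀ H ∈ hyperplanes W, x ∉ H} =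
        (⋃ H : hyperplanes W, (H.1 : Set (Fin n → ℂ)))ᶜ := by
      ext x
      simp
    rw [this, isOpen_compl_iff]
    exact isClosed_iUnion_of_finite fun H => H.1.closed_of_finiteDimensional
  have : LocallyCompactSpace (Vreg W) := hopen.locallyCompactSpace
  have : IsCancelSMul W (Vreg W) := isCancelSMul_iff_eq_one_of_smul_eq.2 hfix
  refine Topology.IsQuotientMap.isQuotientCoveringMap_of_properlyDiscontinuousSMul
    isQuotientMap_quotient_mk' fun {x y} => ?_
  change Quotient.mk (regSetoid W) x = Quotient.mk (regSetoid W) y ↔ _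
  rw [Quotient.eq]
  constructor
  · rintro ⟨w, hw, h⟩
    exact ⟨⟨w⁻¹, W.inv_mem hw⟩, Subtype.ext (by
      change act w⁻¹ y.1 = x.1
      rw [← h, act_inv_act])⟩
  · rintro ⟨w, rfl⟩
    exact ⟨w⁻¹.1, w⁻¹.2, act_inv_act w.1 y.1⟩

theorem IsCanonicalForm.eval_of_liftsTo (ht : IsCanonicalForm x₀ t) {b : Braid x₀} {w : W}
    (h : LiftsTo b w) [Decidable (w = 1)] :
    genEval (groupParam W) (t (T x₀ (genParam W) b)) = if w = 1 then 1 else 0 := by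
  split_ifs with hw
  · subst hw
    obtain ⟨γ, rfl⟩ := h.exists_path
    have e : vregAct 1 x₀ = x₀ := one_smul W x₀
    exact ht.spec_eq_one (γ.cast rfl e.symm)
  · obtain ⟨y, h, γ, rfl⟩ := h
    exact ht.spec_eq_zero w y h γ hw

/-- Freeness of the action is read off from the form. If `w` fixes `x`, go from `x₀` to `x` and
return along the `w`-translate of the path, which ends at `w x₀`. The image in `V^reg / W` is
null-homotopic, so for `w ≠ 1` the value of `t` at `1` would specialize to both `0` and `1`. -/
theorem IsCanonicalForm.eq_one_of_vregAct_eq [Finite W] (ht : IsCanonicalForm x₀ t) {w : W}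
    {x : Vreg W} (h : vregAct w x = x) : w = 1 := by
  classical
  by_contra hw
  obtain ⟨γ⟩ := vreg_joined x₀ x
  let γ' : Path x₀ (vregAct w x₀) := γ.trans ((γ.map (continuous_vregAct w)).cast rfl h.symm).symm
  have h1 : ofLoop (projLoop w rfl γ') = 1 := by
    rw [← ofLoop_refl]
    have hp : projLoop w rfl γ' =
        (γ.map continuous_regProj).trans (γ.map continuous_regProj).symm := by
      ext s
      change regProj (γ.trans ((γ.map (continuous_vregAct w)).cast rfl h.symm).symm s) = _
      rw [Path.trans_apply, Path.trans_apply]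
      split_ifs
      · rfl
      · exact regProj_vregAct w _
    rw [hp]
    have : ((γ.map continuous_regProj).trans (γ.map continuous_regProj).symm).Homotopic
        (Path.refl (regProj x₀)) := ⟨(Path.Homotopy.reflTransSymm _).symm⟩
    rw [ofLoop, ofLoop, Path.Homotopic.Quotient.eq.2 this]
  have h2 := ht.eval_of_liftsTo (w := w) ⟨_, rfl, γ', rfl⟩
  have h3 := ht.spec_eq_one (Path.refl x₀)
  have h4 : ofLoop ((Path.refl x₀).map continuous_regProj) = 1 := by
    rw [← ofLoop_refl]; rfl
  rw [h1, if_neg hw] at h2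
  rw [h4, h2] at h3
  exact zero_ne_one h3

/-- By freeness `V^reg → V^reg / W` is a covering; lift a loop representing `b` and look at its
endpoint. -/
theorem IsCanonicalForm.exists_liftsTo [Finite W] (ht : IsCanonicalForm x₀ t) (b : Braid x₀) :
    ∃ w : W, LiftsTo b w := by
  have hq := isQuotientCoveringMap_regProj (W := W) fun w x => ht.eq_one_of_vregAct_eq
  obtain ⟨γ, rfl⟩ := ofLoop_surjective b
  obtain ⟨Γ, hΓ, hΓ0⟩ := hq.isCoveringMap.exists_path_lifts γ.toContinuousMap x₀ γ.source
  have h1 : regProj (Γ 1) = regProj x₀ := (congrFun hΓ 1).trans γ.target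
  obtain ⟨w, hw⟩ := hq.apply_eq_iff_mem_orbit.1 h1
  refine ⟨w, Γ 1, congrArg Subtype.val hw, ⟨Γ, hΓ0, rfl⟩, ?_⟩
  congr 1
  ext s
  exact (congrFun hΓ s).symm

theorem LiftsTo.eval_mul [Finite W] (ht : IsCanonicalForm x₀ t) [DecidableEq W] {b c : Braid x₀}
    {v w : W} (h : LiftsTo b v) (h' : LiftsTo c w) :
    genEval (groupParam W) (t (T x₀ (genParam W) b * T x₀ (genParam W) c)) =
      if v = w⁻¹ then 1 else 0 := by
  rw [← T_mul, ht.eval_of_liftsTo (h.mul h')]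
  simp only [mul_eq_one_iff_eq_inv]

/-- For `u_{𝒞,j} ↦ ζ_{e_𝒞}^j`, the trace of the regular representation is `|W|` times the
canonical form. -/
theorem IsCanonicalForm.eval_trace [Finite W] (ht : IsCanonicalForm x₀ t)
    (b : Module.Basis W (GenRing W) (Hecke x₀ (genParam W))) [Fintype W]
    (h : Hecke x₀ (genParam W)) :
    genEval (groupParam W) (LinearMap.trace (GenRing W) _ (LinearMap.mulLeft (GenRing W) h)) =
      (Nat.card W : ℕ) * genEval (groupParam W) (t h) := by
  classical
  obtain ⟨b', hb'⟩ := ht.symm.exists_dualBasis b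
  choose β hβ using CycHecke.exists_liftsTo (W := W) x₀
  let τ : Hecke x₀ (genParam W) → 𝓞 K := fun h => genEval (groupParam W) (t h)
  have τadd : ∀ x y, τ (x + y) = τ x + τ y := fun x y => by simp only [τ, map_add]
  have τsum : ∀ f : W → Hecke x₀ (genParam W), τ (∑ i, f i) = ∑ i, τ (f i) := fun f => by
    simp only [τ, map_sum]
  have τsmul : ∀ r x, τ (r • x) = genEval (groupParam W) r * τ x := fun r x => by
    simp only [τ, map_smul, smul_eq_mul, map_mul]
  have τcomm : ∀ x y, τ (x * y) = τ (y * x) := fun x y => by simp only [τ, ht.symm.1 x y]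
  let U : W → Hecke x₀ (genParam W) := fun w => T x₀ _ (β w)
  let U' : W → Hecke x₀ (genParam W) := fun w => T x₀ _ (β w)⁻¹
  -- After specialization `τ` has two reproducing systems: the generic dual bases, and the lifts of
  -- the elements of `W` with their inverses.
  have h1 : ∀ g h, τ (g * h) = ∑ i, τ (b' i * h) * τ (g * b i) := by
    intro g h
    conv_lhs => rw [← b.sum_repr h, Finset.mul_sum, τsum]
    refine Finset.sum_congr rfl fun i _ => ?_
    rw [mul_smul_comm, τsmul, ← hb']
  have h2 : ∀ g h, τ (g * h) = ∑ w, τ (U' w * h) * τ (g * U w) := by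
    intro g h
    induction h using Hecke.induction with
    | hT c =>
      induction g using Hecke.induction with
      | hT d =>
        obtain ⟨v, hv⟩ := ht.exists_liftsTo c
        obtain ⟨w, hw⟩ := ht.exists_liftsTo d
        change genEval _ _ = ∑ i, genEval _ _ * genEval _ _
        simp only [U, U', LiftsTo.eval_mul ht hw hv, LiftsTo.eval_mul ht hw (hβ _),
          LiftsTo.eval_mul ht (hβ _).inv hv]
        rw [Finset.sum_eq_single v]
        · simp
        · intro x _ hx
          rw [if_neg (by simpa using hx), zero_mul]
        · simp
      | hadd x y hx hy => simp only [add_mul, τadd, mul_add, Finset.sum_add_distrib, hx, hy]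
      | hsmul r x hx =>
        simp only [smul_mul_assoc, τsmul, hx, Finset.mul_sum]
        exact Finset.sum_congr rfl fun i _ => by ring
    | hadd x y hx hy => simp only [add_mul, τadd, mul_add, Finset.sum_add_distrib, hx, hy]
    | hsmul r x hx =>
      simp only [mul_smul_comm, τsmul, hx, Finset.mul_sum]
      exact Finset.sum_congr rfl fun i _ => by ring
  -- The independence of the Casimir element from the dual bases: expand by one system and sum by
  -- the other.
  have h3 : ∑ i, τ (b' i * (h * b i)) = ∑ w, τ (U' w * (h * U w)) := by
    simp only [← mul_assoc]
    have e1 : ∀ i, τ (b' i * h * b i) = ∑ w, τ (U' w * b i) * τ (b' i * (h * U w)) := fun i => by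
      rw [h2]
      simp only [mul_assoc]
    simp only [e1]
    rw [Finset.sum_comm]
    refine Finset.sum_congr rfl fun w _ => ?_
    rw [mul_assoc, h1]
    exact Finset.sum_congr rfl fun i _ => mul_comm _ _
  rw [trace_mulLeft_eq b hb', map_sum]
  change ∑ i, τ (b' i * (h * b i)) = _
  rw [h3]
  have h4 : ∀ w, τ (U' w * (h * U w)) = τ h := fun w => by
    rw [τcomm, mul_assoc, T_mul_inv, mul_one]
  simp only [h4, Finset.sum_const, Finset.card_univ, Nat.card_eq_fintype_card, nsmul_eq_mul]
  rfl

theorem genInv_injective : Function.Injective (genInv W) := by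
  have h : (genInv W).comp (genInv W) = RingHom.id _ := by
    refine genRing_hom_ext fun C j => ?_
    rw [RingHom.comp_apply]
    change genInv W (genInv W (AddMonoidAlgebra.single _ 1)) = AddMonoidAlgebra.single _ 1
    simp [genInv]
  exact Function.LeftInverse.injective (g := genInv W) fun x => DFunLike.congr_fun h x

/-- Condition (ii) at `b = 1` gives this once `t(π) ≠ 0`. If `t(π)` were `0`, condition (ii) would
make `t` vanish on every `T_b`, contrary to its specialization at `1`. -/
theorem IsCanonicalForm.map_one (ht : IsCanonicalForm x₀ t) : t 1 = 1 := by
  have h1 := ht.inv 1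
  rw [one_mul, inv_one, T_one] at h1
  by_cases h0 : t (T x₀ (genParam W) (fullTwist x₀)) = 0
  · exfalso
    have h2 : ∀ b, t (T x₀ (genParam W) b) = 0 := by
      intro b
      have := ht.inv (b * (fullTwist x₀)⁻¹)
      rw [h0, mul_zero, inv_mul_cancel_right] at this
      exact this.symm
    have h3 := ht.spec_eq_one (Path.refl x₀)
    rw [h2, map_zero] at h3
    exact zero_ne_one h3
  · apply genInv_injective
    rw [_root_.map_one (genInv W)]
    exact mul_right_cancel₀ h0 (h1.trans (one_mul _).symm)

end Lifting

end CycHecke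
end

/-! ### Homogeneity of the canonical form -/

noncomputable section

namespace CycHecke

section Scaling

variable {K : Type*} [Field K] [Algebra K ℂ] {n : ℕ} {W : Subgroup (GL (Fin n) K)}
variable {x₀ : Vreg W} {S : Type*} [CommRing S]

/-- The length functions of the braid group: `ℓ_𝒞` counts the elements of `𝐒_𝒞` in a word. -/
structure IsBraidLength (ℓ : HypOrbit W → Braid x₀ →* Multiplicative ℤ) : Prop where
  self : ∀ C b, IsBraidReflection C b → ℓ C b = Multiplicative.ofAdd 1
  other : ∀ C C' b, C' ≠ C → IsBraidReflection C' b → ℓ C b = 1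
  pure : ∀ C b, LiftsTo b 1 → ∃ k : ℤ, ℓ C b = Multiplicative.ofAdd (ramif C * k)

/-- Multiplication of the parameters by scalars that depend only on the orbit. -/
def Param.scale (c : HypOrbit W → Sˣ) (u : Param W S) : Param W S := fun C j => c C * u C j

/-- The translation of the indices of a family of parameters. -/
def Param.translate (g : (C : HypOrbit W) → ZMod (ramif C)) (u : Param W S) : Param W S :=
  fun C j => u C (j + g C)

/-- The powers of `x`, as units of `S[x, x⁻¹]`. -/
def laurentUnit (S : Type*) [CommRing S] : Multiplicative ℤ →* (S[T;T⁻¹])ˣ :=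
  MonoidHom.toHomUnits (AddMonoidAlgebra.of S ℤ)

theorem laurentUnit_val (k : Multiplicative ℤ) :
    (laurentUnit S k : S[T;T⁻¹]) = AddMonoidAlgebra.single k.toAdd 1 := rfl

open Classical in
/-- The generic parameters, with those of the orbit `C` multiplied by `x ^ a`. -/
def laurentParam (C : HypOrbit W) (a : ℤ) : Param W (GenRing W)[T;T⁻¹] :=
  Param.scale (Function.update 1 C (laurentUnit _ (Multiplicative.ofAdd a)))
    ((genParam W).map LaurentPolynomial.C)

variable {ℓ : HypOrbit W → Braid x₀ →* Multiplicative ℤ}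

/-- A semilinear variant of `twistHom`. -/
theorem Hecke.exists_ringHom [Finite W] {R A : Type*} [CommRing R] [Ring A] (u : Param W R)
    (σ : R →+* S) (φ : S →+* A) (hφ : ∀ r a, φ r * a = a * φ r) {χ : Braid x₀ →* Sˣ}
    {u' : Param W S} (hχ : Compat χ (u.map σ) u') (g : Braid x₀ →* A)
    (hg : ∀ C s, IsBraidReflection C s → Polynomial.eval₂ φ (g s) (paramPoly u' C) = 0) :
    ∃ c : Hecke x₀ u →+* A, (∀ b, c (T x₀ u b) = φ (χ b) * g b) ∧
      ∀ r, c (algebraMap R _ r) = φ (σ r) := by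
  let : Algebra S A := RingHom.toAlgebra' φ hφ
  have hmap : ∀ r, algebraMap S A r = φ r := fun _ => rfl
  let g' : Braid x₀ →* A :=
    { toFun := fun b => (χ b : S) • g b
      map_one' := by rw [map_one, map_one, Units.val_one, one_smul]
      map_mul' := fun b b' => by
        rw [map_mul, map_mul, Units.val_mul, smul_mul_smul_comm] }
  let L := Hecke.lift (u := u.map σ) g' fun _ _ hs => hχ.aeval_eq_zero hs (hg _ _ hs)
  refine ⟨(L : _ →+* A).comp (Hecke.spec x₀ σ u), fun b => ?_, fun r => ?_⟩
  · rw [RingHom.comp_apply, Hecke.spec_T]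
    refine (Hecke.lift_T g' _ b).trans ?_
    exact Algebra.smul_def _ _
  · rw [RingHom.comp_apply, Hecke.spec_algebraMap]
    exact L.commutes _

/-- Scaling the parameters of `C` by `x ^ a` and the generators in `𝐒_C` by the same factor
preserves all relations. The exponent `a = 1` gives the coaction and `a = -1` the twisted form. -/
theorem exists_coaction [Finite W] (hℓ : IsBraidLength ℓ) (C : HypOrbit W) (a : ℤ) :
    ∃ c : Hecke x₀ (genParam W) →+* (Hecke x₀ (genParam W))[T;T⁻¹],
      (∀ b, c (T x₀ _ b) = AddMonoidAlgebra.single (a * (ℓ C b).toAdd) (T x₀ _ b)) ∧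
      ∀ r, c (algebraMap (GenRing W) _ r) = laurentScalar _ _ (genEval (laurentParam C a) r) := by
  classical
  let χ : Braid x₀ →* ((GenRing W)[T;T⁻¹])ˣ :=
    (laurentUnit (GenRing W)).comp ((zpowGroupHom a).comp (ℓ C))
  have hχ : ∀ b, (χ b : (GenRing W)[T;T⁻¹]) =
      AddMonoidAlgebra.single (a * (ℓ C b).toAdd) 1 := fun b => rfl
  have hcompat : Compat χ (laurentParam C a) ((genParam W).map LaurentPolynomial.C) := by
    intro C' s hs
    refine ⟨0, fun j => ?_⟩
    rw [add_zero, laurentParam, Param.scale]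
    congr 1
    by_cases hC : C' = C
    · subst hC
      rw [Function.update_self]
      change _ = laurentUnit (GenRing W) (ℓ C' s ^ a)
      rw [hℓ.self _ _ hs, ← ofAdd_zsmul, smul_eq_mul, mul_one]
    · rw [Function.update_of_ne hC]
      change _ = laurentUnit (GenRing W) (ℓ C s ^ a)
      rw [hℓ.other C C' s hC hs, one_zpow, map_one]
      rfl
  rw [← genParam_map_genEval (laurentParam C a)] at hcompat
  obtain ⟨c, hc, hc'⟩ := Hecke.exists_ringHom (genParam W) (genEval (laurentParam C a))
    (laurentScalar _ (Hecke x₀ (genParam W))) laurentScalar_mul_comm hcompat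
    ((LaurentPolynomial.C : Hecke x₀ (genParam W) →+* _).toMonoidHom.comp (THom x₀ (genParam W)))
    (fun C' s hs => by
      have hp : paramPoly ((genParam W).map LaurentPolynomial.C) C' =
          (paramPoly (genParam W) C').map
            (LaurentPolynomial.C : GenRing W →+* (GenRing W)[T;T⁻¹]) := by
        simp [paramPoly, Param.map, Polynomial.map_prod]
      have h0 := congrArg (LaurentPolynomial.C : Hecke x₀ (genParam W) →+* _)
        (aeval_T_paramPoly (u := genParam W) hs)
      rw [map_zero, Polynomial.aeval_def, Polynomial.hom_eval₂] at h0
      rw [hp, Polynomial.eval₂_map, ← h0]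
      congr 1
      refine RingHom.ext fun r => ?_
      rw [RingHom.comp_apply, RingHom.comp_apply, ← LaurentPolynomial.single_eq_C,
        laurentScalar_single, LaurentPolynomial.single_eq_C])
  refine ⟨c, fun b => ?_, hc'⟩
  rw [hc, hχ, laurentScalar_single, map_one]
  change _ * LaurentPolynomial.C (T x₀ (genParam W) b) = _
  rw [← LaurentPolynomial.single_eq_C, AddMonoidAlgebra.single_mul_single, add_zero, one_mul]

theorem laurentEvalOne_eq_eval₂ (f : S[T;T⁻¹]) :
    laurentEvalOne S f = LaurentPolynomial.eval₂ (RingHom.id S) 1 f := by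
  induction f using AddMonoidAlgebra.induction_linear with
  | zero => simp
  | add f g hf hg => rw [map_add, map_add, hf, hg]
  | single l h =>
    rw [laurentEvalOne_single, LaurentPolynomial.single_eq_C_mul_T, map_mul,
      LaurentPolynomial.eval₂_C, LaurentPolynomial.eval₂_T]
    simp

open Classical in
theorem eval₂_genEval_laurentParam (u : Param W S) (x : Sˣ)
    (C : HypOrbit W) (a : ℤ) :
    (LaurentPolynomial.eval₂ (genEval u) x).comp (genEval (laurentParam C a)) =
      genEval (Param.scale (Function.update 1 C (x ^ a)) u) := by
  refine genRing_hom_ext fun C' j => ?_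
  rw [RingHom.comp_apply, genEval_genParam, genEval_genParam, laurentParam, Param.scale,
    Param.scale, Units.val_mul, Units.val_mul, map_mul]
  congr 1
  · by_cases hC : C' = C
    · subst hC
      rw [Function.update_self, Function.update_self]
      exact LaurentPolynomial.eval₂_T _ _ _
    · rw [Function.update_of_ne hC, Function.update_of_ne hC]
      exact map_one _
  · change LaurentPolynomial.eval₂ _ _ (LaurentPolynomial.C _) = _
    rw [LaurentPolynomial.eval₂_C, genEval_genParam]

variable {t : Hecke x₀ (genParam W) →ₗ[GenRing W] GenRing W}

/-- The canonical form is homogeneous with respect to the indeterminates of each orbit. -/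
theorem IsCanonicalForm.homogeneous [Finite W] (ht : IsCanonicalForm x₀ t)
    (hfree : Nonempty (Module.Basis W (GenRing W) (Hecke x₀ (genParam W))))
    (hK : CharZero K) (hℓ : IsBraidLength ℓ) (C : HypOrbit W) (b : Braid x₀) :
    genEval (laurentParam C 1) (t (T x₀ _ b)) =
      AddMonoidAlgebra.single (ℓ C b).toAdd (t (T x₀ _ b)) := by
  classical
  obtain ⟨B⟩ := hfree
  have := Fintype.ofFinite W
  have hev := ht.eval_trace B
  obtain ⟨c, hcT, hcσ⟩ := exists_coaction hℓ C 1
  obtain ⟨c', hcT', hcσ'⟩ := exists_coaction hℓ C (-1)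
  -- The scaling by `x`, extended to Laurent polynomials with `x` fixed. It undoes the scaling by
  -- `x⁻¹`.
  let ext : (GenRing W)[T;T⁻¹] →+* (GenRing W)[T;T⁻¹] :=
    LaurentPolynomial.eval₂ (genEval (laurentParam C 1)) (laurentUnit _ (Multiplicative.ofAdd 1))
  have hext : ∀ r, ext (genEval (laurentParam C (-1)) r) = LaurentPolynomial.C r := by
    intro r
    change (ext.comp (genEval (laurentParam C (-1)))) r = _
    congr 1
    rw [eval₂_genEval_laurentParam]
    refine genRing_hom_ext fun C' j => ?_
    rw [genEval_genParam, laurentParam, Param.scale, Param.scale, ← mul_assoc, ← Pi.mul_apply]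
    have : ∀ v : ((GenRing W)[T;T⁻¹])ˣ, Function.update (1 : HypOrbit W → _) C (v ^ (-1 : ℤ)) *
        Function.update (1 : HypOrbit W → _) C v = 1 := by
      intro v
      rw [← Function.update_mul]
      simp
    rw [this, Pi.one_apply, one_mul]
    rfl
  -- Passing through the coaction for `-1` before applying `t` and `ext` makes `G` linear and not
  -- just semilinear; on `T_b` it is `x ^ (-ℓ(b))` times the scaled `t(T_b)`.
  let G : Hecke x₀ (genParam W) →ₗ[GenRing W] (GenRing W)[T;T⁻¹] :=
    { toFun := fun x => ext (laurentForm t (c' x))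
      map_add' := fun x y => by rw [map_add, map_add, map_add]
      map_smul' := fun r x => by
        rw [Algebra.smul_def, map_mul c', hcσ', laurentForm_scalar_mul, map_mul ext, hext,
          RingHom.id_apply, LaurentPolynomial.smul_eq_C_mul] }
  refine ht.symm.homogeneous B ht.map_one
    (fun a => ht.symm.eq_zero_of_isNilpotent B Nat.card_pos.ne' hev)
    (fun e => eq_zero_of_isIdempotentElem B hev) (THom x₀ (genParam W)) span_range_T (ℓ C)
    (genEval (laurentParam C 1)) c (fun g => ?_) hcσ (fun r => ?_) G (fun g => ?_) b
  · rw [← one_mul (Multiplicative.toAdd _)]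
    exact hcT g
  · rw [laurentEvalOne_eq_eval₂, ← genEval_genParam_eq_id, ← RingHom.comp_apply,
      eval₂_genEval_laurentParam, one_zpow]
    have : Param.scale (Function.update 1 C 1) (genParam W) = genParam W := by
      rw [show (1 : (GenRing W)ˣ) = (1 : HypOrbit W → (GenRing W)ˣ) C from rfl,
        Function.update_eq_self]
      funext C j
      exact one_mul _
    rw [this, genEval_genParam_eq_id]
    rfl
  · change ext (laurentForm t (c' (T x₀ _ g))) = _
    rw [hcT']
    change ext (AddMonoidAlgebra.map _ _) = _
    rw [AddMonoidAlgebra.map_single, LaurentPolynomial.single_eq_C_mul_T, map_mul,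
      LaurentPolynomial.eval₂_C, LaurentPolynomial.eval₂_T, mul_comm, ← map_zpow,
      laurentUnit_val, neg_one_mul]
    congr 2
    rw [← ofAdd_zsmul, smul_eq_mul, mul_one]
    rfl

/-- The linear character of the braid group that takes the value `c_𝒞` on `𝐒_𝒞`. -/
def braidChar (ℓ : HypOrbit W → Braid x₀ →* Multiplicative ℤ) (c : HypOrbit W → Sˣ) :
    Braid x₀ →* Sˣ :=
  ∏ᶠ C, (zpowersHom Sˣ (c C)).comp (ℓ C)

theorem braidChar_apply [Fintype (HypOrbit W)] (c : HypOrbit W → Sˣ) (b : Braid x₀) :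
    braidChar ℓ c b = ∏ C, c C ^ (ℓ C b).toAdd := by
  rw [braidChar, finprod_eq_prod_of_fintype, MonoidHom.finsetProd_apply]
  rfl

theorem braidChar_of_isBraidReflection [Finite W] (hℓ : IsBraidLength ℓ) (c : HypOrbit W → Sˣ)
    {C : HypOrbit W} {s : Braid x₀} (hs : IsBraidReflection C s) : braidChar ℓ c s = c C := by
  have := Fintype.ofFinite (HypOrbit W)
  rw [braidChar_apply, Finset.prod_eq_single C]
  · rw [hℓ.self C s hs]
    simp
  · intro C' _ hC
    rw [hℓ.other C' C s hC.symm hs]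
    simp
  · simp

/-- The lengths of a pure braid are divisible by the `e_C`. -/
theorem braidChar_eq_one [Finite W] (hℓ : IsBraidLength ℓ) {c : HypOrbit W → Sˣ}
    (hc : ∀ C, c C ^ ramif C = 1) {b : Braid x₀} (hb : LiftsTo b 1) : braidChar ℓ c b = 1 := by
  have := Fintype.ofFinite (HypOrbit W)
  rw [braidChar_apply]
  refine Finset.prod_eq_one fun C _ => ?_
  obtain ⟨k, hk⟩ := hℓ.pure C b hb
  rw [hk, toAdd_ofAdd, zpow_mul, zpow_natCast, hc, one_zpow]

theorem braidChar_mul [Finite W] (c c' : HypOrbit W → Sˣ) :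
    braidChar ℓ (c * c') = braidChar ℓ c * braidChar ℓ c' := by
  have := Fintype.ofFinite (HypOrbit W)
  ext1 b
  rw [MonoidHom.mul_apply, braidChar_apply, braidChar_apply, braidChar_apply,
    ← Finset.prod_mul_distrib]
  simp only [Pi.mul_apply, mul_zpow]

theorem map_braidChar [Finite W] {S' : Type*} [CommRing S'] (f : S →+* S') (c : HypOrbit W → Sˣ)
    (b : Braid x₀) :
    Units.map (f : S →* S') (braidChar ℓ c b) =
      braidChar ℓ (fun C => Units.map (f : S →* S') (c C)) b := by
  have := Fintype.ofFinite (HypOrbit W)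
  rw [braidChar_apply, braidChar_apply, map_prod]
  simp only [map_zpow]

/-- The values of a canonical form under a scaling of the parameters. -/
theorem IsCanonicalForm.genEval_scale [Finite W] (ht : IsCanonicalForm x₀ t)
    (hfree : Nonempty (Module.Basis W (GenRing W) (Hecke x₀ (genParam W))))
    (hK : CharZero K) (hℓ : IsBraidLength ℓ) (c : HypOrbit W → Sˣ) (u : Param W S)
    (b : Braid x₀) :
    genEval (Param.scale c u) (t (T x₀ _ b)) = braidChar ℓ c b * genEval u (t (T x₀ _ b)) := by
  classical
  have := Fintype.ofFinite (HypOrbit W)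
  -- One orbit at a time: evaluate the homogeneity identity at the given unit.
  have key : ∀ (C : HypOrbit W) (x : Sˣ) (u : Param W S),
      genEval (Param.scale (Function.update 1 C x) u) (t (T x₀ _ b)) =
        (x ^ (ℓ C b).toAdd : Sˣ) * genEval u (t (T x₀ _ b)) := by
    intro C x u
    have h1 := congrArg (LaurentPolynomial.eval₂ (genEval u) x) (ht.homogeneous hfree hK hℓ C b)
    rw [← RingHom.comp_apply, eval₂_genEval_laurentParam, zpow_one,
      LaurentPolynomial.single_eq_C_mul_T, map_mul, LaurentPolynomial.eval₂_C,
      LaurentPolynomial.eval₂_T, mul_comm] at h1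
    exact h1
  have hind : ∀ s : Finset (HypOrbit W),
      genEval (Param.scale (fun C => if C ∈ s then c C else 1) u) (t (T x₀ _ b)) =
        (∏ C ∈ s, c C ^ (ℓ C b).toAdd : Sˣ) * genEval u (t (T x₀ _ b)) := by
    intro s
    induction s using Finset.induction_on with
    | empty =>
      rw [Finset.prod_empty, Units.val_one, one_mul]
      congr 2
      funext C j
      simp [Param.scale]
    | insert C s hC ih =>
      rw [Finset.prod_insert hC, Units.val_mul, mul_assoc, ← ih, ← key]
      congr 2
      funext C' j
      simp only [Param.scale, ← mul_assoc]
      congr 1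
      by_cases h : C' = C
      · subst h
        simp [hC]
      · simp [h]
  have h2 := hind Finset.univ
  rw [← braidChar_apply] at h2
  simpa using h2

end Scaling

end CycHecke
end

/-! ### Invariance of the canonical form under translation of the indices -/

noncomputable section

namespace CycHecke

/-- Transport of structure along the semilinear automorphism `(τ, π)`. -/
theorem IsSymmetrizing.of_semilinear {R H : Type*} [CommRing R] [Ring H] [Algebra R H]
    {t t' : H →ₗ[R] R} (ht : IsSymmetrizing t) (τ : R ≃+* R) (π : H ≃+* H)
    (hπ : ∀ (r : R) h, π (r • h) = τ r • π h) (h : ∀ x, τ (t' x) = t (π x)) :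
    IsSymmetrizing t' := by
  refine ⟨fun a b => τ.injective ?_, fun a b hab => ?_, fun f => ?_⟩
  · rw [h, h, map_mul π, map_mul π, ht.1]
  · rw [← sub_eq_zero]
    apply π.injective
    rw [map_zero]
    refine ht.eq_zero fun x => ?_
    obtain ⟨x, rfl⟩ := π.surjective x
    have := LinearMap.congr_fun hab x
    simp only [LinearMap.comp_apply, LinearMap.mulLeft_apply] at this
    rw [← map_mul, ← h, sub_mul, map_sub, this, sub_self, map_zero]
  · let f' : H →ₗ[R] R :=
      { toFun := fun x => τ (f (π.symm x))
        map_add' := fun x y => by simp only [map_add]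
        map_smul' := fun r x => by
          have : π.symm (r • x) = τ.symm r • π.symm x := by
            apply π.injective
            rw [hπ, π.apply_symm_apply, π.apply_symm_apply, τ.apply_symm_apply]
          rw [this, map_smul, smul_eq_mul, map_mul, τ.apply_symm_apply]
          rfl }
    obtain ⟨a, ha⟩ := ht.exists_dual f'
    refine ⟨π.symm a, LinearMap.ext fun x => τ.injective ?_⟩
    change τ (t' (π.symm a * x)) = _
    rw [h, map_mul, π.apply_symm_apply, ha]
    change τ (f (π.symm (π x))) = _
    rw [π.symm_apply_apply]

section Translation

variable {K : Type*} [Field K] [Algebra K ℂ] {n : ℕ} {W : Subgroup (GL (Fin n) K)}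
variable {x₀ : Vreg W} {S : Type*} [CommRing S]

/-- Both branches of the definition of `zeta` satisfy this, the default value `1` trivially. -/
theorem zeta_pow {e : ℕ} (he : e ≠ 0) : zeta K e ^ e = 1 := by
  rw [zeta]
  split_ifs with h
  · have h1 := h.choose_spec
    apply Units.ext
    apply NumberField.RingOfIntegers.ext
    apply (algebraMap K ℂ).injective
    simp only [Units.val_pow_eq_pow_val, Units.val_one, map_pow, map_one]
    rw [h1, ← Complex.exp_nat_mul, mul_div_cancel₀ _ (Nat.cast_ne_zero.2 he),
      Complex.exp_two_pi_mul_I]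
  · exact one_pow _

/-- `ζ_e ^ j`, for `j` modulo `e`. -/
theorem zeta_pow_val_add {e : ℕ} (he : e ≠ 0) (i j : ZMod e) :
    zeta K e ^ (i + j).val = zeta K e ^ i.val * zeta K e ^ j.val := by
  have : NeZero e := ⟨he⟩
  rw [ZMod.val_add, ← pow_add, ← pow_eq_pow_mod _ (zeta_pow he)]

/-- The scalars `ζ_{e_𝒞}^{g_𝒞}`. -/
def shiftScalar (g : (C : HypOrbit W) → ZMod (ramif C)) (C : HypOrbit W) : (𝓞 K)ˣ :=
  zeta K (ramif C) ^ (g C).val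

theorem shiftScalar_add [Finite W] (g h : (C : HypOrbit W) → ZMod (ramif C)) :
    shiftScalar (g + h) = shiftScalar g * shiftScalar h :=
  funext fun C => zeta_pow_val_add (ramif_ne_zero C) _ _

theorem shiftScalar_pow [Finite W] (g : (C : HypOrbit W) → ZMod (ramif C)) (C : HypOrbit W) :
    shiftScalar g C ^ ramif C = 1 := by
  rw [shiftScalar, ← pow_mul, mul_comm, pow_mul, zeta_pow (ramif_ne_zero C), one_pow]

/-- At the group algebra a translation of the indices is a scaling by roots of unity, which brings
the translated form within reach of homogeneity. -/
theorem groupParam_translate [Finite W] (g : (C : HypOrbit W) → ZMod (ramif C)) :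
    (groupParam W).translate g = (groupParam W).scale (shiftScalar g) := by
  funext C j
  rw [Param.translate, Param.scale, groupParam, zeta_pow_val_add (ramif_ne_zero C), mul_comm]
  rfl

theorem Param.translate_translate (g h : (C : HypOrbit W) → ZMod (ramif C)) (u : Param W S) :
    (u.translate g).translate h = u.translate (h + g) :=
  funext₂ fun C j => by rw [translate, translate, translate, Pi.add_apply, add_assoc]

theorem Param.translate_zero (u : Param W S) : u.translate 0 = u :=
  funext₂ fun C j => by rw [translate, Pi.zero_apply, add_zero]

/-- The automorphism `u_{𝒞,j} ↦ u_{𝒞,j+g_𝒞}` of the generic ring. -/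
def genTranslateHom (g : (C : HypOrbit W) → ZMod (ramif C)) : GenRing W →+* GenRing W :=
  genEval ((genParam W).translate g)

theorem genEval_comp_genTranslateHom (g : (C : HypOrbit W) → ZMod (ramif C)) (u : Param W S) :
    (genEval u).comp (genTranslateHom g) = genEval (u.translate g) :=
  genRing_hom_ext fun C j => by
    rw [RingHom.comp_apply, genTranslateHom, genEval_genParam, genEval_genParam, Param.translate,
      genEval_genParam, Param.translate]

theorem genTranslateHom_comp (g h : (C : HypOrbit W) → ZMod (ramif C)) (hgh : h + g = 0) :
    (genTranslateHom g).comp (genTranslateHom h) = RingHom.id (GenRing W) := by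
  rw [genTranslateHom, genEval_comp_genTranslateHom, Param.translate_translate, hgh,
    Param.translate_zero, genEval_genParam_eq_id]

/-- The automorphism `u_{𝒞,j} ↦ u_{𝒞,j+g_𝒞}` of the generic ring. -/
def genTranslate (g : (C : HypOrbit W) → ZMod (ramif C)) : GenRing W ≃+* GenRing W :=
  RingEquiv.ofRingHom (genTranslateHom g) (genTranslateHom (-g))
    (genTranslateHom_comp _ _ (neg_add_cancel g)) (genTranslateHom_comp _ _ (add_neg_cancel g))

theorem genEval_genTranslate (g : (C : HypOrbit W) → ZMod (ramif C)) (u : Param W S)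
    (r : GenRing W) : genEval u (genTranslateHom g r) = genEval (u.translate g) r := by
  rw [← genEval_comp_genTranslateHom]; rfl

theorem genInv_genParam (C : HypOrbit W) (j : ZMod (ramif C)) :
    genInv W (genParam W C j) = ((genParam W C j)⁻¹ : (GenRing W)ˣ) := by
  change genInv W (AddMonoidAlgebra.single _ 1) = AddMonoidAlgebra.single _ 1
  simp [genInv]

theorem genInv_genTranslateHom (g : (C : HypOrbit W) → ZMod (ramif C)) (r : GenRing W) :
    genInv W (genTranslateHom g r) = genTranslateHom g (genInv W r) := by
  change ((genInv W).comp (genTranslateHom g)) r = ((genTranslateHom g).comp (genInv W)) r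
  congr 1
  refine genRing_hom_ext fun C j => ?_
  rw [RingHom.comp_apply, RingHom.comp_apply, genInv_genParam, genTranslateHom, genEval_genParam,
    Param.translate, genInv_genParam]
  have h : Units.map (genEval ((genParam W).translate g) : GenRing W →* GenRing W)
      (genParam W C j) = genParam W C (j + g C) := Units.ext (genEval_genParam _ C j)
  rw [← h, ← map_inv]
  rfl

/-- The relations are symmetric in the parameters of each orbit, so the translation of the ring
extends to the algebra while fixing every `T_b`. -/
theorem exists_heckeTranslate [Finite W] (g : (C : HypOrbit W) → ZMod (ramif C)) :
    ∃ π : Hecke x₀ (genParam W) →+* Hecke x₀ (genParam W), (∀ b, π (T x₀ _ b) = T x₀ _ b) ∧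
      ∀ (r : GenRing W) h, π (r • h) = genTranslateHom g r • π h := by
  have hc : Compat (1 : Braid x₀ →* (GenRing W)ˣ) ((genParam W).map (genTranslateHom g))
      (genParam W) := by
    intro C s _
    refine ⟨g C, fun j => ?_⟩
    rw [genTranslateHom, genParam_map_genEval, MonoidHom.one_apply, one_mul, Param.translate]
  refine ⟨(twistHom hc : _ →+* Hecke x₀ (genParam W)).comp
    (Hecke.spec x₀ (genTranslateHom g) (genParam W)), fun b => ?_, fun r h => ?_⟩
  · rw [RingHom.comp_apply, Hecke.spec_T]
    refine (twistHom_T hc b).trans ?_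
    rw [MonoidHom.one_apply, Units.val_one, one_smul]
  · rw [RingHom.comp_apply, Hecke.spec_smul]
    exact map_smul (twistHom hc) _ _

variable {t : Hecke x₀ (genParam W) →ₗ[GenRing W] GenRing W}
  {ℓ : HypOrbit W → Braid x₀ →* Multiplicative ℤ}

/-- The conjugate of `t` by a translation is symmetrizing, and it satisfies (ii) because
translations commute with the inversion of the indeterminates. Condition (i) is the point that needs
homogeneity. -/
theorem IsCanonicalForm.translate [Finite W] (ht : IsCanonicalForm x₀ t)
    (hfree : Nonempty (Module.Basis W (GenRing W) (Hecke x₀ (genParam W))))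
    (hK : CharZero K) (hℓ : IsBraidLength ℓ) (g : (C : HypOrbit W) → ZMod (ramif C)) :
    ∃ t', IsCanonicalForm x₀ t' ∧ ∀ b, t' (T x₀ _ b) = genTranslateHom (-g) (t (T x₀ _ b)) := by
  obtain ⟨π, hπT, hπ⟩ := exists_heckeTranslate (x₀ := x₀) g
  obtain ⟨π', hπT', hπ'⟩ := exists_heckeTranslate (x₀ := x₀) (-g)
  have h1 : ∀ h, π (π' h) = h := by
    intro h
    induction h using Hecke.induction with
    | hT b => rw [hπT', hπT]
    | hadd a b ha hb => rw [map_add, map_add, ha, hb]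
    | hsmul r a ha =>
      rw [hπ', hπ, ha, ← RingHom.comp_apply, genTranslateHom_comp _ _ (neg_add_cancel g)]; rfl
  have h2 : ∀ h, π' (π h) = h := by
    intro h
    induction h using Hecke.induction with
    | hT b => rw [hπT, hπT']
    | hadd a b ha hb => rw [map_add, map_add, ha, hb]
    | hsmul r a ha =>
      rw [hπ, hπ', ha, ← RingHom.comp_apply, genTranslateHom_comp _ _ (add_neg_cancel g)]; rfl
  let t' : Hecke x₀ (genParam W) →ₗ[GenRing W] GenRing W :=
    { toFun := fun h => genTranslateHom (-g) (t (π h))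
      map_add' := fun x y => by simp only [map_add]
      map_smul' := fun r x => by
        rw [hπ, map_smul, smul_eq_mul, map_mul, ← RingHom.comp_apply,
          genTranslateHom_comp _ _ (add_neg_cancel g)]
        rfl }
  have ht' : ∀ b, t' (T x₀ _ b) = genTranslateHom (-g) (t (T x₀ _ b)) := fun b => by
    change genTranslateHom (-g) (t (π _)) = _
    rw [hπT]
  -- The specialization of the new form differs by a character that is trivial on pure braids; on
  -- the other braids the specialization of `t` is `0` anyway.
  have hev : ∀ b, genEval (groupParam W) (t' (T x₀ _ b)) =
      (braidChar ℓ (shiftScalar (-g)) b : 𝓞 K) *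
        genEval (groupParam W) (t (T x₀ _ b)) := fun b => by
    rw [ht', genEval_genTranslate, groupParam_translate, ht.genEval_scale hfree hK hℓ]
  refine ⟨t', ⟨?_, ?_, ?_, ?_⟩, ht'⟩
  · refine ht.symm.of_semilinear (genTranslate g)
      (RingEquiv.ofRingHom π π' (RingHom.ext h1) (RingHom.ext h2)) hπ fun x => ?_
    change genTranslateHom g (genTranslateHom (-g) (t (π x))) = _
    rw [← RingHom.comp_apply, genTranslateHom_comp _ _ (neg_add_cancel g)]
    rfl
  · intro γ
    rw [hev, ht.spec_eq_one, mul_one, braidChar_eq_one hℓ (shiftScalar_pow _), Units.val_one]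
    exact ⟨x₀, by change act 1 x₀.1 = x₀.1; rw [act_one]; rfl, γ, rfl⟩
  · intro w y h γ hw
    rw [hev, ht.spec_eq_zero w y h γ hw, mul_zero]
  · intro b
    rw [ht', ht', ht', genInv_genTranslateHom, ← map_mul, ht.inv]

/-- The uniqueness of the canonical form makes it invariant under the translations of the
indices. -/
theorem IsCanonicalForm.genEval_translate [Finite W] (ht : IsCanonicalForm x₀ t)
    (ht_unique : ∀ t', IsCanonicalForm x₀ t' → t' = t)
    (hfree : Nonempty (Module.Basis W (GenRing W) (Hecke x₀ (genParam W))))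
    (hK : CharZero K) (hℓ : IsBraidLength ℓ) (g : (C : HypOrbit W) → ZMod (ramif C))
    (u : Param W S) (b : Braid x₀) :
    genEval (u.translate g) (t (T x₀ _ b)) = genEval u (t (T x₀ _ b)) := by
  obtain ⟨t', ht', h⟩ := ht.translate hfree hK hℓ (-g)
  rw [← genEval_genTranslate]
  have h1 := h b
  rw [ht_unique t' ht', neg_neg] at h1
  rw [← h1]

end Translation

/-! ### Comparison of the forms on `ℋ_𝐦` and `ℋ_{𝐠.𝐦}` -/

section Cyclotomic

variable {K : Type*} [Field K] [Algebra K ℂ] {n : ℕ}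
  {W : Subgroup (GL (Fin n) K)} {x₀ : Vreg W}
  {t : Hecke x₀ (genParam W) →ₗ[GenRing W] GenRing W}
  {ℓ : HypOrbit W → Braid x₀ →* Multiplicative ℤ}

/-- The scalars `ζ_{e_𝒞}^{g_𝒞}` in `ℤ_K[y, y⁻¹]`. -/
def cycScalar (g : ShiftGroup W) (C : HypOrbit W) : ((𝓞 K)[T;T⁻¹])ˣ :=
  Units.map (LaurentPolynomial.C : 𝓞 K →+* (𝓞 K)[T;T⁻¹]) (shiftScalar g C)

/-- `ζ^{j+g} q^{m_{j+g}} = ζ^g · ζ^j q^{(g.m)_j}`. -/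
theorem cycParam_translate [Finite W] (g : ShiftGroup W) (m : Weights W) :
    (cycParam m).translate g = (cycParam (shift g m)).scale (cycScalar g) := by
  funext C j
  rw [Param.translate, Param.scale, cycParam, cycParam, ← mul_assoc, cycScalar, shiftScalar,
    zeta_pow_val_add (ramif_ne_zero C), map_mul, mul_comm (Units.map _ (zeta K (ramif C) ^ j.val))]
  rfl

/-- This says that `Γ` carries the form of `ℋ_𝐦` to that of `ℋ_{𝐠.𝐦}`: translate the indices by
invariance, then remove the scalars `ζ^𝐠` by homogeneity. -/
theorem IsCanonicalForm.genEval_cycParam_shift [Finite W] (ht : IsCanonicalForm x₀ t)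
    (ht_unique : ∀ t', IsCanonicalForm x₀ t' → t' = t)
    (hfree : Nonempty (Module.Basis W (GenRing W) (Hecke x₀ (genParam W))))
    (hK : CharZero K) (hℓ : IsBraidLength ℓ) (g : ShiftGroup W) (m : Weights W) (b : Braid x₀) :
    genEval (cycParam m) (t (T x₀ _ b)) = (braidChar ℓ (cycScalar g) b : (𝓞 K)[T;T⁻¹]) *
      genEval (cycParam (shift g m)) (t (T x₀ _ b)) := by
  rw [← ht.genEval_scale hfree hK hℓ, ← cycParam_translate,
    ht.genEval_translate ht_unique hfree hK hℓ]

theorem compat_cycParam [Finite W] (hℓ : IsBraidLength ℓ) (g : ShiftGroup W) (m : Weights W) :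
    Compat (braidChar ℓ (cycScalar g)) (cycParam m) (cycParam (shift g m)) := by
  intro C s hs
  -- The sign: the parameter of index `j` for `𝐦` is `ζ^g` times that of index `j - g` for `𝐠.𝐦`.
  refine ⟨-g C, fun j => ?_⟩
  rw [braidChar_of_isBraidReflection hℓ _ hs]
  have h := congrFun (congrFun (cycParam_translate g m) C) (j + -g C)
  rw [Param.translate, Param.scale, neg_add_cancel_right] at h
  exact h

end Cyclotomic

end CycHecke
end

/-! ### Simple modules of finite-dimensional algebras and their characters -/

noncomputable section

namespace CycHecke

section Simple

instance Irr.isSimpleModule {A : Type*} [Ring A] (M : Irr A) : IsSimpleModule A M.Mod :=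
  isSimpleModule_iff_isCoatom.2 (Quotient.out M).2.out

theorem Irr.ext {A : Type*} [Ring A] {M M' : Irr A} (h : Nonempty (M.Mod ≃ₗ[A] M'.Mod)) :
    M = M' := by
  rw [← Quotient.out_eq M, ← Quotient.out_eq M']
  exact Quotient.sound h

theorem Irr.exists_linearEquiv {A : Type*} [Ring A] (N : Type*) [AddCommGroup N] [Module A N]
    [IsSimpleModule A N] : ∃ M : Irr A, Nonempty (M.Mod ≃ₗ[A] N) := by
  obtain ⟨I, hI, ⟨e⟩⟩ := isSimpleModule_iff_quot_maximal.1 ‹IsSimpleModule A N›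
  let I' : {I : Ideal A // I.IsMaximal} := ⟨I, hI⟩
  obtain ⟨f⟩ : (simpleSetoid A).r (Quotient.out (Quotient.mk (simpleSetoid A) I')) I' :=
    Quotient.mk_out (s := simpleSetoid A) I'
  exact ⟨Quotient.mk (simpleSetoid A) I', ⟨f.trans e.symm⟩⟩

variable (F : Type*) [Field F] {A : Type*} [Ring A] [Algebra F A]

theorem finite_quotient [Module.Finite F A] (I : Ideal A) : Module.Finite F (A ⧸ I) :=
  Module.Finite.equiv (Submodule.Quotient.restrictScalarsEquiv F I)

instance Irr.finite_mod [Module.Finite F A] (M : Irr A) : Module.Finite F M.Mod :=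
  finite_quotient F _

open Classical in
/-- Simple modules can be separated by elements of the algebra. -/
theorem Irr.exists_smul_eq_ite [Module.Finite F A] (s : Finset (Irr A)) (M₀ : Irr A) :
    ∃ a : A, ∀ M ∈ s, ∀ x : M.Mod, a • x = if M = M₀ then x else 0 := by
  let N := (M : s) → M.1.Mod
  -- The projection onto the summand `M₀`. It commutes with all `A`-endomorphisms because there are
  -- no non-zero maps between non-isomorphic simple modules (Schur).
  let Φ : Module.End (Module.End A N) N :=
    { toFun := fun x M => if M.1 = M₀ then x M else 0
      map_add' := fun x y => by
        funext M
        change (if M.1 = M₀ then x M + y M else 0) =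
          (if M.1 = M₀ then x M else 0) + (if M.1 = M₀ then y M else 0)
        split_ifs
        · rfl
        · rw [add_zero]
      map_smul' := fun h x => by
        funext M
        have key : ∀ (M' : s) (y : M'.1.Mod), M' ≠ M → h (Pi.single M' y) M = 0 := by
          intro M' y hne
          let q : M'.1.Mod →ₗ[A] M.1.Mod :=
            (LinearMap.proj M).comp (h.comp (LinearMap.single A (fun M : s => M.1.Mod) M'))
          rcases q.bijective_or_eq_zero with hq | hq
          · exact absurd (Subtype.ext (Irr.ext ⟨LinearEquiv.ofBijective q hq⟩)) hne
          · exact LinearMap.congr_fun hq y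
        have key2 : ∀ y : N, h y M = h (Pi.single M (y M)) M := by
          intro y
          conv_lhs => rw [← Finset.univ_sum_single y, map_sum, Finset.sum_apply]
          exact Finset.sum_eq_single M (fun M' _ hne => key M' _ hne) (by simp)
        change (if M.1 = M₀ then h x M else 0) = h (fun M => if M.1 = M₀ then x M else 0) M
        rw [key2 fun M => if M.1 = M₀ then x M else 0]
        split_ifs
        · exact key2 x
        · rw [Pi.single_zero, map_zero, Pi.zero_apply] }
  obtain ⟨T, hT⟩ := (inferInstance : Module.Finite F N)
  -- By density some `a` agrees with `Φ` on a finite set spanning `N` over `F`, hence everywhere.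
  obtain ⟨a, ha⟩ := jacobson_density Φ T
  have hall : ∀ x : N, Φ x = a • x := by
    intro x
    have hx : x ∈ Submodule.span F (T : Set N) := by rw [hT]; trivial
    induction hx using Submodule.span_induction with
    | mem x hx => exact ha x hx
    | zero => simp
    | add x y _ _ hx hy => rw [map_add, smul_add, hx, hy]
    | smul c x _ hx =>
      have : Φ (c • x) = c • Φ x := by
        funext M
        change (if M.1 = M₀ then c • x M else 0) = c • (if M.1 = M₀ then x M else 0)
        split_ifs <;> simp
      rw [this, hx, smul_comm]
  refine ⟨a, fun M hM x => ?_⟩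
  have h := congrFun (hall (Pi.single ⟨M, hM⟩ x)) ⟨M, hM⟩
  change (if M = M₀ then (Pi.single ⟨M, hM⟩ x : N) ⟨M, hM⟩ else 0) =
    a • (Pi.single ⟨M, hM⟩ x : N) ⟨M, hM⟩ at h
  rw [Pi.single_eq_same] at h
  exact h.symm

/-- Elements separating a finite set of classes are linearly independent, so there are at most `dim
A` classes. -/
theorem Irr.finite [Module.Finite F A] : Finite (Irr A) := by
  classical
  by_contra hinf
  rw [not_finite_iff_infinite] at hinf
  obtain ⟨s, hs⟩ := Infinite.exists_subset_card_eq (Irr A) (Module.finrank F A + 1)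
  choose a ha using Irr.exists_smul_eq_ite F (A := A) s
  have hli : LinearIndependent F fun M : s => a M.1 := by
    rw [Fintype.linearIndependent_iff]
    intro c hc M
    have := IsSimpleModule.nontrivial A M.1.Mod
    obtain ⟨x, hx⟩ := exists_ne (0 : M.1.Mod)
    have h1 := congrArg (· • x) hc
    simp only [Finset.sum_smul, zero_smul, smul_assoc] at h1
    rw [Finset.sum_eq_single M] at h1
    · rw [ha M.1 M.1 M.2, if_pos rfl] at h1
      exact (smul_eq_zero.1 h1).resolve_right hx
    · intro M' _ hne
      rw [ha M'.1 M.1 M.2, if_neg fun h => hne (Subtype.ext h.symm), smul_zero]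
    · simp
  have := hli.fintype_card_le_finrank
  rw [Fintype.card_coe, hs] at this
  omega

open Classical in
theorem Irr.exists_smul_eq [Module.Finite F A] (M₀ : Irr A) :
    ∃ a : A, ∀ (M : Irr A) (x : M.Mod), a • x = if M = M₀ then x else 0 := by
  have := Irr.finite F (A := A)
  have := Fintype.ofFinite (Irr A)
  obtain ⟨a, ha⟩ := Irr.exists_smul_eq_ite F Finset.univ M₀
  exact ⟨a, fun M => ha M (Finset.mem_univ _)⟩

theorem Irr.char_add (M : Irr A) (a b : A) : M.char F (a + b) = M.char F a + M.char F b := by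
  rw [char, map_add, map_add]; rfl

theorem Irr.char_smul (M : Irr A) (c : F) (a : A) : M.char F (c • a) = c * M.char F a := by
  rw [char, map_smul, map_smul]; rfl

theorem Irr.char_eq_ite [Module.Finite F A] {M₀ : Irr A} {a : A} [DecidableEq (Irr A)]
    (ha : ∀ (M : Irr A) (x : M.Mod), a • x = if M = M₀ then x else 0) (M : Irr A) :
    M.char F a = if M = M₀ then (Module.finrank F M.Mod : F) else 0 := by
  rw [char]
  split_ifs with h
  · have : Algebra.lsmul F F M.Mod a = LinearMap.id := LinearMap.ext fun x => by
      change a • x = x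
      rw [ha, if_pos h]
    rw [this, LinearMap.trace_id]
  · have : (Algebra.lsmul F F M.Mod a : M.Mod →ₗ[F] M.Mod) = 0 := LinearMap.ext fun x => by
      change a • x = 0
      rw [ha, if_neg h]
    rw [this, map_zero]

theorem Irr.finrank_ne_zero [Module.Finite F A] (M : Irr A) : Module.finrank F M.Mod ≠ 0 := by
  have := IsSimpleModule.nontrivial A M.Mod
  exact Module.finrank_pos.ne'

/-- The irreducible characters are linearly independent in characteristic `0`. -/
theorem Irr.eq_zero_of_sum_char [CharZero F] [Module.Finite F A] {c : Irr A → F}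
    (h : ∀ a, ∑ᶠ M : Irr A, c M * M.char F a = 0) : c = 0 := by
  classical
  have := Irr.finite F (A := A)
  have := Fintype.ofFinite (Irr A)
  funext M
  obtain ⟨a, ha⟩ := Irr.exists_smul_eq F M
  have h1 := h a
  rw [finsum_eq_sum_of_fintype, Finset.sum_eq_single M] at h1
  · rw [Irr.char_eq_ite F ha, if_pos rfl] at h1
    exact (mul_eq_zero.1 h1).resolve_right (Nat.cast_ne_zero.2 (Irr.finrank_ne_zero F M))
  · intro M' _ hne
    rw [Irr.char_eq_ite F ha, if_neg hne, mul_zero]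
  · simp

theorem Irr.ext_char [CharZero F] [Module.Finite F A] {M M' : Irr A}
    (h : ∀ a, M.char F a = M'.char F a) : M = M' := by
  classical
  by_contra hne
  obtain ⟨a, ha⟩ := Irr.exists_smul_eq F M
  have h1 := h a
  rw [Irr.char_eq_ite F ha, Irr.char_eq_ite F ha, if_pos rfl, if_neg (Ne.symm hne)] at h1
  exact Nat.cast_ne_zero.2 (Irr.finrank_ne_zero F M) h1

/-! ### Transport along isomorphisms of algebras -/

variable {F} {A' : Type*} [Ring A'] [Algebra F A']

/-- `M'` is the simple `A'`-module obtained from `M` by transport along `e`. -/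
def Irr.Rel (e : A ≃ₐ[F] A') (M : Irr A) (M' : Irr A') : Prop :=
  ∃ f : M.Mod ≃ₗ[F] M'.Mod, ∀ a x, f (a • x) = e a • f x

theorem Irr.Rel.symm {e : A ≃ₐ[F] A'} {M : Irr A} {M' : Irr A'} (h : Rel e M M') :
    Rel e.symm M' M := by
  obtain ⟨f, hf⟩ := h
  refine ⟨f.symm, fun a x => f.injective ?_⟩
  rw [hf, f.apply_symm_apply, f.apply_symm_apply, e.apply_symm_apply]

theorem Irr.Rel.left_unique {e : A ≃ₐ[F] A'} {M M₁ : Irr A} {M' : Irr A'} (h : Rel e M M')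
    (h₁ : Rel e M₁ M') : M = M₁ := by
  obtain ⟨f, hf⟩ := h
  obtain ⟨f₁, hf₁⟩ := h₁
  refine Irr.ext ⟨{ (f.trans f₁.symm).toAddEquiv with map_smul' := fun a x => ?_ }⟩
  change f₁.symm (f (a • x)) = a • f₁.symm (f x)
  apply f₁.injective
  rw [hf₁, f₁.apply_symm_apply, f₁.apply_symm_apply, hf]

theorem Irr.exists_rel (e : A ≃ₐ[F] A') (M' : Irr A') : ∃ M, Rel e M M' := by
  let : Module A M'.Mod := Module.compHom M'.Mod (e : A →+* A')
  have hsmul : ∀ (a : A) (x : M'.Mod), a • x = e a • x := fun _ _ => rfl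
  have : IsScalarTower F A M'.Mod := ⟨fun c a x => by
    rw [hsmul, hsmul, map_smul, smul_assoc]⟩
  have : IsSimpleModule A M'.Mod := by
    rw [isSimpleModule_iff_toSpanSingleton_surjective]
    refine ⟨IsSimpleModule.nontrivial A' M'.Mod, fun x hx y => ?_⟩
    obtain ⟨a, ha⟩ := IsSimpleModule.toSpanSingleton_surjective A' hx y
    refine ⟨e.symm a, ?_⟩
    rw [LinearMap.toSpanSingleton_apply, hsmul, e.apply_symm_apply]
    exact ha
  obtain ⟨M, ⟨f⟩⟩ := Irr.exists_linearEquiv (A := A) M'.Mod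
  exact ⟨M, f.restrictScalars F, fun a x => f.map_smul a x⟩

/-- The bijection between simple modules induced by an isomorphism of algebras. -/
def Irr.congr (e : A ≃ₐ[F] A') : Irr A ≃ Irr A' where
  toFun M := (exists_rel e.symm M).choose
  invFun M' := (exists_rel e M').choose
  left_inv M := (exists_rel e _).choose_spec.left_unique (exists_rel e.symm M).choose_spec.symm
  right_inv M' := (exists_rel e.symm _).choose_spec.left_unique (exists_rel e M').choose_spec.symm

theorem Irr.rel_congr (e : A ≃ₐ[F] A') (M : Irr A) : Rel e M (congr e M) :=
  (exists_rel e.symm M).choose_spec.symm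

theorem Irr.char_eq_of_linearEquiv {M : Irr A} {M' : Irr A'} (f : M.Mod ≃ₗ[F] M'.Mod)
    {a : A} {a' : A'} (hf : ∀ x, f (a • x) = a' • f x) : M'.char F a' = M.char F a := by
  have : (Algebra.lsmul F F M'.Mod a' : M'.Mod →ₗ[F] M'.Mod) =
      f.conj (Algebra.lsmul F F M.Mod a : M.Mod →ₗ[F] M.Mod) := by
    refine LinearMap.ext fun x => ?_
    rw [LinearEquiv.conj_apply_apply, Algebra.lsmul_coe, Algebra.lsmul_coe, hf,
      f.apply_symm_apply]
  rw [char, this, LinearMap.trace_conj']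
  rfl

theorem Irr.char_congr (e : A ≃ₐ[F] A') (M : Irr A) (a : A) :
    (congr e M).char F (e a) = M.char F a := by
  obtain ⟨f, hf⟩ := rel_congr e M
  exact char_eq_of_linearEquiv f (hf a)

theorem Irr.charpoly_congr (e : A ≃ₐ[F] A') (M : Irr A) (a : A) :
    (congr e M).charpoly F (e a) = M.charpoly F a := by
  obtain ⟨f, hf⟩ := rel_congr e M
  have : (Algebra.lsmul F F (congr e M).Mod (e a) : (congr e M).Mod →ₗ[F] (congr e M).Mod) =
      f.conj (Algebra.lsmul F F M.Mod a : M.Mod →ₗ[F] M.Mod) := by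
    refine LinearMap.ext fun x => ?_
    rw [LinearEquiv.conj_apply_apply, Algebra.lsmul_coe, Algebra.lsmul_coe, hf,
      f.apply_symm_apply]
  rw [charpoly, charpoly]
  by_cases h : Module.Finite F M.Mod
  · have h' : Module.Finite F (congr e M).Mod := Module.Finite.equiv f
    rw [dif_pos h, dif_pos h', this]
    exact f.charpoly_conj _
  · have h' : ¬ Module.Finite F (congr e M).Mod := fun h' => h (Module.Finite.equiv f.symm)
    rw [dif_neg h, dif_neg h']

theorem Irr.charpoly_ne_zero (M : Irr A) (a : A) : M.charpoly F a ≠ 0 := by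
  rw [charpoly]
  split_ifs with h
  · exact (LinearMap.charpoly_monic _).ne_zero
  · exact one_ne_zero

/-- The element `c • a` acts as `c` on `M₀` and as `0 ≠ c` elsewhere. The multiplicity of the root
`c` thus isolates the contribution of `M₀` to a product of characteristic polynomials. -/
theorem Irr.rootMultiplicity_charpoly [Module.Finite F A] {M₀ : Irr A} {a : A} {c : F} (hc : c ≠ 0)
    [DecidableEq (Irr A)]
    (ha : ∀ (M : Irr A) (x : M.Mod), a • x = if M = M₀ then x else 0) (M : Irr A) :
    (M.charpoly F (c • a)).rootMultiplicity c ≠ 0 ↔ M = M₀ := by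
  rw [charpoly, dif_pos (Irr.finite_mod F M), ne_eq,
    Polynomial.rootMultiplicity_eq_zero_iff, not_forall]
  rw [exists_prop, ← ne_eq, and_iff_left (LinearMap.charpoly_monic _).ne_zero,
    ← Module.End.hasEigenvalue_iff_isRoot_charpoly]
  have hact : ∀ x : M.Mod, Algebra.lsmul F F M.Mod (c • a) x = if M = M₀ then c • x else 0 := by
    intro x
    change (c • a) • x = _
    rw [smul_assoc, ha]
    split_ifs
    · rfl
    · exact smul_zero c
  constructor
  · intro h
    obtain ⟨x, hx⟩ := h.exists_hasEigenvector
    by_contra hne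
    have h1 := hx.apply_eq_smul
    rw [hact, if_neg hne] at h1
    exact (smul_ne_zero hc hx.2) h1.symm
  · intro h
    have := IsSimpleModule.nontrivial A M.Mod
    obtain ⟨x, hx⟩ := exists_ne (0 : M.Mod)
    refine Module.End.hasEigenvalue_of_hasEigenvector (x := x) ⟨?_, hx⟩
    rw [Module.End.mem_eigenspace_iff, hact, if_pos h]

end Simple

end CycHecke
end

/-! ### Uniqueness of labels, Schur elements, decomposition numbers and basic sets -/

noncomputable section

namespace CycHecke

/-- A value over `K(y)` then determines its Laurent polynomial, and so its specializations. After
multiplication by a power of `y` the map is the inclusion of polynomials over `ℤ_K` into `K(y)`. -/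
theorem toKy_injective (K : Type*) [Field K] : Function.Injective (toKy K) := by
  rw [injective_iff_map_eq_zero]
  intro f hf
  obtain ⟨k, p, hp⟩ := LaurentPolynomial.exists_T_pow f
  have h1 : ∀ q : Polynomial (𝓞 K), toKy K (Polynomial.toLaurent q) =
      algebraMap (Polynomial K) (RatFunc K) (q.map (algebraMap (𝓞 K) K)) := by
    intro q
    change ((toKy K).comp Polynomial.toLaurent) q =
      ((algebraMap (Polynomial K) (RatFunc K)).comp
        (Polynomial.mapRingHom (algebraMap (𝓞 K) K))) q
    congr 1
    refine Polynomial.ringHom_ext (fun a => ?_) ?_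
    · simp only [RingHom.comp_apply, Polynomial.toLaurent_C, Polynomial.coe_mapRingHom,
        Polynomial.map_C, toKy, LaurentPolynomial.eval₂_C]
      rw [RatFunc.algebraMap_C, ← RatFunc.algebraMap_eq_C,
        ← IsScalarTower.algebraMap_apply (𝓞 K) K (RatFunc K)]
    · simp [toKy]
  have h2 : toKy K (Polynomial.toLaurent p) = 0 := by rw [hp, map_mul, hf, zero_mul]
  rw [h1, map_eq_zero_iff _ (FaithfulSMul.algebraMap_injective _ _),
    Polynomial.map_eq_zero_iff (FaithfulSMul.algebraMap_injective (𝓞 K) K)] at h2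
  rw [h2, map_zero] at hp
  exact (LaurentPolynomial.isUnit_T _).mul_left_eq_zero.1 hp.symm

theorem Irr.ext_char_group {K : Type*} [Field K] [CharZero K] {G : Type*} [Group G] [Finite G]
    {L L' : Irr (MonoidAlgebra K G)}
    (h : ∀ w : G, L.char K (MonoidAlgebra.of K G w) = L'.char K (MonoidAlgebra.of K G w)) :
    L = L' := by
  refine Irr.ext_char K fun a => ?_
  induction a using MonoidAlgebra.induction_on with
  | of w => exact h w
  | add a b ha hb => rw [Irr.char_add, Irr.char_add, ha, hb]
  | smul r a ha => rw [Irr.char_smul, Irr.char_smul, ha]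

/-- As `k` is the field of fractions of the image of `θ`, every element of `k ℋ` comes from `ℋ`
after multiplication by a common denominator. -/
theorem Hecke.exists_spec_eq_smul {K : Type*} [Field K] [Algebra K ℂ] {n : ℕ}
    {W : Subgroup (GL (Fin n) K)} {x₀ : Vreg W} {S : Type*} [CommRing S] {k : Type*} [Field k] {θ : S →+* k}
    (hθ : ∀ z : k, ∃ a b, θ b ≠ 0 ∧ z = θ a / θ b) (u : Param W S) (a : Hecke x₀ (u.map θ)) :
    ∃ c h, θ c ≠ 0 ∧ Hecke.spec x₀ θ u h = θ c • a := by
  induction a using Hecke.induction with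
  | hT b => exact ⟨1, T x₀ u b, by simp, by rw [Hecke.spec_T, map_one, one_smul]⟩
  | hadd a b ha hb =>
    obtain ⟨c, h, hc, hh⟩ := ha
    obtain ⟨c', h', hc', hh'⟩ := hb
    refine ⟨c * c', c' • h + c • h', by rw [map_mul]; exact mul_ne_zero hc hc', ?_⟩
    rw [map_add, Hecke.spec_smul, Hecke.spec_smul, hh, hh', smul_smul, smul_smul, map_mul,
      mul_comm (θ c'), smul_add]
  | hsmul r a ha =>
    obtain ⟨c, h, hc, hh⟩ := ha
    obtain ⟨p, q, hq, rfl⟩ := hθ r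
    refine ⟨q * c, p • h, by rw [map_mul]; exact mul_ne_zero hq hc, ?_⟩
    rw [Hecke.spec_smul, hh, smul_smul, smul_smul, map_mul]
    congr 1
    field_simp

section Unique

variable {K : Type*} [Field K] [Algebra K ℂ] {n : ℕ}
  {W : Subgroup (GL (Fin n) K)} {x₀ : Vreg W}

/-- Take an element of `ℋ_𝐦` whose image is a non-zero multiple `θ(c)` of the separating element for
`M`. The multiplicity of the root `θ(c)` in the reduced polynomial is `d_{U,M}` times a positive
number independent of `d`. -/
theorem IsDecompositionMatrix.unique [Finite W]
    (hfree : Nonempty (Module.Basis W (GenRing W) (Hecke x₀ (genParam W))))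
    {k : Type*} [Field k] {θ : (𝓞 K)[T;T⁻¹] →+* k}
    (hθ : ∀ z : k, ∃ a b, θ b ≠ 0 ∧ z = θ a / θ b) {m : Weights W}
    {d d' : Irr (HeckeK x₀ m) → Irr (Heckek x₀ θ m) → ℕ} (h : IsDecompositionMatrix x₀ θ m d)
    (h' : IsDecompositionMatrix x₀ θ m d') : d = d' := by
  classical
  have := Hecke.finite hfree ((cycParam m).map θ)
  have := Irr.finite k (A := Heckek x₀ θ m)
  have := Fintype.ofFinite (Irr (Heckek x₀ θ m))
  funext U M
  obtain ⟨a, ha⟩ := Irr.exists_smul_eq k M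
  obtain ⟨c, x, hc, hx⟩ := Hecke.exists_spec_eq_smul hθ (cycParam m) a
  obtain ⟨P, hP, hPd⟩ := h U x
  obtain ⟨P', hP', hPd'⟩ := h' U x
  obtain rfl := Polynomial.map_injective _ (toKy_injective K) (hP.trans hP'.symm)
  have h1 := hPd.symm.trans hPd'
  rw [hx, finprod_eq_prod_of_fintype, finprod_eq_prod_of_fintype] at h1
  have hroot : ∀ e : Irr (Heckek x₀ θ m) → ℕ,
      (∏ M, M.charpoly k (θ c • a) ^ e M).rootMultiplicity (θ c) =
        e M * (M.charpoly k (θ c • a)).rootMultiplicity (θ c) := by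
    intro e
    rw [← Polynomial.count_roots, Polynomial.roots_prod _ _ (Finset.prod_ne_zero_iff.2
      fun M _ => pow_ne_zero _ (Irr.charpoly_ne_zero M _)), Multiset.count_bind]
    simp only [Polynomial.roots_pow, Multiset.count_nsmul, Polynomial.count_roots]
    refine Finset.sum_eq_single M (fun M' _ hne => ?_) (by simp)
    rw [not_not.1 (mt (Irr.rootMultiplicity_charpoly hc ha M').1 hne), mul_zero]
  have h2 := congrArg (fun p => Polynomial.rootMultiplicity (θ c) p) h1
  beta_reduce at h2
  rw [hroot, hroot] at h2
  exact Nat.eq_of_mul_eq_mul_right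
    (Nat.pos_of_ne_zero ((Irr.rootMultiplicity_charpoly hc ha M).2 rfl)) h2

variable [NumberField K]

theorem TitsCorresponds.unique [Finite W] {m : Weights W} {U : Irr (HeckeK x₀ m)}
    {L L' : Irr (MonoidAlgebra K W)} (h : TitsCorresponds x₀ m U L)
    (h' : TitsCorresponds x₀ m U L') : L = L' := by
  refine Irr.ext_char_group fun w => ?_
  obtain ⟨γ⟩ := vreg_joined x₀ (vregAct w x₀)
  obtain ⟨P, hP, hP1⟩ := h w _ rfl γ
  obtain ⟨P', hP', hP1'⟩ := h' w _ rfl γ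
  rw [← hP1, ← hP1', toKy_injective K (hP.trans hP'.symm)]

theorem IsSchurFamily.unique [Finite W]
    (hfree : Nonempty (Module.Basis W (GenRing W) (Hecke x₀ (genParam W))))
    {t : Hecke x₀ (genParam W) →ₗ[GenRing W] GenRing W} {m : Weights W}
    {s s' : Irr (HeckeK x₀ m) → RatFunc K} (h : IsSchurFamily x₀ t m s)
    (h' : IsSchurFamily x₀ t m s') : s = s' := by
  have := Hecke.finite hfree ((cycParam m).map (toKy K))
  have := Irr.finite (RatFunc K) (A := HeckeK x₀ m)
  have := Fintype.ofFinite (Irr (HeckeK x₀ m))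
  have hz : (fun U => (s U)⁻¹ - (s' U)⁻¹) = 0 := by
    refine Irr.eq_zero_of_sum_char (RatFunc K) fun a => ?_
    rw [finsum_eq_sum_of_fintype]
    induction a using Hecke.induction with
    | hT b =>
      have h1 := (h.2 b).symm.trans (h'.2 b)
      rw [finsum_eq_sum_of_fintype, finsum_eq_sum_of_fintype] at h1
      simp only [sub_mul, Finset.sum_sub_distrib]
      rw [h1, sub_self]
    | hadd a b ha hb =>
      simp only [Irr.char_add, mul_add, Finset.sum_add_distrib]
      rw [ha, hb, add_zero]
    | hsmul r a ha =>
      simp only [Irr.char_smul, mul_left_comm _ r]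
      rw [← Finset.mul_sum, ha, mul_zero]
  funext U
  exact inv_injective (sub_eq_zero.1 (congrFun hz U))

/-- Once `V`, `s` and `d` agree, two different choices of `λ_M` would each have strictly smaller
`a`-value than the other. -/
theorem IsBasicSet.unique [Finite W]
    (hfree : Nonempty (Module.Basis W (GenRing W) (Hecke x₀ (genParam W))))
    {t : Hecke x₀ (genParam W) →ₗ[GenRing W] GenRing W}
    {Λ : Type*} {ι : Λ ≃ Irr (MonoidAlgebra K W)} {k : Type*} [Field k]
    {θ : (𝓞 K)[T;T⁻¹] →+* k} (hθ : ∀ z : k, ∃ a b, θ b ≠ 0 ∧ z = θ a / θ b) {m : Weights W}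
    {𝓑 𝓑' : Set Λ} (h : IsBasicSet x₀ t ι θ m 𝓑) (h' : IsBasicSet x₀ t ι θ m 𝓑') : 𝓑 = 𝓑' := by
  obtain ⟨V, s, d, hV, hVL, hs, hd, l, hl, hB⟩ := h
  obtain ⟨V', s', d', hV', hVL', hs', hd', l', hl', hB'⟩ := h'
  obtain rfl := hs.unique hfree hs'
  obtain rfl := hd.unique hfree hθ hd'
  obtain rfl : V = V' := by
    funext μ
    obtain ⟨ν, hν⟩ := hV.2 (V' μ)
    have h1 := hVL ν
    rw [hν] at h1
    rw [← hν, ι.injective (h1.unique (hVL' μ))]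
  have : l = l' := by
    funext M
    by_contra hne
    have h1 := (hl M).2 (l' M) (Ne.symm hne) (by rw [(hl' M).1]; exact one_ne_zero)
    have h2 := (hl' M).2 (l M) hne (by rw [(hl M).1]; exact one_ne_zero)
    exact lt_asymm h1 h2
  rw [← hB.image_eq, ← hB'.image_eq, this]

end Unique

end CycHecke
end

/-! ### Twisting by linear characters and the main theorem -/

noncomputable section

namespace CycHecke

/-- A linear character of the braid group that is trivial on the pure braids factors
through `W`. -/
theorem exists_monoidHom_of_liftsTo {K : Type*} [Field K] [Algebra K ℂ] {n : ℕ}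
    {W : Subgroup (GL (Fin n) K)} [Finite W] {x₀ : Vreg W} {Z : Type*} [CommGroup Z]
    (χ : Braid x₀ →* Z) (hχ : ∀ b, LiftsTo b 1 → χ b = 1) :
    ∃ ε : W →* Z, ∀ b w, LiftsTo b w → ε w = χ b := by
  choose β hβ using exists_liftsTo (W := W) x₀
  have huniq : ∀ b b' w, LiftsTo b w → LiftsTo b' w → χ b = χ b' := by
    intro b b' w h h'
    have h1 := hχ (b * b'⁻¹) (by simpa using h.mul h'.inv)
    rwa [map_mul, map_inv, mul_inv_eq_one] at h1
  refine ⟨MonoidHom.mk' (fun w => χ (β w)) fun v w => ?_, fun b w h => huniq _ _ _ (hβ w) h⟩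
  rw [← map_mul]
  exact huniq _ _ _ (hβ _) ((hβ v).mul (hβ w))

/-- The endomorphism `w ↦ ε(w) w` of a group algebra. -/
def groupTwistHom {K G : Type*} [Field K] [Group G] (ε : G →* Kˣ) :
    MonoidAlgebra K G →ₐ[K] MonoidAlgebra K G :=
  MonoidAlgebra.lift K (MonoidAlgebra K G) G
    { toFun := fun w => (ε w : K) • MonoidAlgebra.of K G w
      map_one' := by rw [map_one, map_one, Units.val_one, one_smul]
      map_mul' := fun v w => by
        rw [map_mul, map_mul, Units.val_mul, smul_mul_smul_comm] }

theorem groupTwistHom_of {K G : Type*} [Field K] [Group G] (ε : G →* Kˣ) (w : G) :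
    groupTwistHom ε (MonoidAlgebra.of K G w) = (ε w : K) • MonoidAlgebra.of K G w :=
  MonoidAlgebra.lift_of _ _

theorem groupTwistHom_comp {K G : Type*} [Field K] [Group G] {ε ε' : G →* Kˣ} (h : ε * ε' = 1) :
    (groupTwistHom ε).comp (groupTwistHom ε') = AlgHom.id K (MonoidAlgebra K G) :=
  MonoidAlgebra.algHom_ext (single_one_left := Subsingleton.elim _ _) fun w => by
    change groupTwistHom ε (groupTwistHom ε' (MonoidAlgebra.of K G w)) = MonoidAlgebra.of K G w
    rw [groupTwistHom_of, map_smul, groupTwistHom_of, smul_smul, ← Units.val_mul, mul_comm,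
      ← MonoidHom.mul_apply, h, MonoidHom.one_apply, Units.val_one, one_smul]

/-- The automorphism `w ↦ ε(w) w` of a group algebra. -/
def groupTwist {K G : Type*} [Field K] [Group G] (ε : G →* Kˣ) :
    MonoidAlgebra K G ≃ₐ[K] MonoidAlgebra K G :=
  AlgEquiv.ofAlgHom (groupTwistHom ε) (groupTwistHom ε⁻¹)
    (groupTwistHom_comp (mul_inv_cancel ε)) (groupTwistHom_comp (inv_mul_cancel ε))

theorem groupTwist_of {K G : Type*} [Field K] [Group G] (ε : G →* Kˣ) (w : G) :
    groupTwist ε (MonoidAlgebra.of K G w) = (ε w : K) • MonoidAlgebra.of K G w :=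
  groupTwistHom_of ε w

/-- The tensor product with a linear character, on the simple modules of a group algebra. -/
def Irr.tensor {K G : Type*} [Field K] [Group G] (ε : G →* Kˣ) (L : Irr (MonoidAlgebra K G)) :
    Irr (MonoidAlgebra K G) :=
  Irr.congr (groupTwist ε⁻¹) L

/-- Transport along `w ↦ ε(w)⁻¹ w` makes `w` act as `ε(w) w` did before; this is why `Irr.tensor`
uses the inverse of `ε`. -/
theorem Irr.char_tensor {K G : Type*} [Field K] [Group G] (ε : G →* Kˣ)
    (L : Irr (MonoidAlgebra K G)) (w : G) :
    (Irr.tensor ε L).char K (MonoidAlgebra.of K G w) =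
      ε w * L.char K (MonoidAlgebra.of K G w) := by
  rw [← Irr.char_congr (groupTwist ε⁻¹) L, groupTwist_of, Irr.char_smul, ← mul_assoc,
    MonoidHom.inv_apply, Units.mul_inv, one_mul]
  rfl

section Main

variable {K : Type*} [Field K] [Algebra K ℂ] {n : ℕ}
  {W : Subgroup (GL (Fin n) K)} {x₀ : Vreg W}

/-- Multiplying the character value on `T_b` by `χ(b)` before specialization multiplies it at `y =
1` by the value of `χ(b)` there, so Tits' correspondence is compatible with twists. -/
theorem TitsCorresponds.twist {m m' : Weights W} {U : Irr (HeckeK x₀ m)}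
    {U' : Irr (HeckeK x₀ m')} {L L' : Irr (MonoidAlgebra K W)} (χ : Braid x₀ →* ((𝓞 K)[T;T⁻¹])ˣ)
    (hU : ∀ b, U'.char (RatFunc K) (T x₀ _ b) = toKy K (χ b) * U.char (RatFunc K) (T x₀ _ b))
    (hL : ∀ b w, LiftsTo b w → L'.char K (MonoidAlgebra.of K W w) =
      atOne K (χ b) * L.char K (MonoidAlgebra.of K W w))
    (h : TitsCorresponds x₀ m U L) : TitsCorresponds x₀ m' U' L' := by
  intro w y hy γ
  obtain ⟨P, hP, hP1⟩ := h w y hy γ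
  refine ⟨χ (ofLoop (projLoop w hy γ)) * P, ?_, ?_⟩
  · rw [map_mul, hP, hU]
  · rw [map_mul, hP1, hL _ w ⟨y, hy, γ, rfl⟩]

variable [Finite W] {ℓ : HypOrbit W → Braid x₀ →* Multiplicative ℤ}

theorem Affords.char_eq (hℓ : IsBraidLength ℓ) {g : ShiftGroup W} {m : Weights W}
    {U' : Irr (HeckeK x₀ m)} {U : Irr (HeckeK x₀ (shift g m))}
    (h : Affords x₀ g m (twistEquiv (compat_cycParam hℓ g m)) U' U) (b : Braid x₀) :
    U'.char (RatFunc K) (T x₀ _ b) =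
      toKy K (braidChar ℓ (cycScalar g) b : ((𝓞 K)[T;T⁻¹])ˣ) *
        U.char (RatFunc K) (T x₀ _ b) := by
  obtain ⟨f, hf⟩ := h
  have h1 := Irr.char_eq_of_linearEquiv f (hf (T x₀ _ b))
  rw [twistEquiv_T, Hecke.spec_smul, Hecke.spec_T, Hecke.spec_T, Irr.char_smul] at h1
  exact h1.symm

variable [NumberField K]

/-- The image of a basic set under a shift of the weights. -/
theorem IsBasicSet.shift (hℓ : IsBraidLength ℓ)
    (hfree : Nonempty (Module.Basis W (GenRing W) (Hecke x₀ (genParam W))))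
    {t : Hecke x₀ (genParam W) →ₗ[GenRing W] GenRing W} (ht : IsCanonicalForm x₀ t)
    (ht_unique : ∀ t', IsCanonicalForm x₀ t' → t' = t)
    {Λ : Type*} {ι : Λ ≃ Irr (MonoidAlgebra K W)} {k : Type*} [Field k]
    {θ : (𝓞 K)[T;T⁻¹] →+* k} {m : Weights W} {𝓑 : Set Λ} (h : IsBasicSet x₀ t ι θ m 𝓑)
    (g : ShiftGroup W) (σ : Λ ≃ Λ)
    (hσ : ∀ l b w, LiftsTo b w → (ι (σ l)).char K (MonoidAlgebra.of K W w) =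
      atOne K (braidChar ℓ (cycScalar g) b : ((𝓞 K)[T;T⁻¹])ˣ) *
        (ι l).char K (MonoidAlgebra.of K W w)) :
    IsBasicSet x₀ t ι θ (CycHecke.shift g m) (Set.image σ.symm 𝓑) := by
  obtain ⟨V, s, d, hV, hVL, hs, hd, l, hl, hB⟩ := h
  let χ : Braid x₀ →* ((𝓞 K)[T;T⁻¹])ˣ := braidChar ℓ (cycScalar g)
  have hc := compat_cycParam hℓ g m
  let E := Irr.congr (twistEquiv (hc.map (toKy K)))
  let Ek := Irr.congr (twistEquiv (hc.map θ))
  have hE : ∀ U b, U.char (RatFunc K) (T x₀ _ b) =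
      toKy K (χ b) * (E U).char (RatFunc K) (T x₀ _ b) := by
    intro U b
    rw [← Irr.char_congr (twistEquiv (hc.map (toKy K))) U, twistEquiv_T, Irr.char_smul]
    rfl
  have hE' : ∀ U b, (E U).char (RatFunc K) (T x₀ _ b) =
      toKy K (χ⁻¹ b : ((𝓞 K)[T;T⁻¹])ˣ) * U.char (RatFunc K) (T x₀ _ b) := by
    intro U b
    rw [hE, ← mul_assoc, ← map_mul, MonoidHom.inv_apply, Units.inv_mul, map_one, one_mul]
  -- All data for `𝐠.𝐦` are those for `𝐦` carried along the isomorphism. The module labelled `μ` is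
  -- the transport of the one labelled `σ μ`, so `λ_M` is moved by `σ⁻¹`.
  refine ⟨fun μ => E (V (σ μ)), fun U => s (E.symm U), fun U M => d (E.symm U) (Ek.symm M),
    E.bijective.comp (hV.comp σ.bijective), fun μ => ?_, ⟨fun U => hs.1 _, fun b => ?_⟩,
    fun U x => ?_, fun M => σ.symm (l (Ek.symm M)), fun M => ⟨?_, fun μ hμ hd0 => ?_⟩, ?_⟩
  · refine (hVL (σ μ)).twist χ⁻¹ (hE' _) fun b w hb => ?_
    rw [hσ μ b w hb, ← mul_assoc, ← map_mul, MonoidHom.inv_apply, Units.inv_mul, map_one, one_mul]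
  -- The form and the characters change by the same factor `χ(b)`, so the Schur elements, hence the
  -- `a`-values, do not change.
  · have h1 := hs.2 b
    rw [ht.genEval_cycParam_shift ht_unique hfree inferInstance hℓ g, map_mul] at h1
    have h2 := congrArg (toKy K (χ⁻¹ b : ((𝓞 K)[T;T⁻¹])ˣ) * ·) h1
    beta_reduce at h2
    rw [← mul_assoc, ← map_mul, MonoidHom.inv_apply, Units.inv_mul, map_one, one_mul] at h2
    rw [h2, mul_finsum, ← finsum_comp_equiv E]
    refine finsum_congr fun U => ?_
    beta_reduce
    rw [E.symm_apply_apply, hE', mul_left_comm]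
    rfl
  -- The twist commutes with both specializations, so the polynomial of the preimage of `x` serves
  -- again.
  · obtain ⟨y, rfl⟩ := (twistEquiv hc).surjective x
    obtain ⟨P, hP, hP'⟩ := hd (E.symm U) y
    refine ⟨P, ?_, ?_⟩
    · obtain ⟨U, rfl⟩ := E.surjective U
      rw [hP, E.symm_apply_apply, ← twistEquiv_spec]
      exact (Irr.charpoly_congr _ _ _).symm
    · rw [hP', ← finprod_comp_equiv Ek]
      refine finprod_congr fun M => ?_
      beta_reduce
      rw [Ek.symm_apply_apply, ← twistEquiv_spec]
      congr 1
      exact (Irr.charpoly_congr _ _ _).symm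
  · beta_reduce
    rw [σ.apply_symm_apply, E.symm_apply_apply]
    exact (hl _).1
  · beta_reduce at hd0 hμ ⊢
    rw [σ.apply_symm_apply, E.symm_apply_apply, E.symm_apply_apply]
    rw [E.symm_apply_apply] at hd0
    exact (hl _).2 (σ μ) (fun h => hμ (by rw [← h, σ.symm_apply_apply])) hd0
  · have hB' : Set.BijOn (l ∘ Ek.symm) Set.univ 𝓑 := hB.comp (Set.bijOn_univ.2 Ek.symm.bijective)
    exact (σ.symm.injective.injOn.bijOn_image (s := 𝓑)).comp hB'

/-- The character `χ` has constant values, trivial on pure braids, so it gives a linear character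
`ε_𝐠` of `W`, multiplicative in `𝐠`. The action on labels is the tensor product with `ε_𝐠`, which
makes it visibly independent of `𝐦`. -/
theorem exists_labelAction (hℓ : IsBraidLength ℓ) {Λ : Type*}
    (ι : Λ ≃ Irr (MonoidAlgebra K W)) :
    ∃ σ : ShiftGroup W → Λ → Λ, (∀ l, σ 0 l = l) ∧ (∀ g g' l, σ (g + g') l = σ g (σ g' l)) ∧
      ∀ g l b w, LiftsTo b w → (ι (σ g l)).char K (MonoidAlgebra.of K W w) =
        atOne K (braidChar ℓ (cycScalar g) b : ((𝓞 K)[T;T⁻¹])ˣ) *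
          (ι l).char K (MonoidAlgebra.of K W w) := by
  have hatOne : ∀ (g : ShiftGroup W) (b : Braid x₀),
      atOne K (braidChar ℓ (cycScalar g) b : ((𝓞 K)[T;T⁻¹])ˣ) =
        Units.map (algebraMap (𝓞 K) K : 𝓞 K →* K) (braidChar ℓ (shiftScalar g) b) := by
    intro g b
    have : braidChar ℓ (cycScalar g) b =
        Units.map (LaurentPolynomial.C : 𝓞 K →+* (𝓞 K)[T;T⁻¹]) (braidChar ℓ (shiftScalar g) b) :=
      (map_braidChar _ _ _).symm
    rw [this, Units.coe_map, atOne]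
    exact LaurentPolynomial.eval₂_C _ _ _
  choose ε hε using fun g : ShiftGroup W => exists_monoidHom_of_liftsTo
    ((Units.map (algebraMap (𝓞 K) K : 𝓞 K →* K)).comp (braidChar ℓ (shiftScalar g)))
    (fun b hb => by
      rw [MonoidHom.comp_apply, braidChar_eq_one hℓ (shiftScalar_pow g) hb, map_one])
  have hε_add : ∀ g g', ε (g + g') = ε g * ε g' := by
    intro g g'
    refine MonoidHom.ext fun w => ?_
    obtain ⟨b, hb⟩ := exists_liftsTo x₀ w
    rw [MonoidHom.mul_apply, hε _ b w hb, hε _ b w hb, hε _ b w hb, shiftScalar_add,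
      braidChar_mul]
    exact map_mul (Units.map (algebraMap (𝓞 K) K : 𝓞 K →* K)) _ _
  have hε_zero : ε 0 = 1 := by
    have := hε_add 0 0
    rwa [add_zero, left_eq_mul] at this
  have hσ : ∀ g l w, (ι (ι.symm (Irr.tensor (ε g) (ι l)))).char K (MonoidAlgebra.of K W w) =
      ε g w * (ι l).char K (MonoidAlgebra.of K W w) := fun g l w => by
    rw [ι.apply_symm_apply, Irr.char_tensor]
  refine ⟨fun g l => ι.symm (Irr.tensor (ε g) (ι l)), fun l => ?_, fun g g' l => ?_,
    fun g l b w hb => ?_⟩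
  · refine ι.injective (Irr.ext_char_group fun w => ?_)
    rw [hσ, hε_zero, MonoidHom.one_apply, Units.val_one, one_mul]
  · refine ι.injective (Irr.ext_char_group fun w => ?_)
    rw [hσ, hσ, hσ, hε_add, MonoidHom.mul_apply, Units.val_mul, mul_assoc]
  · rw [hσ, hatOne, hε g b w hb]
    rfl

end Main

end CycHecke

end

open CycHecke in
theorem mainTheorem2
    {K : Type*} [Field K] [NumberField K] [IsAbelianGalois ℚ K] [Algebra K ℂ]
    {n : ℕ} (W : Subgroup (Matrix.GeneralLinearGroup (Fin n) K)) [Finite W]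
    (hgen : Subgroup.closure {w | w ∈ W ∧ IsPseudoReflection w} = W)
    (hirr : ActsIrreducibly W)
    (x₀ : Vreg W)
    (hfree : Nonempty (Module.Basis W (GenRing W) (Hecke x₀ (genParam W))))
    (t : Hecke x₀ (genParam W) →ₗ[GenRing W] GenRing W)
    (ht : IsCanonicalForm x₀ t)
    (ht_unique : ∀ t', IsCanonicalForm x₀ t' → t' = t)
    {Λ : Type*} (ι : Λ ≃ Irr (MonoidAlgebra K W))
    {k : Type*} [Field k] (θ : (𝓞 K)[T;T⁻¹] →+* k)
    (hθ : ∀ z : k, ∃ a b, θ b ≠ 0 ∧ z = θ a / θ b)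
    (m : Weights W)
    (hsplit : IsSplit k (Heckek x₀ θ m))
    (𝓑 : Set Λ) (h𝓑 : IsBasicSet x₀ t ι θ m 𝓑) :
    ∃ (Γ : ∀ (g : ShiftGroup W) (m' : Weights W),
        HeckeCyc x₀ m' ≃ₐ[(𝓞 K)[T;T⁻¹]] HeckeCyc x₀ (shift g m'))
      (σ : ShiftGroup W → Λ → Λ),
      (∀ g m', IsGamma x₀ g m' (Γ g m')) ∧
      IsInducedAction x₀ ι Γ σ ∧
      ∀ g : ShiftGroup W,
        (∃ 𝓑' : Set Λ, IsBasicSet x₀ t ι θ (shift g m) 𝓑') ∧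
        ∀ 𝓑' : Set Λ, IsBasicSet x₀ t ι θ (shift g m) 𝓑' →
          𝓑' = {μ | ∃ l ∈ 𝓑, μ = σ (-g) l} := by
  obtain ⟨ℓ, h1, h2, h3⟩ := exists_braidLength hgen x₀
  have hℓ : IsBraidLength ℓ := ⟨h1, h2, h3⟩
  obtain ⟨σ, hσ0, hσadd, hσ⟩ := exists_labelAction hℓ ι
  refine ⟨fun g m' => twistEquiv (compat_cycParam hℓ g m'), σ, fun g m' C s hs => ?_,
    ⟨hσ0, hσadd, fun g m' l U U' hU haff => ?_⟩, fun g => ?_⟩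
  · rw [twistEquiv_T, braidChar_of_isBraidReflection hℓ _ hs]
    rfl
  · exact hU.twist _ (haff.char_eq hℓ) (hσ g l)
  -- The action law makes `σ (-g)` the inverse of `σ g`, so the image under `e.symm` is the set in
  -- the statement.
  · let e : Λ ≃ Λ :=
      { toFun := σ g
        invFun := σ (-g)
        left_inv := fun l => by rw [← hσadd, neg_add_cancel, hσ0]
        right_inv := fun l => by rw [← hσadd, add_neg_cancel, hσ0] }
    have hB := h𝓑.shift hℓ hfree ht ht_unique g e (hσ g)
    refine ⟨⟨_, hB⟩, fun 𝓑' h𝓑' => ?_⟩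
    rw [h𝓑'.unique hfree hθ hB]
    ext μ
    constructor
    · rintro ⟨l, hl, rfl⟩
      exact ⟨l, hl, rfl⟩
    · rintro ⟨l, hl, rfl⟩
      exact ⟨l, hl, rfl⟩
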